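/- **Setting.** Let $M$ be a non-empty smooth (Hausdorff, second countable) four-manifold and $\mathfrak v$ the Lie algebra of (complexified) vector fields on $M$, acting on differential forms by Lie derivative and on $\mathfrak v$ by the bracket. Let $\mathcal F=\mathsf f^k\otimes\mathsf f_k\in (U\mathfrak v\otimes U\mathfrak v)[[\hbar]]$ be a Drinfel'd twist: an invertible element with $(\mathcal F\otimes1)(\Delta\otimes\mathrm{id})\mathcal F=(1\otimes\mathcal F)(\mathrm{id}\otimes\Delta)\mathcal F$ and $(\varepsilon\otimes\mathrm{id})\mathcal F=1=(\mathrm{id}\otimes\varepsilon)\mathcal F$. Write $v\otimes_\star w=\mathcal F^{-1}(v\otimes w)$; a $\star$ on a bilinear product $B$ means $B_\star(v,w)=B(v\otimes_\star w)$. Let $\mathcal R=\mathcal F_{21}\mathcal F^{-1}=\mathsf R^k\otimes\mathsf R_k$. Fix signs $\eta_1,\dots,\eta_4\in\{\pm1\}$, let $W$ be the vector space with orthonormal basis ${\tt E}_a$ of signature $\eta$ and $\mathfrak g=\mathfrak{so}(W)$, which acts on $\bigwedge^kW$ by derivations (denoted $\triangleright$, or $\wedge$ for $k=1$) and is identified with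 $\bigwedge^2W$ by $X\mapsto\sum_{a,b}X^a{}_b\,\eta_b\,{\tt E}_a\wedge{\tt E}_b$ ($\eta=(1,1,1,1)$ is the Euclidean case $\mathfrak{so}(4)$; vector spaces are complexified). For forms with values in multivectors, $\curlywedge$ is the exterior product of forms times the exterior product of multivectors. Let $\Lambda\in\mathbb R$. Gauge parameters are $\lambda=(\xi,\rho)\in(\mathfrak v\times\Omega^0(M,\mathfrak g))[[\hbar]]$ and fields are $A=(e,\omega)\in(\Omega^1(M,W)\times\Omega^1(M,\mathfrak g))[[\hbar]]$. The classical brackets are $$\ell_1(\xi,\rho)=(0,\mathrm d\rho),\qquad \ell_2\big((\xi,\rho),(e,\omega)\big)=(-\rho\, e+\mathrm L_\xi e,\,-[\rho,\omega]+\mathrm L_\xi\omega),$$ $$\ell_2(A_1,A_2)=-(e_1\curlywedge\mathrm d\omega_2+e_2\curlywedge\mathrm d\omega_1,\; e_1\curlywedge\mathrm de_2+e_2\curlywedge\mathrm de_1),$$ $$\ell_3(A_1,A_2,A_3)=-\Big(e_1\curlywedge[\omega_2,\omega_3]+e_2\curlywedge[\omega_1,\omega_3]+e_3\curlywedge[\omega_1,\omega_2]+6\Lambda\,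 e_1\curlywedge e_2\curlywedge e_3,\ \sum_{\sigma\in S_3}e_{\sigma(1)}\curlywedge(\omega_{\sigma(2)}\wedge e_{\sigma(3)})\Big),$$ with $\ell_1=0$ on fields. The braided brackets are $\ell_2^\star(v,w)=\ell_2(v\otimes_\star w)$ and $\ell_3^\star(u,v,w)=\ell_3(u\otimes_\star(v\otimes_\star w))$, and the braided field equations of four-dimensional Einstein–Cartan–Palatini gravity are $F^\star_A=(F^\star_e,F^\star_\omega)=0$ with $$F^\star_A:=-\tfrac12\,\ell_2^\star(A,A)-\tfrac16\,\ell_3^\star(A,A,A)\ \in\ \big(\Omega^3(M,\textstyle\bigwedge^3W)\times\Omega^3(M,\bigwedge^2W)\big)[[\hbar]] .$$ Let $R^\star=\mathrm d\omega+\tfrac12[\omega,\omega]^\star$, $T^\star_L=\mathrm de+\omega\wedge_\star e$, $T^\star_R=\mathrm de+\mathsf R_k(\omega)\wedge_\star\mathsf R^k(e)$, $\mathrm d^\omega_{\star L}\Phi=\mathrm d\Phi+\omega\triangleright_\star\Phi$, $\mathrm d^\omega_{\star R}\Phi=\mathrm d\Phi+\mathsf R_k(\omega)\triangleright_\star\mathsf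 R^k(\Phi)$. The left braided gauge variation of a field is $\delta_\lambda A=\ell_1(\lambda)+\ell_2^\star(\lambda,A)$. It extends to expressions $b(A,A)+t(A,A,A)$ by the braided Leibniz rule $$b(\delta_\lambda A,A)+b(\mathsf R_kA,\delta_{\mathsf R^k\lambda}A)+t(\delta_\lambda A,A,A)+t(\mathsf R_kA,\delta_{\mathsf R^k\lambda}A,A)+t(\mathsf R_kA,\mathsf R_lA,\delta_{\mathsf R^l\mathsf R^k\lambda}A),$$ where the order of the arguments is the order in which the fields enter before any braiding (so $\mathsf R_k(\omega)\wedge_\star\mathsf R^k(e)$ has $e$ before $\omega$, $\mathsf R_k(\omega)\triangleright_\star\mathsf R^k(e\curlywedge_\star e)$ has both $e$'s before $\omega$, and $\mathsf R_k(e)\curlywedge_\star[\mathsf R^k(\omega),\omega]^\star$ has the order $\omega,e,\omega$). An expression $\Phi$ with values in $\Omega^3(M,\bigwedge^kW)[[\hbar]]$ is *braided covariant* if $\delta_{(\xi,\rho)}\Phi=-\rho\triangleright_\star\Phi+\mathrm L^\star_\xi\Phi$ for all $\xi,\rho,e,\omega$. **Theorem.** 1. (Torsion equation) For all $(e,\omega)$,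 $$F^\star_\omega=\tfrac16\big(e\curlywedge_\star T^\star_L-T^\star_R\curlywedge_\star e-\mathrm d^\omega_{\star L}(e\curlywedge_\star e)-\mathrm d^\omega_{\star R}(e\curlywedge_\star e)\big).$$ 2. (Einstein equation) For all $(e,\omega)$, $$F^\star_e=\tfrac16\big(2\,e\curlywedge_\star R^\star+2\,R^\star\curlywedge_\star e+6\Lambda\,e\curlywedge_\star e\curlywedge_\star e+e\curlywedge_\star\mathrm d\omega+\mathrm d\omega\curlywedge_\star e+\mathsf R_k(e)\curlywedge_\star[\mathsf R^k(\omega),\omega]^\star\big).$$ 3. (Covariance) $F^\star_\omega$ and $F^\star_e$ are braided covariant, and so is each of $e\curlywedge_\star T^\star_L$, $T^\star_R\curlywedge_\star e$, $\mathrm d^\omega_{\star L}(e\curlywedge_\star e)$, $\mathrm d^\omega_{\star R}(e\curlywedge_\star e)$, $e\curlywedge_\star R^\star$, $R^\star\curlywedge_\star e$, $e\curlywedge_\star e\curlywedge_\star e$. The combination $e\curlywedge_\star\mathrm d\omega+\mathrm d\omega\curlywedge_\star e+\mathsf R_k(e)\curlywedge_\star[\mathsf R^k(\omega),\omega]^\star$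 is braided covariant, but none of its three terms is. 4. (Classical form) If $\mathcal R=1\otimes1$, then $T^\star_L=T^\star_R=:T^\star$, $F^\star_\omega=e\curlywedge_\star T^\star$ and $F^\star_e=e\curlywedge_\star R^\star+\Lambda\,e\curlywedge_\star e\curlywedge_\star e$. If $\mathcal F=1\otimes1$, then on fields $(e,\omega)$ independent of $\hbar$ these are the classical expressions $F_\omega=e\curlywedge T$ and $F_e=e\curlywedge R+\Lambda\,e\curlywedge e\curlywedge e$ with $T=\mathrm de+\omega\wedge e$ and $R=\mathrm d\omega+\tfrac12[\omega,\omega]$. -/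

import Mathlib

open scoped TensorProduct Manifold

noncomputable section

namespace BraidedECP

attribute [local instance 100] LieRing.ofAssociativeRing

section Cartan

/-- `(sumUpdate T f)(v₁,…,v_p) = ∑ᵢ f(v₁,…,T vᵢ,…,v_p)`. -/
def sumUpdate {M N : Type*} [AddCommGroup M] [Module ℂ M] [AddCommGroup N] [Module ℂ N] {p : ℕ}
    (T : M →ₗ[ℂ] M) (f : M [⋀^Fin p]→ₗ[ℂ] N) : M [⋀^Fin p]→ₗ[ℂ] N where
  toFun v := ∑ i, f (Function.update v i (T (v i)))
  map_update_add' := by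
    intro dec v i x y
    cases Subsingleton.elim dec (instDecidableEqFin p)
    rw [← Finset.sum_add_distrib]
    refine Finset.sum_congr rfl fun j _ => ?_
    rcases eq_or_ne j i with rfl | h
    · simp
    · simp only [Function.update_of_ne h]
      rw [Function.update_comm h.symm, Function.update_comm h.symm, Function.update_comm h.symm,
        f.map_update_add]
  map_update_smul' := by
    intro dec v i c x
    cases Subsingleton.elim dec (instDecidableEqFin p)
    rw [Finset.smul_sum]
    refine Finset.sum_congr rfl fun j _ => ?_
    rcases eq_or_ne j i with rfl | h
    · simp
    · simp only [Function.update_of_ne h]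
      rw [Function.update_comm h.symm, Function.update_comm h.symm, f.map_update_smul]
  map_eq_zero_of_eq' := by
    intro v i j hv hij
    rw [Fintype.sum_eq_add i j hij]
    · have hsw : Function.update v j (T (v j)) =
          Function.update v i (T (v i)) ∘ Equiv.swap i j := by
        funext k
        rcases eq_or_ne k i with rfl | hki
        · simp [Function.update_of_ne hij, Function.update_of_ne hij.symm, hv]
        · rcases eq_or_ne k j with rfl | hkj
          · simp [hv]
          · simp [Function.update_of_ne hki, Function.update_of_ne hkj,
              Equiv.swap_apply_of_ne_of_ne hki hkj]
      rw [hsw, AlternatingMap.map_swap _ _ hij, add_neg_cancel]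
    · rintro k ⟨hki, hkj⟩
      exact f.map_eq_zero_of_eq _
        (by rw [Function.update_of_ne hki.symm, Function.update_of_ne hkj.symm, hv]) hij

theorem sumUpdate_apply {M N : Type*} [AddCommGroup M] [Module ℂ M] [AddCommGroup N] [Module ℂ N]
    {p : ℕ} (T : M →ₗ[ℂ] M) (f : M [⋀^Fin p]→ₗ[ℂ] N) (v : Fin p → M) :
    sumUpdate T f v = ∑ i, f (Function.update v i (T (v i))) := rfl

theorem sumUpdate_comm {M N : Type*} [AddCommGroup M] [Module ℂ M] [AddCommGroup N] [Module ℂ N]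
    {p : ℕ} (S T : M →ₗ[ℂ] M) (f : M [⋀^Fin p]→ₗ[ℂ] N) (v : Fin p → M) :
    sumUpdate S (sumUpdate T f) v - sumUpdate T (sumUpdate S f) v =
      sumUpdate (T ∘ₗ S - S ∘ₗ T) f v := by
  have key : ∀ (S T : M →ₗ[ℂ] M), sumUpdate S (sumUpdate T f) v =
      ∑ i, f (Function.update v i (T (S (v i)))) + ∑ i, ∑ j, if j = i then 0 else
        f (Function.update (Function.update v i (S (v i))) j (T (v j))) := by
    intro S T
    rw [sumUpdate_apply, ← Finset.sum_add_distrib]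
    refine Finset.sum_congr rfl fun i _ => ?_
    rw [sumUpdate_apply, ← Finset.add_sum_erase _ _ (Finset.mem_univ i),
      ← Finset.add_sum_erase Finset.univ (fun j => if j = i then (0 : N) else _)
        (Finset.mem_univ i)]
    simp only [Function.update_self, Function.update_idem, if_true, zero_add]
    congr 1
    refine Finset.sum_congr rfl fun j hj => ?_
    have hji := Finset.ne_of_mem_erase hj
    simp [hji]
  rw [key S T, key T S, sumUpdate_apply]
  have h2 : (∑ i, ∑ j, if j = i then (0 : N) else
        f (Function.update (Function.update v i (S (v i))) j (T (v j)))) =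
      ∑ i, ∑ j, if j = i then 0 else
        f (Function.update (Function.update v i (T (v i))) j (S (v j))) := by
    rw [Finset.sum_comm]
    refine Finset.sum_congr rfl fun i _ => Finset.sum_congr rfl fun j _ => ?_
    rcases eq_or_ne i j with rfl | h
    · simp
    · simp only [h, h.symm, if_false]
      rw [Function.update_comm h]
  rw [h2, add_sub_add_right_eq_sub, ← Finset.sum_sub_distrib]
  refine Finset.sum_congr rfl fun i _ => ?_
  simp

variable {A : Type*} [CommRing A] [Algebra ℂ A]

variable (A) in
/-- Vector fields: derivations of the algebra of functions. -/
abbrev Vect := Derivation ℂ A A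

variable (A) in
/-- Differential `p`-forms: alternating function-multilinear maps on vector fields. -/
abbrev Form (p : ℕ) := Vect A [⋀^Fin p]→ₗ[A] A

/-- A form, regarded as an alternating map over `ℂ`. -/
def Form.toC {p : ℕ} (α : Form A p) : Vect A [⋀^Fin p]→ₗ[ℂ] A where
  toFun := α
  map_update_add' := fun v i x y => α.map_update_add v i x y
  map_update_smul' := fun v i c x => by
    have := α.map_update_smul v i (algebraMap ℂ A c) x
    rw [algebraMap_smul] at this
    rw [this, smul_eq_mul, Algebra.smul_def]
  map_eq_zero_of_eq' := fun v i j h hij => α.map_eq_zero_of_eq v h hij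

theorem Form.toC_apply {p : ℕ} (α : Form A p) (v : Fin p → Vect A) : α.toC v = α v := rfl

/-- An alternating map over `ℂ` which is homogeneous over functions is a form. -/
def Form.ofHomogeneous {p : ℕ} (β : Vect A [⋀^Fin p]→ₗ[ℂ] A)
    (h : ∀ (v : Fin p → Vect A) (i : Fin p) (f : A),
      β (Function.update v i (f • v i)) = f * β v) : Form A p where
  toFun := β
  map_update_add' := fun v i x y => β.map_update_add v i x y
  map_update_smul' := by
    intro dec v i c x
    cases Subsingleton.elim dec (instDecidableEqFin p)
    have := h (Function.update v i x) i c
    simpa only [Function.update_idem, Function.update_self, smul_eq_mul] using this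
  map_eq_zero_of_eq' := fun v i j h hij => β.map_eq_zero_of_eq v h hij

theorem bracket_smul (X Y : Vect A) (f : A) : ⁅X, f • Y⁆ = f • ⁅X, Y⁆ + X f • Y := by
  ext g
  simp only [Derivation.commutator_apply, Derivation.smul_apply, Derivation.add_apply,
    smul_eq_mul, Derivation.leibniz]
  ring

theorem smul_bracket (X Y : Vect A) (f : A) : ⁅f • X, Y⁆ = f • ⁅X, Y⁆ - Y f • X := by
  ext g
  simp only [Derivation.commutator_apply, Derivation.smul_apply, Derivation.sub_apply,
    smul_eq_mul, Derivation.leibniz]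
  ring

/-- The Lie derivative of a form along a vector field,
`(L_X α)(Y₁,…,Y_p) = X(α(Y₁,…,Y_p)) - ∑ᵢ α(Y₁,…,[X,Yᵢ],…,Y_p)`. -/
def lieForm {p : ℕ} (X : Vect A) (α : Form A p) : Form A p :=
  Form.ofHomogeneous
    (X.toLinearMap.compAlternatingMap α.toC - sumUpdate (LieAlgebra.ad ℂ (Vect A) X) α.toC)
    (by
      intro v i f
      have e1 : ∀ (w : Fin p → Vect A) (g : A) (Y : Vect A),
          α (Function.update w i (g • Y)) = g * α (Function.update w i Y) :=
        fun w g Y => α.map_update_smul w i g Y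
      have key : ∑ j, α (Function.update (Function.update v i (f • v i)) j
            ⁅X, Function.update v i (f • v i) j⁆) =
          f * ∑ j, α (Function.update v j ⁅X, v j⁆) + X f * α v := by
        rw [← Finset.add_sum_erase _ _ (Finset.mem_univ i),
          ← Finset.add_sum_erase Finset.univ (fun j => α (Function.update v j ⁅X, v j⁆))
            (Finset.mem_univ i)]
        rw [Function.update_self, Function.update_idem, bracket_smul, α.map_update_add, e1, e1,
          Function.update_eq_self, mul_add, add_right_comm, add_left_inj, add_right_inj,
          Finset.mul_sum]
        refine Finset.sum_congr rfl fun j hj => ?_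
        have hji := Finset.ne_of_mem_erase hj
        rw [Function.update_of_ne hji, Function.update_comm hji.symm, e1,
          Function.update_comm hji, Function.update_eq_self]
      have l : (X : A →ₗ[ℂ] A) (α (Function.update v i (f • v i))) = f * X (α v) + α v * X f := by
        rw [e1, Function.update_eq_self]
        simp
      change (X : A →ₗ[ℂ] A) (α (Function.update v i (f • v i))) -
        ∑ j, α (Function.update (Function.update v i (f • v i)) j
            ⁅X, Function.update v i (f • v i) j⁆) =
        f * ((X : A →ₗ[ℂ] A) (α v) - ∑ j, α (Function.update v j ⁅X, v j⁆))
      rw [l, key]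
      simp only [Derivation.coeFn_coe]
      ring)

theorem lieForm_apply {p : ℕ} (X : Vect A) (α : Form A p) (v : Fin p → Vect A) :
    lieForm X α v = X (α v) - ∑ i, α (Function.update v i ⁅X, v i⁆) := rfl

/-- The Lie derivative as a representation of the Lie algebra of vector fields on `p`-forms. -/
def lieRep (p : ℕ) : Vect A →ₗ⁅ℂ⁆ Module.End ℂ (Form A p) where
  toFun X :=
    { toFun := lieForm X
      map_add' := fun α β => by
        ext v; simp [lieForm_apply, Finset.sum_add_distrib]; ring
      map_smul' := fun c α => by
        ext v; simp [lieForm_apply, smul_sub, Finset.smul_sum] }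
  map_add' X Y := by
    ext α v
    simp only [LinearMap.coe_mk, AddHom.coe_mk, LinearMap.add_apply, AlternatingMap.add_apply,
      lieForm_apply, Derivation.add_apply, add_lie, α.map_update_add, Finset.sum_add_distrib]
    ring
  map_smul' c X := by
    ext α v
    have := fun i Y => α.toC.map_update_smul v i c Y
    simp only [Form.toC_apply] at this
    simp only [LinearMap.coe_mk, AddHom.coe_mk, LinearMap.smul_apply, AlternatingMap.smul_apply,
      lieForm_apply, Derivation.smul_apply, smul_lie, this, RingHom.id_apply, smul_sub,
      Finset.smul_sum]
  map_lie' := by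
    intro X Y
    ext α v
    have h := sumUpdate_comm (LieAlgebra.ad ℂ (Vect A) X) (LieAlgebra.ad ℂ (Vect A) Y) α.toC v
    have h2 : LieAlgebra.ad ℂ (Vect A) Y ∘ₗ LieAlgebra.ad ℂ (Vect A) X -
        LieAlgebra.ad ℂ (Vect A) X ∘ₗ LieAlgebra.ad ℂ (Vect A) Y =
        - LieAlgebra.ad ℂ (Vect A) ⁅X, Y⁆ := by
      rw [LieHom.map_lie, LieRing.of_associative_ring_bracket]
      simp [Module.End.mul_eq_comp]
    rw [h2] at h
    have h3 : sumUpdate (-LieAlgebra.ad ℂ (Vect A) ⁅X, Y⁆) α.toC v =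
        - ∑ i, α (Function.update v i ⁅⁅X, Y⁆, v i⁆) := by
      rw [sumUpdate_apply, ← Finset.sum_neg_distrib]
      refine Finset.sum_congr rfl fun i _ => ?_
      rw [LinearMap.neg_apply, α.toC.map_update_neg]
      rfl
    have h4 : ∀ X Y : Vect A, sumUpdate (LieAlgebra.ad ℂ (Vect A) X)
        (sumUpdate (LieAlgebra.ad ℂ (Vect A) Y) α.toC) v =
        ∑ i, ∑ j, α (Function.update (Function.update v i ⁅X, v i⁆) j
          ⁅Y, Function.update v i ⁅X, v i⁆ j⁆) := fun _ _ => rfl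
    rw [h3, h4, h4] at h
    simp only [LinearMap.coe_mk, AddHom.coe_mk, LieRing.of_associative_ring_bracket,
      LinearMap.sub_apply, Module.End.mul_apply, AlternatingMap.sub_apply, lieForm_apply,
      Derivation.commutator_apply, Finset.sum_sub_distrib, map_sub, map_sum]
    linear_combination -h

/-- `α ↦ (X ↦ X ∘ α + L_X α)`. -/
def preD (p : ℕ) (α : Form A p) : Vect A →ₗ[ℂ] Vect A [⋀^Fin p]→ₗ[ℂ] A where
  toFun X := X.toLinearMap.compAlternatingMap α.toC + (lieRep p X α).toC
  map_add' X Y := by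
    ext v
    simp [Form.toC_apply]; ring
  map_smul' c X := by
    ext v
    simp [Form.toC_apply]

theorem preD_apply (p : ℕ) (α : Form A p) (X : Vect A) (v : Fin p → Vect A) :
    preD p α X v = 2 * X (α v) - ∑ i, α (Function.update v i ⁅X, v i⁆) := by
  change X (α v) + (X (α v) - ∑ i, α (Function.update v i ⁅X, v i⁆)) = _
  ring

/-- Twice the exterior derivative, as an alternating map over `ℂ`. -/
def twoD (p : ℕ) (α : Form A p) : Vect A [⋀^Fin (p + 1)]→ₗ[ℂ] A :=
  AlternatingMap.alternatizeUncurryFin (preD p α)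

theorem twoD_apply_vecCons (p : ℕ) (α : Form A p) (X : Vect A) (w : Fin p → Vect A) :
    twoD p α (Matrix.vecCons X w) = X (α w) + lieForm X α w +
      ∑ j : Fin p, (-1) ^ ((j : ℕ) + 1) * (w j (α (Matrix.vecCons X w ∘ j.succ.succAbove)) +
        lieForm (w j) α (Matrix.vecCons X w ∘ j.succ.succAbove)) := by
  rw [twoD, AlternatingMap.alternatizeUncurryFin_apply, Fin.sum_univ_succ]
  simp only [zsmul_eq_mul, Fin.val_zero, pow_zero, one_smul, Matrix.cons_val_zero, Fin.val_succ,
    Matrix.cons_val_succ]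
  congr 1
  refine Finset.sum_congr rfl fun j _ => ?_
  push_cast
  rfl

theorem twoD_smul_zero (p : ℕ) (α : Form A p) (X : Vect A) (w : Fin p → Vect A) (f : A) :
    twoD p α (Matrix.vecCons (f • X) w) = f * twoD p α (Matrix.vecCons X w) := by
  rcases p with _ | p
  · simp [twoD_apply_vecCons, lieForm_apply]
    ring
  have hc : ∀ (Y : Vect A) (j : Fin (p + 1)), Matrix.vecCons Y w ∘ j.succ.succAbove =
      Matrix.vecCons Y (j.removeNth w) := by
    intro Y j
    funext k
    refine Fin.cases ?_ (fun k => ?_) k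
    · simp
    · simp [Fin.removeNth]
  have hs : ∀ (β : Form A (p + 1)) (u : Fin p → Vect A),
      β (Matrix.vecCons (f • X) u) = f * β (Matrix.vecCons X u) := by
    intro β u
    have h0 : ∀ Y : Vect A, Function.update (Matrix.vecCons X u) 0 Y = Matrix.vecCons Y u := by
      intro Y
      funext k
      refine Fin.cases ?_ (fun k => ?_) k <;> simp
    have := β.map_update_smul (Matrix.vecCons X u) 0 f X
    rwa [h0, h0] at this
  have hl : lieForm (f • X) α w = f * lieForm X α w +
      ∑ j, (w j) f * α (Function.update w j X) := by
    simp only [lieForm_apply, smul_bracket, Derivation.smul_apply, sub_eq_add_neg,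
      α.map_update_add, α.map_update_smul, ← neg_smul]
    simp only [smul_eq_mul, Finset.sum_add_distrib, mul_add, mul_neg, Finset.mul_sum,
      neg_mul, Finset.sum_neg_distrib, neg_add, neg_neg]
    ring
  have hu : ∀ j : Fin (p + 1), α (Function.update w j X) =
      (-1) ^ (j : ℕ) * α (Matrix.vecCons X (j.removeNth w)) := by
    intro j
    rw [← Fin.insertNth_removeNth, α.map_insertNth]
    simp [zsmul_eq_mul]
  rw [twoD_apply_vecCons, twoD_apply_vecCons]
  simp only [hc, hs, hl, hu, Derivation.leibniz, Derivation.smul_apply, smul_eq_mul]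
  simp only [mul_add, Finset.mul_sum, Finset.sum_add_distrib]
  have e1 : ∑ j : Fin (p + 1), (w j) f * ((-1) ^ (j : ℕ) * α (Matrix.vecCons X (j.removeNth w))) =
      - ∑ j : Fin (p + 1), (-1) ^ ((j : ℕ) + 1) * (α (Matrix.vecCons X (j.removeNth w)) * (w j) f) := by
    rw [← Finset.sum_neg_distrib]
    exact Finset.sum_congr rfl fun j _ => by ring
  have e2 : ∀ c : Fin (p + 1) → A, ∑ j : Fin (p + 1), (-1) ^ ((j : ℕ) + 1) * (f * c j) =
      ∑ j : Fin (p + 1), f * ((-1) ^ ((j : ℕ) + 1) * c j) :=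
    fun c => Finset.sum_congr rfl fun j _ => by ring
  rw [e1, e2, e2]
  ring

theorem twoD_smul (p : ℕ) (α : Form A p) (v : Fin (p + 1) → Vect A) (i : Fin (p + 1)) (f : A) :
    twoD p α (Function.update v i (f • v i)) = f * twoD p α v := by
  have h1 : Function.update v i (f • v i) = i.insertNth (f • v i) (i.removeNth v) := by
    rw [Fin.insertNth_removeNth]
  have h2 : v = i.insertNth (v i) (i.removeNth v) := by
    rw [Fin.insertNth_removeNth, Function.update_eq_self]
  rw [h1]
  conv_rhs => rw [h2]
  rw [AlternatingMap.map_insertNth, AlternatingMap.map_insertNth, twoD_smul_zero]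
  rw [mul_smul_comm]

/-- The exterior derivative. -/
def extD (p : ℕ) : Form A p →ₗ[ℂ] Form A (p + 1) where
  toFun α := Form.ofHomogeneous ((2⁻¹ : ℂ) • twoD p α) (by
    intro v i f
    simp only [AlternatingMap.smul_apply, twoD_smul, mul_smul_comm])
  map_add' α β := by
    ext v
    have : preD p (α + β) = preD p α + preD p β := by
      ext X w
      simp only [preD_apply, LinearMap.add_apply, AlternatingMap.add_apply, map_add,
        Finset.sum_add_distrib]
      ring
    change (2⁻¹ : ℂ) • twoD p (α + β) v = (2⁻¹ : ℂ) • twoD p α v + (2⁻¹ : ℂ) • twoD p β v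
    rw [twoD, this, AlternatingMap.alternatizeUncurryFin_add, AlternatingMap.add_apply, smul_add]
    rfl
  map_smul' c α := by
    ext v
    have : preD p (c • α) = c • preD p α := by
      ext X w
      simp only [preD_apply, LinearMap.smul_apply, AlternatingMap.smul_apply,
        Derivation.map_smul, smul_sub, Finset.smul_sum, mul_smul_comm]
    change (2⁻¹ : ℂ) • twoD p (c • α) v = c • (2⁻¹ : ℂ) • twoD p α v
    rw [twoD, this, AlternatingMap.alternatizeUncurryFin_smul, AlternatingMap.smul_apply, smul_comm]
    rfl

theorem extD_apply (p : ℕ) (α : Form A p) (v : Fin (p + 1) → Vect A) :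
    extD p α v = (2⁻¹ : ℂ) • ∑ i : Fin (p + 1), (-1) ^ (i : ℕ) •
      (2 * v i (α (i.removeNth v)) -
        ∑ j, α (Function.update (i.removeNth v) j ⁅v i, i.removeNth v j⁆)) := by
  change (2⁻¹ : ℂ) • twoD p α v = _
  simp only [twoD, AlternatingMap.alternatizeUncurryFin_apply, preD_apply]

theorem extD_zero_apply (f : Form A 0) (X : Vect A) : extD 0 f ![X] = X (f ![]) := by
  rw [extD_apply]
  have : ∀ v w : Fin 0 → Vect A, f v = f w := fun v w => congrArg f (Subsingleton.elim v w)
  simp only [Finset.univ_eq_empty, Finset.sum_empty]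
  rw [this _ ![]]
  simp [← two_smul ℂ, smul_smul, two_mul]

theorem extD_one_apply (α : Form A 1) (X Y : Vect A) :
    extD 1 α ![X, Y] = X (α ![Y]) - Y (α ![X]) - α ![⁅X, Y⁆] := by
  rw [extD_apply]
  have h : ∀ v : Fin 1 → Vect A, v = ![v 0] := fun v => by ext i : 1; fin_cases i; rfl
  have r0 : Fin.removeNth 0 ![X, Y] = ![Y] := h _
  have r1 : Fin.removeNth 1 ![X, Y] = ![X] := h _
  have u : ∀ Z W : Vect A, Function.update ![Z] 0 W = ![W] := fun Z W => by
    rw [h (Function.update ![Z] 0 W), Function.update_self]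
  have hn : α ![⁅Y, X⁆] = - α ![⁅X, Y⁆] := by
    have := α.map_update_neg ![X] 0 ⁅X, Y⁆
    rwa [u, u, lie_skew] at this
  refine (congrArg _ (Fin.sum_univ_two _)).trans ?_
  simp only [r0, r1, Finset.univ_unique, Finset.sum_singleton,
    Fin.default_eq_zero, u, Matrix.cons_val_zero, Matrix.cons_val_one, Fin.val_zero, Fin.val_one,
    pow_zero, pow_one, one_smul, hn]
  have : (2⁻¹ : ℂ) • ((2 : A) * (X (α ![Y]) - Y (α ![X]) - α ![⁅X, Y⁆])) =
      X (α ![Y]) - Y (α ![X]) - α ![⁅X, Y⁆] := by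
    rw [two_mul, ← two_smul ℂ, smul_smul]; norm_num
  rw [← this]
  congr 1
  simp only [neg_smul, one_smul]
  ring

theorem complex_smul_form {p : ℕ} (c : ℂ) (α : Form A p) : c • α = algebraMap ℂ A c • α := by
  ext v
  simp [Algebra.smul_def]

/-- The exterior product of forms, the alternated sum over shuffles. -/
def wedge {p q r : ℕ} (h : p + q = r) : Form A p →ₗ[ℂ] Form A q →ₗ[ℂ] Form A r :=
  LinearMap.mk₂ ℂ
    (fun α β => ((LinearMap.mul' A A).compAlternatingMap
      (AlternatingMap.domCoprod' (α ⊗ₜ[A] β))).domDomCongr (finSumFinEquiv.trans (finCongr h)))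
    (by intros; ext; simp [TensorProduct.add_tmul])
    (by
      intro c α β
      ext v
      rw [complex_smul_form c α, ← TensorProduct.smul_tmul', map_smul]
      simp [Algebra.smul_def])
    (by intros; ext; simp [TensorProduct.tmul_add])
    (by
      intro c α β
      ext v
      rw [complex_smul_form c β, TensorProduct.tmul_smul, map_smul]
      simp [Algebra.smul_def])

end Cartan
section Twist

variable (A : Type*) [CommRing A] [Algebra ℂ A]

/-- The universal enveloping algebra of the Lie algebra of vector fields. -/
abbrev U := UniversalEnvelopingAlgebra ℂ (Vect A)

/-- The coproduct of the universal enveloping algebra, `Δ(X) = X ⊗ 1 + 1 ⊗ X`. -/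
def coproduct : U A →ₐ[ℂ] U A ⊗[ℂ] U A :=
  UniversalEnvelopingAlgebra.lift ℂ
    { toFun := fun X => UniversalEnvelopingAlgebra.ι ℂ X ⊗ₜ 1 + 1 ⊗ₜ UniversalEnvelopingAlgebra.ι ℂ X
      map_add' := fun X Y => by
        simp only [map_add, TensorProduct.add_tmul, TensorProduct.tmul_add]; abel
      map_smul' := fun c X => by
        simp only [map_smul, TensorProduct.tmul_smul, ← TensorProduct.smul_tmul', smul_add,
          RingHom.id_apply]
      map_lie' := by
        intro X Y
        simp only [LieHom.map_lie, LieRing.of_associative_ring_bracket, mul_add, add_mul,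
          Algebra.TensorProduct.tmul_mul_tmul, one_mul, mul_one, TensorProduct.sub_tmul,
          TensorProduct.tmul_sub]
        abel }

/-- The counit of the universal enveloping algebra, `ε(X) = 0`. -/
def counit : U A →ₐ[ℂ] ℂ := UniversalEnvelopingAlgebra.lift ℂ 0

/-- A Drinfel'd twist `F = ∑ f^k ⊗ f_k`: an invertible formal power series in `ħ` with coefficients
in `U ⊗ U` which satisfies the cocycle and the normalization conditions. -/
structure DrinfeldTwist where
  /-- The twist. -/
  F : (PowerSeries (U A ⊗[ℂ] U A))ˣ
  /-- `(F ⊗ 1)(Δ ⊗ id)F = (1 ⊗ F)(id ⊗ Δ)F`. -/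
  cocycle :
    PowerSeries.map (Algebra.TensorProduct.assoc ℂ ℂ ℂ (U A) (U A) (U A)).toRingHom
      (PowerSeries.map
          (Algebra.TensorProduct.includeLeft : U A ⊗[ℂ] U A →ₐ[ℂ] (U A ⊗[ℂ] U A) ⊗[ℂ] U A).toRingHom F *
        PowerSeries.map
          (Algebra.TensorProduct.map (coproduct A) (AlgHom.id ℂ (U A))).toRingHom F) =
      PowerSeries.map
          (Algebra.TensorProduct.includeRight : U A ⊗[ℂ] U A →ₐ[ℂ] U A ⊗[ℂ] (U A ⊗[ℂ] U A)).toRingHom F *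
        PowerSeries.map
          (Algebra.TensorProduct.map (AlgHom.id ℂ (U A)) (coproduct A)).toRingHom F
  /-- `(ε ⊗ id)F = 1`. -/
  normalized_left :
    PowerSeries.map ((Algebra.TensorProduct.lid ℂ (U A)).toAlgHom.comp
      (Algebra.TensorProduct.map (counit A) (AlgHom.id ℂ (U A)))).toRingHom F = 1
  /-- `(id ⊗ ε)F = 1`. -/
  normalized_right :
    PowerSeries.map ((Algebra.TensorProduct.rid ℂ ℂ (U A)).toAlgHom.comp
      (Algebra.TensorProduct.map (AlgHom.id ℂ (U A)) (counit A))).toRingHom F = 1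

variable {A}

/-- The transposition of the two factors of a formal power series with coefficients in `U ⊗ U`. -/
def transposition : PowerSeries (U A ⊗[ℂ] U A) →+* PowerSeries (U A ⊗[ℂ] U A) :=
  PowerSeries.map (Algebra.TensorProduct.comm ℂ (U A) (U A)).toRingHom

/-- The `R`-matrix `R = F₂₁ F⁻¹ = ∑ R^k ⊗ R_k`. -/
def DrinfeldTwist.R (𝓕 : DrinfeldTwist A) : PowerSeries (U A ⊗[ℂ] U A) :=
  transposition 𝓕.F * (↑(𝓕.F⁻¹) : PowerSeries (U A ⊗[ℂ] U A))

variable (A) in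
/-- A complex vector space with an action of the universal enveloping algebra of vector fields. -/
class EnvModule (V : Type*) [AddCommGroup V] [Module ℂ V] where
  /-- The action. -/
  act : U A →ₐ[ℂ] Module.End ℂ V

/-- Vector fields act on forms by the Lie derivative. -/
instance (p : ℕ) : EnvModule A (Form A p) := ⟨UniversalEnvelopingAlgebra.lift ℂ (lieRep p)⟩

/-- Vector fields act on vector fields by the Lie bracket. -/
instance : EnvModule A (Vect A) :=
  ⟨UniversalEnvelopingAlgebra.lift ℂ (LieAlgebra.ad ℂ (Vect A))⟩

variable (A) in
/-- Forms with values in a complex vector space. -/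
def VForm (p : ℕ) (W : Type*) [AddCommGroup W] [Module ℂ W] := Form A p ⊗[ℂ] W

instance (p : ℕ) (W : Type*) [AddCommGroup W] [Module ℂ W] : AddCommGroup (VForm A p W) :=
  inferInstanceAs (AddCommGroup (Form A p ⊗[ℂ] W))

instance (p : ℕ) (W : Type*) [AddCommGroup W] [Module ℂ W] : Module ℂ (VForm A p W) :=
  inferInstanceAs (Module ℂ (Form A p ⊗[ℂ] W))

/-- The Lie derivative does not act on the values of a form. -/
instance (p : ℕ) (W : Type*) [AddCommGroup W] [Module ℂ W] : EnvModule A (VForm A p W) :=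
  ⟨(Module.End.rTensorAlgHom ℂ (Form A p) W).comp (EnvModule.act (A := A) (V := Form A p))⟩

instance (V W : Type*) [AddCommGroup V] [Module ℂ V] [AddCommGroup W] [Module ℂ W]
    [EnvModule A V] [EnvModule A W] : EnvModule A (V × W) :=
  ⟨(LinearMap.prodMapAlgHom ℂ V W).comp ((EnvModule.act (A := A)).prod (EnvModule.act (A := A)))⟩

/-- The action on a tensor product, through the coproduct. -/
abbrev tensorEnvModule (V W : Type*) [AddCommGroup V] [Module ℂ V] [AddCommGroup W] [Module ℂ W]
    [EnvModule A V] [EnvModule A W] : EnvModule A (V ⊗[ℂ] W) :=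
  ⟨(Module.endTensorEndAlgHom.comp
    (Algebra.TensorProduct.map (EnvModule.act (A := A) (V := V)) (EnvModule.act (A := A) (V := W)))).comp
      (coproduct A)⟩

/-- Formal power series in `ħ` with coefficients in a vector space. -/
abbrev FPS (V : Type*) := ℕ → V

/-- The constant formal power series. -/
def FPS.const {V : Type*} [Zero V] (v : V) : FPS V := Pi.single 0 v

section Operations

variable {V W X Y Z : Type*} [AddCommGroup V] [Module ℂ V] [AddCommGroup W] [Module ℂ W]
  [AddCommGroup X] [Module ℂ X] [AddCommGroup Y] [Module ℂ Y] [AddCommGroup Z] [Module ℂ Z]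

/-- The `ħ`-linear extension of a linear map. -/
abbrev FPS.map (f : V →ₗ[ℂ] W) : FPS V →ₗ[ℂ] FPS W := f.compLeft ℕ

/-- The `ħ`-bilinear extension of a bilinear map. -/
def FPS.map₂ (B : V →ₗ[ℂ] W →ₗ[ℂ] X) : FPS V →ₗ[ℂ] FPS W →ₗ[ℂ] FPS X :=
  LinearMap.mk₂ ℂ (fun v w n => ∑ ij ∈ Finset.HasAntidiagonal.antidiagonal n, B (v ij.1) (w ij.2))
    (by intros; funext n; simp [Finset.sum_add_distrib])
    (by intros; funext n; simp [Finset.smul_sum])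
    (by intros; funext n; simp [Finset.sum_add_distrib])
    (by intros; funext n; simp [Finset.smul_sum])

/-- The coefficientwise action of the enveloping algebra on formal power series, `(v, u) ↦ u(v)`. -/
def orbit [EnvModule A V] : FPS V →ₗ[ℂ] U A →ₗ[ℂ] FPS V :=
  LinearMap.mk₂ ℂ (fun v u n => EnvModule.act u (v n))
    (by intros; funext n; simp)
    (by intros; funext n; simp)
    (by intros; funext n; simp)
    (by intros; funext n; simp)

/-- For `T = ∑ a_k ⊗ b_k`, the bilinear map `(v, w) ↦ ∑ G(a_k(v), b_k(w))`; the sum is the formal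
power series obtained from the coefficients of `T`. -/
def twistBy [EnvModule A V] [EnvModule A W] (T : PowerSeries (U A ⊗[ℂ] U A))
    (G : FPS V →ₗ[ℂ] FPS W →ₗ[ℂ] FPS X) : FPS V →ₗ[ℂ] FPS W →ₗ[ℂ] FPS X :=
  LinearMap.mk₂ ℂ
    (fun v w n => ∑ ij ∈ Finset.HasAntidiagonal.antidiagonal n,
      TensorProduct.lift G
        (TensorProduct.map (orbit v) (orbit w) (PowerSeries.coeff ij.1 T)) ij.2)
    (by intros; funext n; simp [TensorProduct.map_add_left, Finset.sum_add_distrib])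
    (by intros; funext n; simp [TensorProduct.map_smul_left, Finset.smul_sum])
    (by intros; funext n; simp [TensorProduct.map_add_right, Finset.sum_add_distrib])
    (by intros; funext n; simp [TensorProduct.map_smul_right, Finset.smul_sum])

theorem twistBy_apply [EnvModule A V] [EnvModule A W] (T : PowerSeries (U A ⊗[ℂ] U A))
    (G : FPS V →ₗ[ℂ] FPS W →ₗ[ℂ] FPS X) (v : FPS V) (w : FPS W) (n : ℕ) :
    twistBy T G v w n = ∑ ij ∈ Finset.HasAntidiagonal.antidiagonal n,
      TensorProduct.lift G
        (TensorProduct.map (orbit v) (orbit w) (PowerSeries.coeff ij.1 T)) ij.2 := rfl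

theorem twistBy_add [EnvModule A V] [EnvModule A W] (T : PowerSeries (U A ⊗[ℂ] U A))
    (G G' : FPS V →ₗ[ℂ] FPS W →ₗ[ℂ] FPS X) : twistBy T (G + G') = twistBy T G + twistBy T G' := by
  ext v w n
  have : TensorProduct.lift (G + G') = TensorProduct.lift G + TensorProduct.lift G' := by
    ext; simp
  simp [twistBy_apply, this, Finset.sum_add_distrib]

theorem twistBy_smul [EnvModule A V] [EnvModule A W] (T : PowerSeries (U A ⊗[ℂ] U A)) (c : ℂ)
    (G : FPS V →ₗ[ℂ] FPS W →ₗ[ℂ] FPS X) : twistBy T (c • G) = c • twistBy T G := by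
  ext v w n
  have : TensorProduct.lift (c • G) = c • TensorProduct.lift G := by
    ext; simp
  simp [twistBy_apply, this, Finset.smul_sum]

/-- The twisted tensor product `v ⊗⋆ w = F⁻¹(v ⊗ w)`. -/
def DrinfeldTwist.tmul (𝓕 : DrinfeldTwist A) [EnvModule A V] [EnvModule A W] :
    FPS V →ₗ[ℂ] FPS W →ₗ[ℂ] FPS (V ⊗[ℂ] W) :=
  twistBy (↑(𝓕.F⁻¹) : PowerSeries (U A ⊗[ℂ] U A)) (FPS.map₂ (TensorProduct.mk ℂ V W))

/-- The star deformation of a bilinear map, `B⋆(v, w) = B(v ⊗⋆ w)`. -/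
def DrinfeldTwist.star (𝓕 : DrinfeldTwist A) [EnvModule A V] [EnvModule A W]
    (B : V →ₗ[ℂ] W →ₗ[ℂ] X) : FPS V →ₗ[ℂ] FPS W →ₗ[ℂ] FPS X :=
  𝓕.tmul.compr₂ (FPS.map (TensorProduct.lift B))

/-- The star deformation of a trilinear map, `T⋆(v, w, z) = T(v ⊗⋆ (w ⊗⋆ z))`. -/
def DrinfeldTwist.star₃ (𝓕 : DrinfeldTwist A) [EnvModule A V] [EnvModule A W] [EnvModule A Z]
    (T : V →ₗ[ℂ] W →ₗ[ℂ] Z →ₗ[ℂ] X) : FPS V →ₗ[ℂ] FPS W →ₗ[ℂ] FPS Z →ₗ[ℂ] FPS X :=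
  letI : EnvModule A (W ⊗[ℂ] Z) := tensorEnvModule W Z
  LinearMap.mk₂ ℂ
    (fun v w => 𝓕.star ((TensorProduct.uncurry (.id ℂ) W Z X) ∘ₗ T) v ∘ₗ 𝓕.tmul w)
    (by intros; ext; simp)
    (by intros; ext; simp)
    (by intros; ext; simp)
    (by intros; ext; simp)

/-- The braided transposition of the arguments of a bilinear map,
`(v, w) ↦ ∑ G(R_k(w), R^k(v))`. -/
def DrinfeldTwist.braid (𝓕 : DrinfeldTwist A) [EnvModule A V] [EnvModule A W]
    (G : FPS W →ₗ[ℂ] FPS V →ₗ[ℂ] FPS X) : FPS V →ₗ[ℂ] FPS W →ₗ[ℂ] FPS X :=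
  (twistBy (transposition 𝓕.R) G).flip

theorem DrinfeldTwist.braid_add (𝓕 : DrinfeldTwist A) [EnvModule A V] [EnvModule A W]
    (G G' : FPS W →ₗ[ℂ] FPS V →ₗ[ℂ] FPS X) : 𝓕.braid (G + G') = 𝓕.braid G + 𝓕.braid G' := by
  rw [DrinfeldTwist.braid, twistBy_add]; rfl

theorem DrinfeldTwist.braid_smul (𝓕 : DrinfeldTwist A) [EnvModule A V] [EnvModule A W] (c : ℂ)
    (G : FPS W →ₗ[ℂ] FPS V →ₗ[ℂ] FPS X) : 𝓕.braid (c • G) = c • 𝓕.braid G := by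
  rw [DrinfeldTwist.braid, twistBy_smul]; rfl

end Operations

end Twist

section Values

/-- The multivectors `⋀^k` of the four-dimensional fundamental representation. -/
abbrev Lam (k : ℕ) := ⋀[ℂ]^k (Fin 4 → ℂ)

/-- The Lie algebra `so(p,q)` (complexified) of the diagonal metric with signs `η`, with the
commutator as its bracket: matrices `X` with `Xᵀ η = - η X`. -/
abbrev So (η : Fin 4 → ℤˣ) :=
  skewAdjointMatricesLieSubalgebra (Matrix.diagonal fun i => ((η i : ℤ) : ℂ))

/-- The exterior product of multivectors. -/
def lamMul {k l m : ℕ} (h : k + l = m) : Lam k →ₗ[ℂ] Lam l →ₗ[ℂ] Lam m :=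
  LinearMap.mk₂ ℂ (fun u v => ⟨(u : ExteriorAlgebra ℂ (Fin 4 → ℂ)) * v,
      h ▸ SetLike.mul_mem_graded u.2 v.2⟩)
    (by intros; ext; simp [add_mul]) (by intros; ext; simp)
    (by intros; ext; simp [mul_add]) (by intros; ext; simp)

variable (η : Fin 4 → ℤˣ)

/-- The Lie bracket. -/
def soBracket : So η →ₗ[ℂ] So η →ₗ[ℂ] So η :=
  LinearMap.mk₂ ℂ (fun X Y => ⁅X, Y⁆) add_lie smul_lie lie_add lie_smul

/-- The action on multivectors: on vectors by matrix multiplication, on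
multivectors by derivations. -/
def soAct (k : ℕ) : So η →ₗ[ℂ] Lam k →ₗ[ℂ] Lam k where
  toFun X := exteriorPower.alternatingMapLinearEquiv
    (sumUpdate (Matrix.toLin' (X : Matrix (Fin 4) (Fin 4) ℂ)) (exteriorPower.ιMulti ℂ k))
  map_add' X Y := by
    rw [← map_add]
    congr 1
    ext v
    simp [sumUpdate_apply, Finset.sum_add_distrib]
  map_smul' c X := by
    rw [RingHom.id_apply, ← map_smul]
    congr 1
    ext v
    simp [sumUpdate_apply, Finset.smul_sum]

/-- The identification of `so(p,q)` with bivectors, `X ↦ ∑ X^a_b η^{bb} E_a ∧ E_b`. -/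
def soToLam : So η →ₗ[ℂ] Lam 2 where
  toFun X := ∑ a, ∑ b, ((X : Matrix (Fin 4) (Fin 4) ℂ) a b * ((η b : ℤ) : ℂ)) •
    exteriorPower.ιMulti ℂ 2 ![Pi.single a (1 : ℂ), Pi.single b (1 : ℂ)]
  map_add' X Y := by
    simp [add_mul, add_smul, Finset.sum_add_distrib]
  map_smul' c X := by
    simp [mul_assoc, mul_smul, Finset.smul_sum]

end Values

section Brackets

variable {A : Type*} [CommRing A] [Algebra ℂ A] {η : Fin 4 → ℤˣ}

/-- The product of forms with values, for a given bilinear product of the values. -/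
def formMul {W₁ W₂ W₃ : Type*} [AddCommGroup W₁] [Module ℂ W₁] [AddCommGroup W₂] [Module ℂ W₂]
    [AddCommGroup W₃] [Module ℂ W₃] {p q r : ℕ} (h : p + q = r) (B : W₁ →ₗ[ℂ] W₂ →ₗ[ℂ] W₃) :
    VForm A p W₁ →ₗ[ℂ] VForm A q W₂ →ₗ[ℂ] VForm A r W₃ :=
  TensorProduct.map₂ (wedge h) B

/-- `Φ ⋏ Ψ` for forms with values in multivectors. -/
def curly {p q r k l m : ℕ} (h : p + q = r := by norm_num) (h' : k + l = m := by norm_num) :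
    VForm A p (Lam k) →ₗ[ℂ] VForm A q (Lam l) →ₗ[ℂ] VForm A r (Lam m) :=
  formMul h (lamMul h')

/-- `Φ ⋏ Ω` for a multivector form `Φ` and an `so`-valued form `Ω`. -/
def curlySo {p q r k m : ℕ} (h : p + q = r := by norm_num) (h' : k + 2 = m := by norm_num) :
    VForm A p (Lam k) →ₗ[ℂ] VForm A q (So η) →ₗ[ℂ] VForm A r (Lam m) :=
  formMul h ((lamMul h').compl₂ (soToLam η))

/-- `Ω ⋏ Φ` for an `so`-valued form `Ω` and a multivector form `Φ`. -/
def soCurly {p q r k m : ℕ} (h : p + q = r := by norm_num) (h' : 2 + k = m := by norm_num) :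
    VForm A p (So η) →ₗ[ℂ] VForm A q (Lam k) →ₗ[ℂ] VForm A r (Lam m) :=
  formMul h (lamMul h' ∘ₗ soToLam η)

/-- `[Ω, Ω']` for `so`-valued forms. -/
def soBr {p q r : ℕ} (h : p + q = r := by norm_num) :
    VForm A p (So η) →ₗ[ℂ] VForm A q (So η) →ₗ[ℂ] VForm A r (So η) :=
  formMul h (soBracket η)

/-- `Ω ▷ Φ` (also written `Ω ∧ Φ`, or `Ω Φ`) for an `so`-valued form `Ω` and a multivector form
`Φ`. -/
def soTri {p q r k : ℕ} (h : p + q = r := by norm_num) :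
    VForm A p (So η) →ₗ[ℂ] VForm A q (Lam k) →ₗ[ℂ] VForm A r (Lam k) :=
  formMul h (soAct η k)

/-- The exterior derivative of forms with values. -/
def vd (p q : ℕ) (h : p + 1 = q := by norm_num) {W : Type*} [AddCommGroup W] [Module ℂ W] :
    VForm A p W →ₗ[ℂ] VForm A q W :=
  ((AlternatingMap.domDomCongrₗ ℂ (finCongr h)).toLinearMap ∘ₗ extD p).rTensor W

/-- The Lie derivative of forms with values. -/
def vLie (p : ℕ) {W : Type*} [AddCommGroup W] [Module ℂ W] :
    Vect A →ₗ[ℂ] VForm A p W →ₗ[ℂ] VForm A p W :=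
  LinearMap.rTensorHom W ∘ₗ (lieRep p : Vect A →ₗ⁅ℂ⁆ Module.End ℂ (Form A p)).toLinearMap

variable (A η) in
/-- Gauge parameters `(ξ, ρ)`. -/
abbrev V0 := Vect A × VForm A 0 (So η)

variable (A η) in
/-- Fields `(e, ω)`. -/
abbrev V1 := VForm A 1 (Lam 1) × VForm A 1 (So η)

variable (A) in
/-- Field equations `(E, Ω)`. -/
abbrev V2 := VForm A 3 (Lam 3) × VForm A 3 (Lam 2)

/-- `ℓ₁(ξ, ρ) = (0, dρ)`; the bracket `ℓ₁` vanishes on fields. -/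
def ell1 : V0 A η →ₗ[ℂ] V1 A η :=
  (LinearMap.inr ℂ _ _) ∘ₗ vd 0 1 ∘ₗ LinearMap.snd ℂ _ _

/-- `ℓ₂((ξ, ρ), (e, ω)) = (-ρ e + L_ξ e, -[ρ, ω] + L_ξ ω)`. -/
def ell2Gauge : V0 A η →ₗ[ℂ] V1 A η →ₗ[ℂ] V1 A η :=
  LinearMap.mk₂ ℂ
    (fun l a => (-(soTri) l.2 a.1 + vLie 1 l.1 a.1, -(soBr) l.2 a.2 + vLie 1 l.1 a.2))
    (by intros; ext <;> simp <;> abel)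
    (by intros; ext <;> simp)
    (by intros; ext <;> simp <;> abel)
    (by intros; ext <;> simp)

/-- The action `((ξ, ρ), Φ) ↦ -ρ ▷ Φ + L_ξ Φ` of gauge parameters on multivector forms. -/
def gaugeAct (p k : ℕ) : V0 A η →ₗ[ℂ] VForm A p (Lam k) →ₗ[ℂ] VForm A p (Lam k) :=
  LinearMap.mk₂ ℂ
    (fun l x => -(soTri (zero_add p)) l.2 x + vLie p l.1 x)
    (by intros; simp; abel) (by intros; simp) (by intros; simp; abel) (by intros; simp)

/-- `d` from one-forms to two-forms. -/
abbrev d₁ {W : Type*} [AddCommGroup W] [Module ℂ W] : VForm A 1 W →ₗ[ℂ] VForm A 2 W := vd 1 2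

/-- `ℓ₂((e₁, ω₁), (e₂, ω₂)) = -(e₁ ⋏ dω₂ + e₂ ⋏ dω₁, e₁ ⋏ de₂ + e₂ ⋏ de₁)`. -/
def ell2 : V1 A η →ₗ[ℂ] V1 A η →ₗ[ℂ] V2 A :=
  LinearMap.mk₂ ℂ
    (fun a b =>
      -((curlySo) a.1 (d₁ b.2) + (curlySo) b.1 (d₁ a.2),
        (curly) a.1 (d₁ b.1) + (curly) b.1 (d₁ a.1)))
    (by intros; ext <;> simp <;> abel)
    (by intros; ext <;> simp)
    (by intros; ext <;> simp <;> abel)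
    (by intros; ext <;> simp)

/-- A trilinear map from a function which is linear in each of its three arguments. -/
def mk₃ {V W Z X : Type*} [AddCommGroup V] [Module ℂ V] [AddCommGroup W] [Module ℂ W]
    [AddCommGroup Z] [Module ℂ Z] [AddCommGroup X] [Module ℂ X] (f : V → W → Z → X)
    (h₁ : ∀ v v' w z, f (v + v') w z = f v w z + f v' w z)
    (h₁' : ∀ (c : ℂ) v w z, f (c • v) w z = c • f v w z)
    (h₂ : ∀ v w w' z, f v (w + w') z = f v w z + f v w' z)
    (h₂' : ∀ (c : ℂ) v w z, f v (c • w) z = c • f v w z)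
    (h₃ : ∀ v w z z', f v w (z + z') = f v w z + f v w z')
    (h₃' : ∀ (c : ℂ) v w z, f v w (c • z) = c • f v w z) : V →ₗ[ℂ] W →ₗ[ℂ] Z →ₗ[ℂ] X :=
  LinearMap.mk₂ ℂ
    (fun v w => { toFun := f v w, map_add' := h₃ v w, map_smul' := fun c => h₃' c v w })
    (fun v v' w => LinearMap.ext (h₁ v v' w)) (fun c v w => LinearMap.ext (h₁' c v w))
    (fun v w w' => LinearMap.ext (h₂ v w w')) (fun c v w => LinearMap.ext (h₂' c v w))

/-- The curvature component of the ternary bracket: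
`-(e₁ ⋏ [ω₂, ω₃] + e₂ ⋏ [ω₁, ω₃] + e₃ ⋏ [ω₁, ω₂] + 6 Λ e₁ ⋏ e₂ ⋏ e₃)`. -/
def ell3Curv (Λ : ℝ) : V1 A η →ₗ[ℂ] V1 A η →ₗ[ℂ] V1 A η →ₗ[ℂ] VForm A 3 (Lam 3) :=
  mk₃ (fun a b c =>
      -((curlySo) a.1 ((soBr) b.2 c.2 : VForm A 2 (So η)) +
        (curlySo) b.1 ((soBr) a.2 c.2 : VForm A 2 (So η)) +
        (curlySo) c.1 ((soBr) a.2 b.2 : VForm A 2 (So η)) +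
        (6 * (Λ : ℂ)) • (curly) a.1 ((curly) b.1 c.1 : VForm A 2 (Lam 2))))
    (by intros; simp [smul_add]; abel)
    (by intros; simp [smul_add, smul_comm (6 * (Λ : ℂ))])
    (by intros; simp [smul_add]; abel)
    (by intros; simp [smul_add, smul_comm (6 * (Λ : ℂ))])
    (by intros; simp [smul_add]; abel)
    (by intros; simp [smul_add, smul_comm (6 * (Λ : ℂ))])

/-- The torsion component of the ternary bracket:
`-(e₁ ⋏ (ω₂ ∧ e₃) + e₁ ⋏ (ω₃ ∧ e₂) + e₂ ⋏ (ω₁ ∧ e₃) + e₂ ⋏ (ω₃ ∧ e₁) + e₃ ⋏ (ω₁ ∧ e₂)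
+ e₃ ⋏ (ω₂ ∧ e₁))`. -/
def ell3Tors : V1 A η →ₗ[ℂ] V1 A η →ₗ[ℂ] V1 A η →ₗ[ℂ] VForm A 3 (Lam 2) :=
  mk₃ (fun a b c =>
      -((curly) a.1 ((soTri) b.2 c.1 : VForm A 2 (Lam 1)) +
        (curly) a.1 ((soTri) c.2 b.1 : VForm A 2 (Lam 1)) +
        (curly) b.1 ((soTri) a.2 c.1 : VForm A 2 (Lam 1)) +
        (curly) b.1 ((soTri) c.2 a.1 : VForm A 2 (Lam 1)) +
        (curly) c.1 ((soTri) a.2 b.1 : VForm A 2 (Lam 1)) +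
        (curly) c.1 ((soTri) b.2 a.1 : VForm A 2 (Lam 1))))
    (by intros; simp; abel) (by intros; simp [smul_add])
    (by intros; simp; abel) (by intros; simp [smul_add])
    (by intros; simp; abel) (by intros; simp [smul_add])

/-- The ternary bracket of fields. -/
def ell3 (Λ : ℝ) : V1 A η →ₗ[ℂ] V1 A η →ₗ[ℂ] V1 A η →ₗ[ℂ] V2 A :=
  mk₃ (fun a b c => (ell3Curv Λ a b c, ell3Tors a b c))
    (by intros; simp) (by intros; simp) (by intros; simp) (by intros; simp)
    (by intros; simp) (by intros; simp)

end Brackets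

section Fields

variable {A : Type*} [CommRing A] [Algebra ℂ A] {η : Fin 4 → ℤˣ}

/-- The pair of formal power series `(v, w)`. -/
def FPS.pair {V W : Type*} (v : FPS V) (w : FPS W) : FPS (V × W) := fun n => (v n, w n)

/-- The component `e` of a field `(e, ω)`. -/
def ePart : FPS (V1 A η) →ₗ[ℂ] FPS (VForm A 1 (Lam 1)) := FPS.map (LinearMap.fst ℂ _ _)

/-- The component `ω` of a field `(e, ω)`. -/
def ωPart : FPS (V1 A η) →ₗ[ℂ] FPS (VForm A 1 (So η)) := FPS.map (LinearMap.snd ℂ _ _)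

/-- The component `E` of a field equation `(E, Ω)`. -/
def EPart : FPS (V2 A) →ₗ[ℂ] FPS (VForm A 3 (Lam 3)) := FPS.map (LinearMap.fst ℂ _ _)

/-- The component `Ω` of a field equation `(E, Ω)`. -/
def ΩPart : FPS (V2 A) →ₗ[ℂ] FPS (VForm A 3 (Lam 2)) := FPS.map (LinearMap.snd ℂ _ _)

/-- The exterior derivative of formal power series of one-forms. -/
abbrev D₁ {W : Type*} [AddCommGroup W] [Module ℂ W] : FPS (VForm A 1 W) →ₗ[ℂ] FPS (VForm A 2 W) :=
  FPS.map d₁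

/-- The exterior derivative of formal power series of two-forms. -/
abbrev D₂ {W : Type*} [AddCommGroup W] [Module ℂ W] : FPS (VForm A 2 W) →ₗ[ℂ] FPS (VForm A 3 W) :=
  FPS.map (vd 2 3)

namespace DrinfeldTwist

variable (𝓕 : DrinfeldTwist A)

/-- The braided field equations `F⋆_A = -½ ℓ₂⋆(A, A) - ⅙ ℓ₃⋆(A, A, A)` of a field `A = (e, ω)`. -/
def fieldEq (Λ : ℝ) (Φ : FPS (V1 A η)) : FPS (V2 A) :=
  -((1 / 2 : ℂ) • 𝓕.star ell2 Φ Φ) - (1 / 6 : ℂ) • 𝓕.star₃ (ell3 Λ) Φ Φ Φ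

/-- The component `F⋆_e` of the field equations. -/
def eqE (Λ : ℝ) (e : FPS (VForm A 1 (Lam 1))) (ω : FPS (VForm A 1 (So η))) :
    FPS (VForm A 3 (Lam 3)) :=
  EPart (𝓕.fieldEq Λ (FPS.pair e ω))

/-- The component `F⋆_ω` of the field equations. -/
def eqω (Λ : ℝ) (e : FPS (VForm A 1 (Lam 1))) (ω : FPS (VForm A 1 (So η))) :
    FPS (VForm A 3 (Lam 2)) :=
  ΩPart (𝓕.fieldEq Λ (FPS.pair e ω))

/-- `Φ ⋏⋆ Ψ` for multivector forms. -/
abbrev cur {p q r k l m : ℕ} (h : p + q = r := by norm_num) (h' : k + l = m := by norm_num) :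
    FPS (VForm A p (Lam k)) →ₗ[ℂ] FPS (VForm A q (Lam l)) →ₗ[ℂ] FPS (VForm A r (Lam m)) :=
  𝓕.star (curly h h')

/-- `Φ ⋏⋆ Ω` for a multivector form `Φ` and an `so`-valued form `Ω`. -/
abbrev curR {p q r k m : ℕ} (h : p + q = r := by norm_num) (h' : k + 2 = m := by norm_num) :
    FPS (VForm A p (Lam k)) →ₗ[ℂ] FPS (VForm A q (So η)) →ₗ[ℂ] FPS (VForm A r (Lam m)) :=
  𝓕.star (curlySo h h')

/-- `Ω ⋏⋆ Φ` for an `so`-valued form `Ω` and a multivector form `Φ`. -/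
abbrev curL {p q r k m : ℕ} (h : p + q = r := by norm_num) (h' : 2 + k = m := by norm_num) :
    FPS (VForm A p (So η)) →ₗ[ℂ] FPS (VForm A q (Lam k)) →ₗ[ℂ] FPS (VForm A r (Lam m)) :=
  𝓕.star (soCurly h h')

/-- `e ⋏⋆ e'` for one-forms with values in vectors. -/
abbrev ee : FPS (VForm A 1 (Lam 1)) →ₗ[ℂ] FPS (VForm A 1 (Lam 1)) →ₗ[ℂ] FPS (VForm A 2 (Lam 2)) :=
  𝓕.cur

/-- `[ω, ω']⋆` for one-forms. -/
abbrev br : FPS (VForm A 1 (So η)) →ₗ[ℂ] FPS (VForm A 1 (So η)) →ₗ[ℂ] FPS (VForm A 2 (So η)) :=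
  𝓕.star soBr

/-- `ω ▷⋆ Φ` for a one-form `ω`. -/
abbrev tri {p q k : ℕ} (h : 1 + p = q := by norm_num) :
    FPS (VForm A 1 (So η)) →ₗ[ℂ] FPS (VForm A p (Lam k)) →ₗ[ℂ] FPS (VForm A q (Lam k)) :=
  𝓕.star (soTri h)

/-- The braided curvature `R⋆ = dω + ½ [ω, ω]⋆`. -/
def curvature (ω : FPS (VForm A 1 (So η))) : FPS (VForm A 2 (So η)) :=
  D₁ ω + (1 / 2 : ℂ) • 𝓕.br ω ω

/-- The left torsion `T⋆_L = de + ω ∧⋆ e`. -/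
def torsionL (e : FPS (VForm A 1 (Lam 1))) (ω : FPS (VForm A 1 (So η))) : FPS (VForm A 2 (Lam 1)) :=
  D₁ e + 𝓕.tri (by norm_num) ω e

/-- The right torsion `T⋆_R = de + R_k(ω) ∧⋆ R^k(e)`. -/
def torsionR (e : FPS (VForm A 1 (Lam 1))) (ω : FPS (VForm A 1 (So η))) : FPS (VForm A 2 (Lam 1)) :=
  D₁ e + 𝓕.braid (𝓕.tri (by norm_num)) e ω

/-- The left covariant derivative `d^ω_L Φ = dΦ + ω ▷⋆ Φ` of a two-form. -/
def covDL {k : ℕ} (ω : FPS (VForm A 1 (So η))) (Φ : FPS (VForm A 2 (Lam k))) :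
    FPS (VForm A 3 (Lam k)) :=
  D₂ Φ + 𝓕.tri (by norm_num) ω Φ

/-- The right covariant derivative `d^ω_R Φ = dΦ + R_k(ω) ▷⋆ R^k(Φ)` of a two-form. -/
def covDR {k : ℕ} (ω : FPS (VForm A 1 (So η))) (Φ : FPS (VForm A 2 (Lam k))) :
    FPS (VForm A 3 (Lam k)) :=
  D₂ Φ + 𝓕.braid (𝓕.tri (by norm_num)) Φ ω

/-- `R_k(e₂) ⋏⋆ [R^k(ω₁), ω₃]⋆`. -/
def braidedTerm (ω₁ : FPS (VForm A 1 (So η))) (e₂ : FPS (VForm A 1 (Lam 1)))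
    (ω₃ : FPS (VForm A 1 (So η))) : FPS (VForm A 3 (Lam 3)) :=
  𝓕.braid (𝓕.curR.compl₂ (𝓕.br.flip ω₃)) ω₁ e₂

/-- The left braided gauge variation `λ ↦ δ_λ A = ℓ₁(λ) + ℓ₂⋆(λ, A)` of the field `A`. -/
def gaugeVar (Φ : FPS (V1 A η)) : FPS (V0 A η) →ₗ[ℂ] FPS (V1 A η) :=
  FPS.map ell1 + (𝓕.star ell2Gauge).flip Φ

end DrinfeldTwist

variable (A η) in
/-- An expression in a field `A`, the sum of a quadratic part `b(A, A)` and a cubic part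
`t(A, A, A)`; the order of the arguments of `b` and `t` is the order in which the
factors of the expression are braided. -/
abbrev Expression (X : Type*) [AddCommGroup X] [Module ℂ X] :=
  (FPS (V1 A η) →ₗ[ℂ] FPS (V1 A η) →ₗ[ℂ] FPS X) ×
    (FPS (V1 A η) →ₗ[ℂ] FPS (V1 A η) →ₗ[ℂ] FPS (V1 A η) →ₗ[ℂ] FPS X)

/-- The value of an expression. -/
def Expression.eval {X : Type*} [AddCommGroup X] [Module ℂ X] (T : Expression A η X)
    (Φ : FPS (V1 A η)) : FPS X :=
  T.1 Φ Φ + T.2 Φ Φ Φ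

/-- The left braided gauge variation of an expression, by the braided Leibniz rule:
`b(δ_λ A, A) + b(R_k A, δ_{R^k λ} A)` for the quadratic part and
`t(δ_λ A, A, A) + t(R_k A, δ_{R^k λ} A, A) + t(R_k A, R_l A, δ_{R^l R^k λ} A)`
for the cubic part. -/
def Expression.variation {X : Type*} [AddCommGroup X] [Module ℂ X] (𝓕 : DrinfeldTwist A)
    (T : Expression A η X) (lam : FPS (V0 A η)) (Φ : FPS (V1 A η)) : FPS X :=
  T.1 (𝓕.gaugeVar Φ lam) Φ + 𝓕.braid (T.1.compl₂ (𝓕.gaugeVar Φ)) lam Φ +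
    (T.2 (𝓕.gaugeVar Φ lam) Φ Φ +
      𝓕.braid (LinearMap.mk₂ ℂ (fun Φ' lam' => T.2 Φ' (𝓕.gaugeVar Φ lam') Φ)
        (by intros; simp) (by intros; simp) (by intros; simp) (by intros; simp)) lam Φ +
      𝓕.braid (LinearMap.mk₂ ℂ (fun Φ' lam' => 𝓕.braid ((T.2 Φ').compl₂ (𝓕.gaugeVar Φ)) lam' Φ)
        (by
          intro Φ₁ Φ₂ lam'
          have : (T.2 (Φ₁ + Φ₂)).compl₂ (𝓕.gaugeVar Φ) =
              (T.2 Φ₁).compl₂ (𝓕.gaugeVar Φ) + (T.2 Φ₂).compl₂ (𝓕.gaugeVar Φ) := by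
            ext; simp
          rw [this, DrinfeldTwist.braid_add]; rfl)
        (by
          intro c Φ₁ lam'
          have : (T.2 (c • Φ₁)).compl₂ (𝓕.gaugeVar Φ) = c • (T.2 Φ₁).compl₂ (𝓕.gaugeVar Φ) := by
            ext; simp
          rw [this, DrinfeldTwist.braid_smul]; rfl)
        (by intros; simp) (by intros; simp)) lam Φ)

/-- An expression with values in multivector forms is braided covariant if its braided gauge
variation is `δ_{(ξ, ρ)} T = -ρ ▷⋆ T + L⋆_ξ T`. -/
def Expression.IsCovariant {p k : ℕ} (𝓕 : DrinfeldTwist A) (T : Expression A η (VForm A p (Lam k))) :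
    Prop :=
  ∀ (lam : FPS (V0 A η)) (Φ : FPS (V1 A η)),
    T.variation 𝓕 lam Φ = 𝓕.star (gaugeAct p k) lam (T.eval Φ)

namespace DrinfeldTwist

variable (𝓕 : DrinfeldTwist A)

variable (η) in
/-- `F⋆_e` as an expression. -/
def exprE (Λ : ℝ) : Expression A η (VForm A 3 (Lam 3)) :=
  (-((1 / 2 : ℂ) • (𝓕.star ell2).compr₂ EPart),
    mk₃ (fun a b c => -((1 / 6 : ℂ) • EPart (𝓕.star₃ (ell3 Λ) a b c)))
      (by intros; simp only [map_add, LinearMap.add_apply]; module)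
      (by intros; simp only [map_smul, LinearMap.smul_apply]; module)
      (by intros; simp only [map_add, LinearMap.add_apply]; module)
      (by intros; simp only [map_smul, LinearMap.smul_apply]; module)
      (by intros; simp only [map_add]; module)
      (by intros; simp only [map_smul]; module))

variable (η) in
/-- `F⋆_ω` as an expression. -/
def exprω (Λ : ℝ) : Expression A η (VForm A 3 (Lam 2)) :=
  (-((1 / 2 : ℂ) • (𝓕.star ell2).compr₂ ΩPart),
    mk₃ (fun a b c => -((1 / 6 : ℂ) • ΩPart (𝓕.star₃ (ell3 Λ) a b c)))
      (by intros; simp only [map_add, LinearMap.add_apply]; module)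
      (by intros; simp only [map_smul, LinearMap.smul_apply]; module)
      (by intros; simp only [map_add, LinearMap.add_apply]; module)
      (by intros; simp only [map_smul, LinearMap.smul_apply]; module)
      (by intros; simp only [map_add]; module)
      (by intros; simp only [map_smul]; module))

variable (η) in
/-- `e ⋏⋆ T⋆_L`. -/
def exprETL : Expression A η (VForm A 3 (Lam 2)) :=
  (𝓕.cur.compl₁₂ ePart (D₁ ∘ₗ ePart),
    mk₃ (fun a b c => (𝓕.cur) (ePart a)
        (𝓕.tri (by norm_num) (ωPart b) (ePart c) : FPS (VForm A 2 (Lam 1))))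
      (by intros; simp) (by intros; simp) (by intros; simp) (by intros; simp)
      (by intros; simp) (by intros; simp))

variable (η) in
/-- `T⋆_R ⋏⋆ e`. -/
def exprTRE : Expression A η (VForm A 3 (Lam 2)) :=
  (𝓕.cur.compl₁₂ (D₁ ∘ₗ ePart) ePart,
    mk₃ (fun a b c => (𝓕.cur)
        (𝓕.braid (𝓕.tri (by norm_num)) (ePart a) (ωPart b) : FPS (VForm A 2 (Lam 1))) (ePart c))
      (by intros; simp) (by intros; simp) (by intros; simp) (by intros; simp)
      (by intros; simp) (by intros; simp))

variable (η) in
/-- `d^ω_L (e ⋏⋆ e)`. -/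
def exprDL : Expression A η (VForm A 3 (Lam 2)) :=
  ((𝓕.ee.compl₁₂ ePart ePart).compr₂ D₂,
    mk₃ (fun a b c => 𝓕.tri (by norm_num) (ωPart a) (𝓕.ee (ePart b) (ePart c)))
      (by intros; simp) (by intros; simp) (by intros; simp) (by intros; simp)
      (by intros; simp) (by intros; simp))

variable (η) in
/-- `d^ω_R (e ⋏⋆ e)`. -/
def exprDR : Expression A η (VForm A 3 (Lam 2)) :=
  ((𝓕.ee.compl₁₂ ePart ePart).compr₂ D₂,
    mk₃ (fun a b c => 𝓕.braid (𝓕.tri (by norm_num)) (𝓕.ee (ePart a) (ePart b)) (ωPart c))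
      (by intros; simp) (by intros; simp) (by intros; simp) (by intros; simp)
      (by intros; simp) (by intros; simp))

variable (η) in
/-- `e ⋏⋆ R⋆`. -/
def exprER : Expression A η (VForm A 3 (Lam 3)) :=
  (𝓕.curR.compl₁₂ ePart (D₁ ∘ₗ ωPart),
    mk₃ (fun a b c => (1 / 2 : ℂ) • (𝓕.curR) (ePart a) (𝓕.br (ωPart b) (ωPart c)))
      (by intros; simp only [map_add, LinearMap.add_apply]; module)
      (by intros; simp only [map_smul, LinearMap.smul_apply]; module)
      (by intros; simp only [map_add, LinearMap.add_apply]; module)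
      (by intros; simp only [map_smul, LinearMap.smul_apply]; module)
      (by intros; simp only [map_add]; module)
      (by intros; simp only [map_smul]; module))

variable (η) in
/-- `R⋆ ⋏⋆ e`. -/
def exprRE : Expression A η (VForm A 3 (Lam 3)) :=
  (𝓕.curL.compl₁₂ (D₁ ∘ₗ ωPart) ePart,
    mk₃ (fun a b c => (1 / 2 : ℂ) • (𝓕.curL) (𝓕.br (ωPart a) (ωPart b)) (ePart c))
      (by intros; simp only [map_add, LinearMap.add_apply]; module)
      (by intros; simp only [map_smul, LinearMap.smul_apply]; module)
      (by intros; simp only [map_add, LinearMap.add_apply]; module)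
      (by intros; simp only [map_smul, LinearMap.smul_apply]; module)
      (by intros; simp only [map_add]; module)
      (by intros; simp only [map_smul]; module))

variable (η) in
/-- `e ⋏⋆ e ⋏⋆ e`. -/
def exprEEE : Expression A η (VForm A 3 (Lam 3)) :=
  (0,
    mk₃ (fun a b c => (𝓕.cur) (ePart a) (𝓕.ee (ePart b) (ePart c)))
      (by intros; simp) (by intros; simp) (by intros; simp) (by intros; simp)
      (by intros; simp) (by intros; simp))

variable (η) in
/-- `e ⋏⋆ dω`. -/
def exprEDω : Expression A η (VForm A 3 (Lam 3)) :=
  (𝓕.curR.compl₁₂ ePart (D₁ ∘ₗ ωPart), 0)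

variable (η) in
/-- `dω ⋏⋆ e`. -/
def exprDωE : Expression A η (VForm A 3 (Lam 3)) :=
  (𝓕.curL.compl₁₂ (D₁ ∘ₗ ωPart) ePart, 0)

variable (η) in
/-- `R_k(e) ⋏⋆ [R^k(ω), ω]⋆`. -/
def exprEωω : Expression A η (VForm A 3 (Lam 3)) :=
  (0,
    mk₃ (fun a b c => 𝓕.braidedTerm (ωPart a) (ePart b) (ωPart c))
      (by intros; simp [braidedTerm]) (by intros; simp [braidedTerm])
      (by intros; simp [braidedTerm]) (by intros; simp [braidedTerm])
      (by
        intro a b c c'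
        have : 𝓕.curR.compl₂ (𝓕.br.flip (ωPart (c + c'))) =
            (𝓕.curR.compl₂ (𝓕.br.flip (ωPart c)) + 𝓕.curR.compl₂ (𝓕.br.flip (ωPart c')) :
              FPS (VForm A 1 (Lam 1)) →ₗ[ℂ] FPS (VForm A 1 (So η)) →ₗ[ℂ]
                FPS (VForm A 3 (Lam 3))) := by
          ext; simp
        rw [braidedTerm, this, braid_add]; rfl)
      (by
        intro k a b c
        have : 𝓕.curR.compl₂ (𝓕.br.flip (ωPart (k • c))) =
            (k • 𝓕.curR.compl₂ (𝓕.br.flip (ωPart c)) :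
              FPS (VForm A 1 (Lam 1)) →ₗ[ℂ] FPS (VForm A 1 (So η)) →ₗ[ℂ]
                FPS (VForm A 3 (Lam 3))) := by
          ext; simp
        rw [braidedTerm, this, braid_smul]; rfl))

theorem map_combination {V W : Type*} [AddCommGroup V] [Module ℂ V] [AddCommGroup W] [Module ℂ W]
    (f : V →ₗ[ℂ] W) (c d : ℂ) (a b : V) :
    f (-(c • a) - d • b) = -(c • f a) + -(d • f b) := by
  rw [map_sub, map_neg, map_smul, map_smul, sub_eq_add_neg]

theorem eval_exprE (Λ : ℝ) (e : FPS (VForm A 1 (Lam 1))) (ω : FPS (VForm A 1 (So η))) :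
    (𝓕.exprE η Λ).eval (FPS.pair e ω) = 𝓕.eqE Λ e ω := by
  change -((1 / 2 : ℂ) • EPart (𝓕.star ell2 (FPS.pair e ω) (FPS.pair e ω))) +
    -((1 / 6 : ℂ) • EPart (𝓕.star₃ (ell3 Λ) (FPS.pair e ω) (FPS.pair e ω) (FPS.pair e ω))) = _
  exact (map_combination EPart _ _ _ _).symm

theorem eval_exprω (Λ : ℝ) (e : FPS (VForm A 1 (Lam 1))) (ω : FPS (VForm A 1 (So η))) :
    (𝓕.exprω η Λ).eval (FPS.pair e ω) = 𝓕.eqω Λ e ω := by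
  change -((1 / 2 : ℂ) • ΩPart (𝓕.star ell2 (FPS.pair e ω) (FPS.pair e ω))) +
    -((1 / 6 : ℂ) • ΩPart (𝓕.star₃ (ell3 Λ) (FPS.pair e ω) (FPS.pair e ω) (FPS.pair e ω))) = _
  exact (map_combination ΩPart _ _ _ _).symm

theorem eval_exprETL (e : FPS (VForm A 1 (Lam 1))) (ω : FPS (VForm A 1 (So η))) :
    (𝓕.exprETL η).eval (FPS.pair e ω) = (𝓕.cur) e (𝓕.torsionL e ω) := by
  rw [torsionL, map_add]; rfl

theorem eval_exprTRE (e : FPS (VForm A 1 (Lam 1))) (ω : FPS (VForm A 1 (So η))) :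
    (𝓕.exprTRE η).eval (FPS.pair e ω) = (𝓕.cur) (𝓕.torsionR e ω) e := by
  rw [torsionR, map_add]; rfl

theorem eval_exprDL (e : FPS (VForm A 1 (Lam 1))) (ω : FPS (VForm A 1 (So η))) :
    (𝓕.exprDL η).eval (FPS.pair e ω) = 𝓕.covDL ω (𝓕.ee e e) := rfl

theorem eval_exprDR (e : FPS (VForm A 1 (Lam 1))) (ω : FPS (VForm A 1 (So η))) :
    (𝓕.exprDR η).eval (FPS.pair e ω) = 𝓕.covDR ω (𝓕.ee e e) := rfl

theorem eval_exprER (e : FPS (VForm A 1 (Lam 1))) (ω : FPS (VForm A 1 (So η))) :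
    (𝓕.exprER η).eval (FPS.pair e ω) = (𝓕.curR) e (𝓕.curvature ω) := by
  change (𝓕.curR) e (D₁ ω) + (1 / 2 : ℂ) • (𝓕.curR) e (𝓕.br ω ω) = _
  rw [curvature, LinearMap.map_add _ (D₁ ω) ((1 / 2 : ℂ) • 𝓕.br ω ω),
    LinearMap.map_smul _ (1 / 2 : ℂ) (𝓕.br ω ω)]

theorem eval_exprRE (e : FPS (VForm A 1 (Lam 1))) (ω : FPS (VForm A 1 (So η))) :
    (𝓕.exprRE η).eval (FPS.pair e ω) = (𝓕.curL) (𝓕.curvature ω) e := by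
  change (𝓕.curL) (D₁ ω) e + (1 / 2 : ℂ) • (𝓕.curL) (𝓕.br ω ω) e = _
  rw [curvature, LinearMap.map_add₂ _ (D₁ ω) ((1 / 2 : ℂ) • 𝓕.br ω ω) e,
    LinearMap.map_smul₂ _ (1 / 2 : ℂ) (𝓕.br ω ω) e]

theorem eval_exprEEE (e : FPS (VForm A 1 (Lam 1))) (ω : FPS (VForm A 1 (So η))) :
    (𝓕.exprEEE η).eval (FPS.pair e ω) = (𝓕.cur) e (𝓕.ee e e) :=
  zero_add _

theorem eval_exprEDω (e : FPS (VForm A 1 (Lam 1))) (ω : FPS (VForm A 1 (So η))) :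
    (𝓕.exprEDω η).eval (FPS.pair e ω) = (𝓕.curR) e (D₁ ω) :=
  add_zero _

theorem eval_exprDωE (e : FPS (VForm A 1 (Lam 1))) (ω : FPS (VForm A 1 (So η))) :
    (𝓕.exprDωE η).eval (FPS.pair e ω) = (𝓕.curL) (D₁ ω) e :=
  add_zero _

theorem eval_exprEωω (e : FPS (VForm A 1 (Lam 1))) (ω : FPS (VForm A 1 (So η))) :
    (𝓕.exprEωω η).eval (FPS.pair e ω) = 𝓕.braidedTerm ω e ω :=
  zero_add _

end DrinfeldTwist

end Fields

section Manifold

/-- The algebra of smooth complex-valued functions on a manifold. -/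
def SmoothFunctions (M : Type*) [TopologicalSpace M] [ChartedSpace (EuclideanSpace ℝ (Fin 4)) M] :
    Subalgebra ℂ (M → ℂ) where
  carrier := {f | ContMDiff (𝓡 4) 𝓘(ℝ, ℂ) ((⊤ : ℕ∞) : WithTop ℕ∞) f}
  mul_mem' hf hg := (contDiff_mul (𝕜 := ℝ) (𝔸 := ℂ)).contMDiff.comp (hf.prodMk_space hg)
  add_mem' hf hg := ContMDiff.add hf hg
  algebraMap_mem' _ := contMDiff_const

end Manifold

end BraidedECP

end

open BraidedECP

open scoped TensorProduct Manifold

noncomputable section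

namespace BraidedECP

attribute [local instance 100] LieRing.ofAssociativeRing


/-! ### Explicit formulas for wedge, Lie derivative and exterior derivative in low degree. -/

section Wedge

variable {A : Type*} [CommRing A] [Algebra ℂ A]

/-! Everything reduces to classical multilinear algebra. Vector fields act on all the spaces
involved, and the products and actions out of which the expressions are built are equivariant. When
the inner operation is equivariant, the cocycle identity turns a nested star product, bracketed in
either way, into `star₃` of the nested classical trilinear map (`star_star_right`,
`star_star_left`). Moreover F⁻¹R₂₁ = (F₂₁)⁻¹, so the braided transposition of a star product is the
star product of the flipped map, and every R-matrix disappears (`braid_star`, `braid_star₃_left`,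
`braid_star₃_right`). Hence each expression of the theorem is `deform b t` for classical maps b and
t; the R-matrices survive only as the order of the arguments.

Field equations. Star deformation is linear in the classical map, so it is enough to decompose -½ℓ₂
and -⅙ℓ₃ classically, with independent arguments in a fixed order (`quadω_eq`, `cubω_eq`,
`quadE_eq`, `cubE_eq`). These are the graded Leibniz rules and graded commutativity. If R = 1, star
products are symmetric and on the diagonal a symmetrized bracket agrees with the unsymmetrized one,
which gives the classical form.

Covariance. Sort the braided variation of b(A, A) + t(A, A, A) by degree in A. The linear part
cancels because d² = 0, the cubic part is the gauge action on t because so acts by derivations, and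
the quadratic part differs from the gauge action on b by `star₃` of a classical `anomaly`. So an
expression is covariant exactly when this `star₃` vanishes on the diagonal
(`isCovariant_deform_iff`). For the covariant expressions the classical anomaly is zero: the term
with dρ which d produces is cancelled by the shift of ω by dρ. The three remaining terms have the
anomalies -e⋏[dρ, ω], -[dρ, ω]⋏e and the negative of the sum of these two.

Non-covariance. If such an anomaly vanished on the diagonal, polarization and the coefficient of ħ⁰
would give a classical identity, provided that the leading coefficient of the twist acts trivially
on functions. It does: on A⊗A⊗A it is a differential operator whose inverse is a differential
operator too. The top symbols of such an operator are nilpotent (`exists_mulLeft_pow_eq_zero`), and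
A⊗A⊗A is reduced because its characters separate elements. So the operator is multiplication by a
function (`eq_mulLeft_of_mul_eq_one`), and the counit normalization makes that function 1. The
resulting identity says that e⋏[dρ, ω] vanishes when e, ρ, ω come from three functions with values
in fixed vectors. Coordinates of a chart and two non-commuting rotations refute it. -/

theorem factorial_smul_wedge {p q r : ℕ} (h : p + q = r) (α : Form A p) (β : Form A q)
    (v : Fin r → Vect A) :
    ((p.factorial * q.factorial : ℕ) : A) * wedge h α β v =
      ∑ σ : Equiv.Perm (Fin p ⊕ Fin q), ((Equiv.Perm.sign σ : ℤ) : A) *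
        (α (fun i => v (finCongr h (finSumFinEquiv (σ (Sum.inl i))))) *
          β (fun i => v (finCongr h (finSumFinEquiv (σ (Sum.inr i)))))) := by
  have key := congrArg (fun f => (LinearMap.mul' A A)
    (f (fun i => v (finCongr h (finSumFinEquiv i)))))
    (MultilinearMap.domCoprod_alternization_eq (R' := A) α β)
  simp only [Fintype.card_fin, AlternatingMap.smul_apply, map_nsmul] at key
  have e : wedge h α β v = (LinearMap.mul' A A)
    ((AlternatingMap.domCoprod α β) (fun i => v (finCongr h (finSumFinEquiv i)))) := rfl
  rw [e, ← nsmul_eq_mul, ← key, MultilinearMap.alternatization_apply, map_sum]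
  refine Finset.sum_congr rfl fun σ _ => ?_
  rw [Units.smul_def, map_zsmul, zsmul_eq_mul]
  rfl

theorem natCast_mul_cancel {n : ℕ} (hn : n ≠ 0) {a b : A} (h : (n : A) * a = n * b) : a = b := by
  have e : ∀ x : A, (n : A) * x = (n : ℂ) • x := fun x => by
    rw [Algebra.smul_def, map_natCast]
  rw [e, e] at h
  have := congrArg (fun x => (n : ℂ)⁻¹ • x) h
  simpa only [smul_smul, inv_mul_cancel₀ (Nat.cast_ne_zero.mpr hn : (n : ℂ) ≠ 0), one_smul] using this

/-- The wedge is a sum over shuffles, that is, over a quotient of the permutation group. Multiplied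
by p!q! it becomes a sum over all permutations, which can be evaluated directly, and the factor is
invertible because A is a ℂ-algebra. -/
theorem wedge_cancel {p q r : ℕ} (h : p + q = r) (α : Form A p) (β : Form A q)
    (v : Fin r → Vect A) {a : A}
    (ha : ∑ σ : Equiv.Perm (Fin p ⊕ Fin q), ((Equiv.Perm.sign σ : ℤ) : A) *
        (α (fun i => v (finCongr h (finSumFinEquiv (σ (Sum.inl i))))) *
          β (fun i => v (finCongr h (finSumFinEquiv (σ (Sum.inr i)))))) =
      ((p.factorial * q.factorial : ℕ) : A) * a) : wedge h α β v = a :=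
  natCast_mul_cancel (mul_ne_zero p.factorial_ne_zero q.factorial_ne_zero)
    ((factorial_smul_wedge h α β v).trans ha)

/-- The identity holds for each permutation separately: the p + q insertions of a bracket with X
split into those landing in slots of α and those landing in slots of β. -/
theorem lieForm_wedge {p q r : ℕ} (h : p + q = r) (X : Vect A) (α : Form A p) (β : Form A q) :
    lieForm X (wedge h α β) = wedge h (lieForm X α) β + wedge h α (lieForm X β) := by
  subst h
  ext v
  apply natCast_mul_cancel (mul_ne_zero p.factorial_ne_zero q.factorial_ne_zero)
  rw [lieForm_apply, AlternatingMap.add_apply, mul_add, factorial_smul_wedge, factorial_smul_wedge,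
    mul_sub, Finset.mul_sum]
  have hX : ∀ (n : ℕ) (a : A), (n : A) * X a = X (n * a) := by intro n a; simp
  rw [hX]
  simp only [factorial_smul_wedge]
  rw [map_sum, Finset.sum_comm, ← Finset.sum_sub_distrib, ← Finset.sum_add_distrib]
  refine Finset.sum_congr rfl fun σ _ => ?_
  -- Slots are numbered through σ, so that the sum over slots splits into the two blocks. The sign
  -- of σ is ±1 and is killed by the derivation X.
  let e : Fin p ⊕ Fin q ≃ Fin (p + q) := σ.trans finSumFinEquiv
  have hs : ∀ s : A, (s = 1 ∨ s = -1) → X s = 0 := by rintro s (rfl | rfl) <;> simp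
  have hsg : ((Equiv.Perm.sign σ : ℤ) : A) = 1 ∨ ((Equiv.Perm.sign σ : ℤ) : A) = -1 := by
    rcases Int.units_eq_one_or (Equiv.Perm.sign σ) with h | h <;> simp [h]
  rw [Derivation.leibniz, hs _ hsg, smul_zero, add_zero, Derivation.leibniz, ← e.sum_comp,
    Fintype.sum_sum_type]
  have u1 : ∀ (j : Fin p) (w : Vect A), (fun i => Function.update v (e (Sum.inl j)) w
      (finCongr rfl (finSumFinEquiv (σ (Sum.inl i))))) =
      Function.update (fun i => v (finCongr rfl (finSumFinEquiv (σ (Sum.inl i))))) j w := by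
    intro j w
    funext i
    rcases eq_or_ne i j with rfl | hij
    · rw [Function.update_self]
      exact Function.update_self _ _ _
    · have : e (Sum.inl i) ≠ e (Sum.inl j) := fun h => hij (Sum.inl.inj (e.injective h))
      rw [Function.update_of_ne hij]
      exact Function.update_of_ne this _ _
  have u2 : ∀ (j : Fin p) (w : Vect A), (fun i => Function.update v (e (Sum.inl j)) w
      (finCongr rfl (finSumFinEquiv (σ (Sum.inr i))))) =
      (fun i => v (finCongr rfl (finSumFinEquiv (σ (Sum.inr i))))) := by
    intro j w
    funext i
    have : e (Sum.inr i) ≠ e (Sum.inl j) := fun h => Sum.inr_ne_inl (e.injective h)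
    exact Function.update_of_ne this _ _
  have u3 : ∀ (j : Fin q) (w : Vect A), (fun i => Function.update v (e (Sum.inr j)) w
      (finCongr rfl (finSumFinEquiv (σ (Sum.inr i))))) =
      Function.update (fun i => v (finCongr rfl (finSumFinEquiv (σ (Sum.inr i))))) j w := by
    intro j w
    funext i
    rcases eq_or_ne i j with rfl | hij
    · rw [Function.update_self]
      exact Function.update_self _ _ _
    · have : e (Sum.inr i) ≠ e (Sum.inr j) := fun h => hij (Sum.inr.inj (e.injective h))
      rw [Function.update_of_ne hij]
      exact Function.update_of_ne this _ _
  have u4 : ∀ (j : Fin q) (w : Vect A), (fun i => Function.update v (e (Sum.inr j)) w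
      (finCongr rfl (finSumFinEquiv (σ (Sum.inl i))))) =
      (fun i => v (finCongr rfl (finSumFinEquiv (σ (Sum.inl i))))) := by
    intro j w
    funext i
    have : e (Sum.inl i) ≠ e (Sum.inr j) := fun h => Sum.inl_ne_inr (e.injective h)
    exact Function.update_of_ne this _ _
  simp only [u1, u2, u3, u4, lieForm_apply, smul_eq_mul, ← Finset.mul_sum, ← Finset.sum_mul]
  simp only [e, Equiv.trans_apply, finCongr_refl, Equiv.refl_apply]
  ring

/-- Permutations of Fin 0 ⊕ Fin q are permutations of Fin q. The alternation of β cancels the sign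
of each of them, so all q! terms agree. -/
theorem wedge_zero_apply {q : ℕ} (α : Form A 0) (β : Form A q) (v : Fin q → Vect A) :
    wedge (zero_add q) α β v = α ![] * β v := by
  apply wedge_cancel
  have h0 : ∀ w : Fin 0 → Vect A, α w = α ![] := fun w => congrArg α (Subsingleton.elim _ _)
  let φ : Equiv.Perm (Fin 0 ⊕ Fin q) ≃ Equiv.Perm (Fin q) := (Equiv.emptySum (Fin 0) (Fin q)).permCongr
  rw [← φ.symm.sum_comp]
  have : ∀ τ : Equiv.Perm (Fin q), ((Equiv.Perm.sign (φ.symm τ) : ℤ) : A) *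
        (α (fun i => v (finCongr (zero_add q) (finSumFinEquiv (φ.symm τ (Sum.inl i))))) *
          β (fun i => v (finCongr (zero_add q) (finSumFinEquiv (φ.symm τ (Sum.inr i)))))) =
      α ![] * β v := by
    intro τ
    have e1 : (fun i => v (finCongr (zero_add q) (finSumFinEquiv (φ.symm τ (Sum.inr i))))) =
        v ∘ τ := by
      funext i
      simp only [φ, Equiv.permCongr_symm, Equiv.permCongr_apply, Function.comp]
      congr 1
      ext
      simp
    have e2 : Equiv.Perm.sign (φ.symm τ) = Equiv.Perm.sign τ := by
      rw [Equiv.permCongr_symm]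
      exact Equiv.Perm.sign_permCongr _ _
    rw [h0, e1, e2, AlternatingMap.map_perm, Units.smul_def, zsmul_eq_mul]
    have e3 : (((Equiv.Perm.sign τ : ℤˣ) : ℤ) : A) * ((Equiv.Perm.sign τ : ℤ) : A) = 1 := by
      rw [← Int.cast_mul, ← Units.val_mul, Int.units_mul_self]; simp
    linear_combination (α ![] * β v) * e3
  simp only [this]
  simp [Fintype.card_perm]

/-- The explicit form of the wedge product in low degree, by a sum over permutations of `Fin r`. -/
theorem wedge_cancel' {p q : ℕ} (α : Form A p) (β : Form A q)
    (v : Fin (p + q) → Vect A) {a : A}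
    (ha : ∑ σ : Equiv.Perm (Fin (p + q)), ((Equiv.Perm.sign σ : ℤ) : A) *
        (α (fun i => v (σ (Fin.castAdd q i))) * β (fun i => v (σ (Fin.natAdd p i)))) =
      ((p.factorial * q.factorial : ℕ) : A) * a) : wedge rfl α β v = a := by
  apply wedge_cancel
  rw [← ha, ← (finSumFinEquiv (m := p) (n := q)).permCongr.sum_comp]
  refine Finset.sum_congr rfl fun σ _ => ?_
  rw [Equiv.Perm.sign_permCongr]
  simp [Equiv.permCongr_apply]

theorem form_one_apply (α : Form A 1) (v : Fin 1 → Vect A) : α v = α ![v 0] :=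
  congrArg α (by ext i : 1; fin_cases i; rfl)

theorem form_two_apply (α : Form A 2) (v : Fin 2 → Vect A) : α v = α ![v 0, v 1] :=
  congrArg α (by ext i : 1; fin_cases i <;> rfl)

theorem form_two_swap (α : Form A 2) (X Y : Vect A) : α ![Y, X] = -α ![X, Y] := by
  rw [← α.map_swap ![X, Y] (zero_ne_one : (0 : Fin 2) ≠ 1)]
  congr 1
  ext i : 1; fin_cases i <;> rfl

theorem form_one_ext {α β : Form A 1} (h : ∀ X, α ![X] = β ![X]) : α = β := by
  ext v; rw [form_one_apply α, form_one_apply β, h]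

theorem form_two_ext {α β : Form A 2} (h : ∀ X Y, α ![X, Y] = β ![X, Y]) : α = β := by
  ext v; rw [form_two_apply α, form_two_apply β, h]

theorem form_three_ext {α β : Form A 3} (h : ∀ X Y Z, α ![X, Y, Z] = β ![X, Y, Z]) : α = β := by
  have : ∀ v : Fin 3 → Vect A, v = ![v 0, v 1, v 2] := fun v => by
    ext i : 1; fin_cases i <;> rfl
  ext v; rw [this v, h]

theorem wedge_one_one_apply (α β : Form A 1) (X Y : Vect A) :
    wedge (p := 1) (q := 1) rfl α β ![X, Y] = α ![X] * β ![Y] - α ![Y] * β ![X] := by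
  apply wedge_cancel'
  have hu : (Finset.univ : Finset (Equiv.Perm (Fin (1 + 1)))) = {1, Equiv.swap 0 1} := by decide
  rw [hu, Finset.sum_insert (by decide), Finset.sum_singleton]
  -- Forms are replaced by functions of separate vector arguments, which spares `simp` any
  -- comparison of tuples.
  obtain ⟨a, ha⟩ : ∃ a : Vect A → A, ∀ v, α v = a (v 0) := ⟨fun X => α ![X], form_one_apply α⟩
  obtain ⟨b, hb⟩ : ∃ b : Vect A → A, ∀ v, β v = b (v 0) := ⟨fun X => β ![X], form_one_apply β⟩
  rw [Equiv.Perm.sign_swap (by decide)]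
  simp only [ha, hb, show ![X, Y] 0 = X from rfl, show ![X, Y] 1 = Y from rfl,
    show ![X] 0 = X from rfl, show ![Y] 0 = Y from rfl, show Fin.castAdd 1 (0 : Fin 1) = 0 from rfl, show Fin.natAdd 1 (0 : Fin 1) = 1 from rfl,
    Equiv.Perm.one_apply, Equiv.swap_apply_left, Equiv.swap_apply_right, Equiv.Perm.sign_one,
    Nat.factorial, Units.val_one, Units.val_neg]
  push_cast
  ring

theorem univ_perm_three : (Finset.univ : Finset (Equiv.Perm (Fin 3))) =
    {1, Equiv.swap 0 1, Equiv.swap 0 2, Equiv.swap 1 2, Equiv.swap 0 1 * Equiv.swap 1 2,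
      Equiv.swap 1 2 * Equiv.swap 0 1} := by decide

theorem sum_sign_mul_perm_three {R : Type*} [CommRing R] (f : Equiv.Perm (Fin 3) → R) :
    ∑ σ, ((Equiv.Perm.sign σ : ℤ) : R) * f σ = f 1 - f (Equiv.swap 0 1) - f (Equiv.swap 0 2) -
      f (Equiv.swap 1 2) + f (Equiv.swap 0 1 * Equiv.swap 1 2) +
        f (Equiv.swap 1 2 * Equiv.swap 0 1) := by
  rw [univ_perm_three, Finset.sum_insert (by decide), Finset.sum_insert (by decide),
    Finset.sum_insert (by decide), Finset.sum_insert (by decide), Finset.sum_insert (by decide),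
    Finset.sum_singleton]
  simp
  ring

theorem wedge_one_two_apply (α : Form A 1) (β : Form A 2) (X Y Z : Vect A) :
    wedge (p := 1) (q := 2) rfl α β ![X, Y, Z] =
      α ![X] * β ![Y, Z] - α ![Y] * β ![X, Z] + α ![Z] * β ![X, Y] := by
  apply wedge_cancel'
  rw [sum_sign_mul_perm_three]
  obtain ⟨a, ha⟩ : ∃ a : Vect A → A, ∀ v, α v = a (v 0) := ⟨fun X => α ![X], form_one_apply α⟩
  obtain ⟨b, hb, hs⟩ : ∃ b : Vect A → Vect A → A, (∀ v, β v = b (v 0) (v 1)) ∧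
      ∀ X Y, b Y X = -b X Y := ⟨fun X Y => β ![X, Y], form_two_apply β, form_two_swap β⟩
  simp only [ha, hb, show ![X, Y] 0 = X from rfl, show ![X, Y] 1 = Y from rfl,
    show ![X, Z] 0 = X from rfl, show ![X, Z] 1 = Z from rfl, show ![Y, Z] 0 = Y from rfl,
    show ![Y, Z] 1 = Z from rfl, show ![X] 0 = X from rfl, show ![Y] 0 = Y from rfl,
    show ![Z] 0 = Z from rfl,
        show Fin.castAdd 2 (0 : Fin 1) = 0 from rfl, show Fin.natAdd 1 (0 : Fin 2) = 1 from rfl,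
    show Fin.natAdd 1 (1 : Fin 2) = 2 from rfl, Equiv.Perm.mul_apply, Equiv.Perm.one_apply,
    show Equiv.swap (0 : Fin 3) 1 0 = 1 from rfl, show Equiv.swap (0 : Fin 3) 1 1 = 0 from rfl,
    show Equiv.swap (0 : Fin 3) 1 2 = 2 from rfl, show Equiv.swap (0 : Fin 3) 2 0 = 2 from rfl,
    show Equiv.swap (0 : Fin 3) 2 1 = 1 from rfl, show Equiv.swap (0 : Fin 3) 2 2 = 0 from rfl,
    show Equiv.swap (1 : Fin 3) 2 0 = 0 from rfl, show Equiv.swap (1 : Fin 3) 2 1 = 2 from rfl,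
    show Equiv.swap (1 : Fin 3) 2 2 = 1 from rfl,
    show ![X, Y, Z] 0 = X from rfl, show ![X, Y, Z] 1 = Y from rfl, show ![X, Y, Z] 2 = Z from rfl]
  rw [hs X Z, hs Y Z, hs X Y]
  simp only [Nat.factorial]
  push_cast
  ring

theorem wedge_two_one_apply (α : Form A 2) (β : Form A 1) (X Y Z : Vect A) :
    wedge (p := 2) (q := 1) rfl α β ![X, Y, Z] =
      α ![X, Y] * β ![Z] - α ![X, Z] * β ![Y] + α ![Y, Z] * β ![X] := by
  apply wedge_cancel'
  rw [sum_sign_mul_perm_three]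
  obtain ⟨b, hb⟩ : ∃ b : Vect A → A, ∀ v, β v = b (v 0) := ⟨fun X => β ![X], form_one_apply β⟩
  obtain ⟨a, ha, hs⟩ : ∃ a : Vect A → Vect A → A, (∀ v, α v = a (v 0) (v 1)) ∧
      ∀ X Y, a Y X = -a X Y := ⟨fun X Y => α ![X, Y], form_two_apply α, form_two_swap α⟩
  simp only [ha, hb, show ![X, Y] 0 = X from rfl, show ![X, Y] 1 = Y from rfl,
    show ![X, Z] 0 = X from rfl, show ![X, Z] 1 = Z from rfl, show ![Y, Z] 0 = Y from rfl,
    show ![Y, Z] 1 = Z from rfl, show ![X] 0 = X from rfl, show ![Y] 0 = Y from rfl,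
    show ![Z] 0 = Z from rfl,
        show Fin.castAdd 1 (0 : Fin 2) = 0 from rfl, show Fin.castAdd 1 (1 : Fin 2) = 1 from rfl,
    show Fin.natAdd 2 (0 : Fin 1) = 2 from rfl, Equiv.Perm.mul_apply, Equiv.Perm.one_apply,
    show Equiv.swap (0 : Fin 3) 1 0 = 1 from rfl, show Equiv.swap (0 : Fin 3) 1 1 = 0 from rfl,
    show Equiv.swap (0 : Fin 3) 1 2 = 2 from rfl, show Equiv.swap (0 : Fin 3) 2 0 = 2 from rfl,
    show Equiv.swap (0 : Fin 3) 2 1 = 1 from rfl, show Equiv.swap (0 : Fin 3) 2 2 = 0 from rfl,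
    show Equiv.swap (1 : Fin 3) 2 0 = 0 from rfl, show Equiv.swap (1 : Fin 3) 2 1 = 2 from rfl,
    show Equiv.swap (1 : Fin 3) 2 2 = 1 from rfl,
    show ![X, Y, Z] 0 = X from rfl, show ![X, Y, Z] 1 = Y from rfl, show ![X, Y, Z] 2 = Z from rfl]
  rw [hs X Z, hs Y Z, hs X Y]
  simp only [Nat.factorial]
  push_cast
  ring

theorem wedge_one_one_comm (α β : Form A 1) :
    wedge (p := 1) (q := 1) rfl α β = -wedge (p := 1) (q := 1) rfl β α :=
  form_two_ext fun X Y => by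
    rw [AlternatingMap.neg_apply, wedge_one_one_apply, wedge_one_one_apply]; ring

theorem wedge_one_two_comm (α : Form A 1) (β : Form A 2) :
    wedge (p := 1) (q := 2) rfl α β = wedge (p := 2) (q := 1) rfl β α :=
  form_three_ext fun X Y Z => by
    rw [wedge_one_two_apply, wedge_two_one_apply]; ring

theorem wedge_assoc_one (α β γ : Form A 1) :
    wedge (p := 2) (q := 1) rfl (wedge (p := 1) (q := 1) rfl α β) γ =
      wedge (p := 1) (q := 2) rfl α (wedge (p := 1) (q := 1) rfl β γ) :=
  form_three_ext fun X Y Z => by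
    simp only [wedge_one_two_apply, wedge_two_one_apply, wedge_one_one_apply]; ring

theorem wedge_zero_eq_smul {q : ℕ} (f : Form A 0) (β : Form A q) :
    wedge (zero_add q) f β = f ![] • β := by
  ext v; rw [wedge_zero_apply]; rfl

theorem wedge_fun_smul_left {p q r : ℕ} (h : p + q = r) (f : A) (α : Form A p) (β : Form A q) :
    wedge h (f • α) β = f • wedge h α β := by
  ext v
  apply natCast_mul_cancel (mul_ne_zero p.factorial_ne_zero q.factorial_ne_zero)
  rw [AlternatingMap.smul_apply, smul_eq_mul, mul_left_comm, factorial_smul_wedge,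
    factorial_smul_wedge, Finset.mul_sum]
  refine Finset.sum_congr rfl fun σ _ => ?_
  rw [AlternatingMap.smul_apply, smul_eq_mul]; ring

theorem wedge_fun_smul_right {p q r : ℕ} (h : p + q = r) (f : A) (α : Form A p) (β : Form A q) :
    wedge h α (f • β) = f • wedge h α β := by
  ext v
  apply natCast_mul_cancel (mul_ne_zero p.factorial_ne_zero q.factorial_ne_zero)
  rw [AlternatingMap.smul_apply, smul_eq_mul, mul_left_comm, factorial_smul_wedge,
    factorial_smul_wedge, Finset.mul_sum]
  refine Finset.sum_congr rfl fun σ _ => ?_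
  rw [AlternatingMap.smul_apply, smul_eq_mul]; ring

theorem form_one_add (α : Form A 1) (X Y : Vect A) : α ![X + Y] = α ![X] + α ![Y] := by
  have := α.map_update_add ![X] 0 X Y
  have u : ∀ Z W : Vect A, Function.update ![Z] 0 W = ![W] := fun Z W => by
    ext i : 1; fin_cases i; rfl
  rwa [u, u, u] at this

theorem form_two_add_left (α : Form A 2) (X Y Z : Vect A) :
    α ![X + Y, Z] = α ![X, Z] + α ![Y, Z] := by
  have := α.map_update_add ![X, Z] 0 X Y
  have u : ∀ V W : Vect A, Function.update ![V, Z] 0 W = ![W, Z] := fun V W => by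
    ext i : 1; fin_cases i <;> rfl
  rwa [u, u, u] at this

theorem form_two_neg_right (α : Form A 2) (X Y : Vect A) : α ![X, -Y] = -α ![X, Y] := by
  have := α.map_update_neg ![X, Y] 1 Y
  have u : ∀ V W : Vect A, Function.update ![X, V] 1 W = ![X, W] := fun V W => by
    ext i : 1; fin_cases i <;> rfl
  rwa [u, u] at this

theorem extD_two_apply (α : Form A 2) (X Y Z : Vect A) : extD 2 α ![X, Y, Z] =
    X (α ![Y, Z]) - Y (α ![X, Z]) + Z (α ![X, Y]) -
      α ![⁅X, Y⁆, Z] + α ![⁅X, Z⁆, Y] - α ![⁅Y, Z⁆, X] := by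
  rw [extD_apply]
  have h : ∀ v : Fin 2 → Vect A, v = ![v 0, v 1] := fun v => by ext i : 1; fin_cases i <;> rfl
  have r0 : Fin.removeNth 0 ![X, Y, Z] = ![Y, Z] := h _
  have r1 : Fin.removeNth 1 ![X, Y, Z] = ![X, Z] := h _
  have r2 : Fin.removeNth 2 ![X, Y, Z] = ![X, Y] := h _
  have u0 : ∀ V W U : Vect A, Function.update ![V, W] 0 U = ![U, W] := fun V W U => by
    rw [h (Function.update ![V, W] 0 U)]; rfl
  have u1 : ∀ V W U : Vect A, Function.update ![V, W] 1 U = ![V, U] := fun V W U => by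
    rw [h (Function.update ![V, W] 1 U)]; rfl
  have hn : ∀ V W U : Vect A, α ![⁅W, V⁆, U] = -α ![⁅V, W⁆, U] := by
    intro V W U
    have := α.map_update_neg ![⁅V, W⁆, U] 0 ⁅V, W⁆
    rwa [u0, u0, lie_skew] at this
  refine (congrArg _ (Fin.sum_univ_three _)).trans ?_
  simp only [r0, r1, r2, Fin.sum_univ_two, u0, u1, Fin.val_zero, Fin.val_one, Fin.val_two, pow_zero,
    pow_one, one_smul, show ![X, Y, Z] 0 = X from rfl, show ![X, Y, Z] 1 = Y from rfl,
    show ![X, Y, Z] 2 = Z from rfl, show ![X, Y] 0 = X from rfl, show ![X, Y] 1 = Y from rfl,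
    show ![Y, Z] 0 = Y from rfl, show ![Y, Z] 1 = Z from rfl,
    show ![X, Z] 0 = X from rfl, show ![X, Z] 1 = Z from rfl]
  rw [hn X Y Z, hn X Z Y, form_two_swap α ⁅Y, Z⁆ X, ← lie_skew Z Y, form_two_neg_right,
    form_two_swap α ⁅Y, Z⁆ X, form_two_swap α ⁅X, Z⁆ Y]
  -- The alternated sum in `extD` counts everything twice: derivatives through the explicit factor
  -- 2, and the bracket of each pair once from either of its members.
  have h2 : ∀ a : A, (2⁻¹ : ℂ) • (2 * a) = a := fun a => by
    rw [two_mul, ← two_smul ℂ, smul_smul]; norm_num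
  rw [← h2 (X (α ![Y, Z]) - Y (α ![X, Z]) + Z (α ![X, Y]) -
      α ![⁅X, Y⁆, Z] + α ![⁅X, Z⁆, Y] - α ![⁅Y, Z⁆, X])]
  congr 1
  simp only [neg_smul, one_smul, zsmul_eq_mul]
  push_cast
  ring

theorem lieForm_one_apply (α : Form A 1) (W X : Vect A) :
    lieForm W α ![X] = W (α ![X]) - α ![⁅W, X⁆] := by
  rw [lieForm_apply, Fin.sum_univ_one, form_one_apply α (Function.update _ _ _), Function.update_self]
  rfl

theorem lieForm_two_apply (α : Form A 2) (W X Y : Vect A) :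
    lieForm W α ![X, Y] = W (α ![X, Y]) - α ![⁅W, X⁆, Y] - α ![X, ⁅W, Y⁆] := by
  rw [lieForm_apply, Fin.sum_univ_two, form_two_apply α (Function.update _ 0 _),
    form_two_apply α (Function.update _ 1 _), Function.update_self, Function.update_self,
    Function.update_of_ne (by decide), Function.update_of_ne (by decide), sub_sub]
  rfl

theorem lieForm_three_apply (α : Form A 3) (W X Y Z : Vect A) :
    lieForm W α ![X, Y, Z] = W (α ![X, Y, Z]) - α ![⁅W, X⁆, Y, Z] - α ![X, ⁅W, Y⁆, Z] -
      α ![X, Y, ⁅W, Z⁆] := by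
  have h : ∀ v : Fin 3 → Vect A, α v = α ![v 0, v 1, v 2] := fun v =>
    congrArg α (by ext i : 1; fin_cases i <;> rfl)
  rw [lieForm_apply, Fin.sum_univ_three, h (Function.update _ 0 _), h (Function.update _ 1 _),
    h (Function.update _ 2 _)]
  simp only [Function.update_self]
  rw [Function.update_of_ne (by decide), Function.update_of_ne (by decide),
    Function.update_of_ne (by decide), Function.update_of_ne (by decide),
    Function.update_of_ne (by decide), Function.update_of_ne (by decide), sub_sub, sub_sub,
    ← add_assoc]
  rfl

/-- Only forms of degree at most two are ever differentiated, so that L and d commute is checked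
from the explicit formulas in degrees 0, 1 and 2. -/
theorem lieForm_extD_zero (X : Vect A) (f : Form A 0) :
    lieForm X (extD 0 f) = extD 0 (lieForm X f) :=
  form_one_ext fun Y => by
    rw [lieForm_one_apply, extD_zero_apply, extD_zero_apply, extD_zero_apply, lieForm_apply,
      Derivation.commutator_apply]
    simp

theorem lieForm_extD_one (W : Vect A) (α : Form A 1) :
    lieForm W (extD 1 α) = extD 1 (lieForm W α) :=
  form_two_ext fun X Y => by
    simp only [lieForm_two_apply, extD_one_apply, lieForm_one_apply, map_sub,
      Derivation.commutator_apply, leibniz_lie W X Y, form_one_add]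
    ring

theorem lieForm_extD_two (W : Vect A) (α : Form A 2) :
    lieForm W (extD 2 α) = extD 2 (lieForm W α) :=
  form_three_ext fun X Y Z => by
    simp only [lieForm_three_apply, extD_two_apply, lieForm_two_apply, map_sub, map_add,
      Derivation.commutator_apply, leibniz_lie W X Y, leibniz_lie W X Z, leibniz_lie W Y Z,
      form_two_add_left]
    rw [form_two_swap α Y ⁅X, ⁅W, Z⁆⁆]
    ring

/-- This makes dω insensitive to the inhomogeneous shift ω ↦ ω + dρ, so the part of the variation
linear in the fields cancels. -/
theorem extD_extD_zero (f : Form A 0) : extD 1 (extD 0 f) = 0 :=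
  form_two_ext fun X Y => by
    rw [extD_one_apply, extD_zero_apply, extD_zero_apply, extD_zero_apply,
      Derivation.commutator_apply]
    simp

theorem extD_wedge_zero_one (f : Form A 0) (α : Form A 1) :
    extD 1 (wedge (zero_add 1) f α) =
      wedge (p := 1) (q := 1) rfl (extD 0 f) α + wedge (zero_add 2) f (extD 1 α) :=
  form_two_ext fun X Y => by
    simp only [AlternatingMap.add_apply, extD_one_apply, wedge_one_one_apply, wedge_zero_apply,
      extD_zero_apply, Derivation.leibniz, smul_eq_mul]
    ring

theorem extD_wedge_zero_two (f : Form A 0) (α : Form A 2) :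
    extD 2 (wedge (zero_add 2) f α) =
      wedge (p := 1) (q := 2) rfl (extD 0 f) α + wedge (zero_add 3) f (extD 2 α) :=
  form_three_ext fun X Y Z => by
    simp only [AlternatingMap.add_apply, extD_two_apply, wedge_one_two_apply, wedge_zero_apply,
      extD_zero_apply, Derivation.leibniz, smul_eq_mul]
    ring

theorem extD_wedge_one_one (α β : Form A 1) :
    extD 2 (wedge (p := 1) (q := 1) rfl α β) =
      wedge (p := 2) (q := 1) rfl (extD 1 α) β - wedge (p := 1) (q := 2) rfl α (extD 1 β) :=
  form_three_ext fun X Y Z => by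
    simp only [AlternatingMap.sub_apply, extD_two_apply, extD_one_apply, wedge_one_two_apply,
      wedge_two_one_apply, wedge_one_one_apply, Derivation.leibniz, smul_eq_mul, map_sub]
    ring

end Wedge

/-! ### Power series in ħ: Cauchy products, ħ-linearity and continuity. -/

section FormalPowerSeries

/-- Both sides run over the triples with sum n. This is the associativity of Cauchy products, for
values in any additive monoid. -/
theorem sum_antidiagonal_assoc {M : Type*} [AddCommMonoid M] (f : ℕ → ℕ → ℕ → M) (n : ℕ) :
    ∑ ij ∈ Finset.HasAntidiagonal.antidiagonal n, ∑ kl ∈ Finset.HasAntidiagonal.antidiagonal ij.1, f kl.1 kl.2 ij.2 =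
      ∑ ij ∈ Finset.HasAntidiagonal.antidiagonal n, ∑ kl ∈ Finset.HasAntidiagonal.antidiagonal ij.2, f ij.1 kl.1 kl.2 := by
  rw [Finset.sum_sigma', Finset.sum_sigma']
  refine Finset.sum_nbij' (fun x => ⟨(x.2.1, x.2.2 + x.1.2), (x.2.2, x.1.2)⟩)
    (fun x => ⟨(x.1.1 + x.2.1, x.2.2), (x.1.1, x.2.1)⟩) ?_ ?_ ?_ ?_ ?_ <;>
  · rintro ⟨⟨a, b⟩, ⟨c, d⟩⟩
    simp only [Finset.mem_sigma, Finset.HasAntidiagonal.mem_antidiagonal]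
    rintro ⟨rfl, rfl⟩
    simp [add_assoc]

variable {V W X Y Z : Type*} [AddCommGroup V] [Module ℂ V] [AddCommGroup W] [Module ℂ W]
  [AddCommGroup X] [Module ℂ X] [AddCommGroup Y] [Module ℂ Y] [AddCommGroup Z] [Module ℂ Z]

/-- Multiplication of formal power series by `ħ`. -/
def hshift : FPS V →ₗ[ℂ] FPS V where
  toFun y n := Nat.casesOn n 0 y
  map_add' x y := by funext n; cases n <;> simp
  map_smul' c x := by funext n; cases n <;> simp

theorem hshift_zero (y : FPS V) : hshift y 0 = 0 := rfl

theorem hshift_succ (y : FPS V) (n : ℕ) : hshift y (n + 1) = y n := rfl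

theorem hshift_iterate (k : ℕ) (y : FPS V) (n : ℕ) :
    hshift^[k] y n = if k ≤ n then y (n - k) else 0 := by
  induction k generalizing n with
  | zero => simp
  | succ k ih =>
    rw [Function.iterate_succ_apply']
    cases n with
    | zero => simp [hshift_zero]
    | succ n => rw [hshift_succ, ih]; simp

/-- A map of formal power series is `ħ`-linear if it commutes with the multiplication by `ħ`. -/
def IsHLinear (f : FPS V →ₗ[ℂ] FPS W) : Prop := ∀ y, f (hshift y) = hshift (f y)

/-- The formal power series `∑ ħ^i y_i`. -/
def hsum (y : ℕ → FPS V) : FPS V := fun n => ∑ ij ∈ Finset.HasAntidiagonal.antidiagonal n, y ij.1 ij.2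

theorem IsHLinear.iterate {f : FPS V →ₗ[ℂ] FPS W} (hf : IsHLinear f) (k : ℕ) (y : FPS V) :
    f (hshift^[k] y) = hshift^[k] (f y) := by
  induction k generalizing y with
  | zero => rfl
  | succ k ih => rw [Function.iterate_succ_apply, ih, hf, ← Function.iterate_succ_apply]

/-- An ħ-linear map is continuous for the ħ-adic topology: if x - y is divisible by ħⁿ⁺¹, so is its
image. -/
theorem IsHLinear.congr_coeff {f : FPS V →ₗ[ℂ] FPS W} (hf : IsHLinear f) {x y : FPS V} {n : ℕ}
    (h : ∀ m ≤ n, x m = y m) : f x n = f y n := by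
  rw [← sub_eq_zero, ← Pi.sub_apply, ← map_sub]
  have e : x - y = hshift^[n + 1] (fun m => (x - y) (m + (n + 1))) := by
    funext m
    rw [hshift_iterate]
    split_ifs with hm
    · rw [Nat.sub_add_cancel hm]
    · rw [Pi.sub_apply, h m (by omega), sub_self]
  rw [e, hf.iterate, hshift_iterate, if_neg (by omega)]

theorem hsum_apply_eq (z : ℕ → FPS V) {m n : ℕ} (hm : m ≤ n) :
    hsum z m = (∑ i ∈ Finset.range (n + 1), hshift^[i] (z i)) m := by
  rw [hsum, Finset.Nat.sum_antidiagonal_eq_sum_range_succ_mk, Finset.sum_apply]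
  simp only [hshift_iterate]
  rw [← Finset.sum_filter]
  refine Finset.sum_congr ?_ fun _ _ => rfl
  ext i
  simp only [Finset.mem_range, Finset.mem_filter]
  omega

/-- Modulo ħⁿ⁺¹ the infinite sum is a finite one, to which linearity applies. -/
theorem IsHLinear.map_hsum {f : FPS V →ₗ[ℂ] FPS W} (hf : IsHLinear f) (y : ℕ → FPS V) :
    f (hsum y) = hsum fun i => f (y i) := by
  funext n
  rw [hf.congr_coeff (fun m hm => hsum_apply_eq y hm), map_sum, hsum_apply_eq _ le_rfl]
  simp only [hf.iterate]

theorem isHLinear_map (f : V →ₗ[ℂ] W) : IsHLinear (FPS.map f) := fun y => by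
  funext n; cases n
  · exact map_zero f
  · rfl

theorem map₂_hshift_left (B : V →ₗ[ℂ] W →ₗ[ℂ] X) (v : FPS V) (w : FPS W) :
    FPS.map₂ B (hshift v) w = hshift (FPS.map₂ B v w) := by
  funext n
  cases n with
  | zero => simp [FPS.map₂, hshift_zero]
  | succ n =>
    rw [hshift_succ]
    simp [FPS.map₂, Finset.Nat.sum_antidiagonal_succ, hshift_zero, hshift_succ]

theorem map₂_hshift_right (B : V →ₗ[ℂ] W →ₗ[ℂ] X) (v : FPS V) (w : FPS W) :
    FPS.map₂ B v (hshift w) = hshift (FPS.map₂ B v w) := by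
  funext n
  cases n with
  | zero => simp [FPS.map₂, hshift_zero]
  | succ n =>
    rw [hshift_succ]
    simp [FPS.map₂, Finset.Nat.sum_antidiagonal_succ', hshift_zero, hshift_succ]

/-- The tensor product of formal power series. -/
abbrev htmul : FPS V →ₗ[ℂ] FPS W →ₗ[ℂ] FPS (V ⊗[ℂ] W) := FPS.map₂ (TensorProduct.mk ℂ V W)

theorem htmul_assoc (u : FPS V) (v : FPS W) (w : FPS X) :
    FPS.map (TensorProduct.assoc ℂ V W X).toLinearMap (htmul (htmul u v) w) =
      htmul u (htmul v w) := by
  funext n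
  simp only [FPS.map₂, LinearMap.compLeft_apply, Function.comp, LinearMap.mk₂_apply,
    TensorProduct.mk_apply, TensorProduct.sum_tmul, TensorProduct.tmul_sum, map_sum,
    LinearEquiv.coe_coe, TensorProduct.assoc_tmul]
  exact sum_antidiagonal_assoc (fun i j k => u i ⊗ₜ[ℂ] (v j ⊗ₜ[ℂ] w k)) n

section Action

variable {H K : Type*} [Ring H] [Algebra ℂ H] [Ring K] [Algebra ℂ K]

/-- The action of formal power series with coefficients in an algebra on formal power series with
coefficients in a module. -/
def pact (ρ : H →ₐ[ℂ] Module.End ℂ Y) (P : PowerSeries H) : FPS Y →ₗ[ℂ] FPS Y where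
  toFun y n := ∑ ij ∈ Finset.HasAntidiagonal.antidiagonal n, ρ (PowerSeries.coeff ij.1 P) (y ij.2)
  map_add' x y := by funext n; simp [Finset.sum_add_distrib]
  map_smul' c x := by funext n; simp [Finset.smul_sum]

theorem pact_apply (ρ : H →ₐ[ℂ] Module.End ℂ Y) (P : PowerSeries H) (y : FPS Y) (n : ℕ) :
    pact ρ P y n = ∑ ij ∈ Finset.HasAntidiagonal.antidiagonal n, ρ (PowerSeries.coeff ij.1 P) (y ij.2) := rfl

theorem pact_mul (ρ : H →ₐ[ℂ] Module.End ℂ Y) (P Q : PowerSeries H) (y : FPS Y) :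
    pact ρ (P * Q) y = pact ρ P (pact ρ Q y) := by
  funext n
  simp only [pact_apply, PowerSeries.coeff_mul, map_sum, LinearMap.sum_apply, map_mul,
    Module.End.mul_apply]
  exact sum_antidiagonal_assoc (fun i j k => ρ (PowerSeries.coeff i P)
    (ρ (PowerSeries.coeff j Q) (y k))) n

theorem isHLinear_pact (ρ : H →ₐ[ℂ] Module.End ℂ Y) (P : PowerSeries H) : IsHLinear (pact ρ P) := by
  intro y
  funext n
  cases n with
  | zero => simp [pact_apply, hshift_zero]
  | succ n =>
    rw [hshift_succ]
    simp [pact_apply, Finset.Nat.sum_antidiagonal_succ', hshift_zero, hshift_succ]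

theorem map_pact {ρ : H →ₐ[ℂ] Module.End ℂ Y} {τ : K →ₐ[ℂ] Module.End ℂ Z} (φ : H →+* K)
    (f : Y →ₗ[ℂ] Z) (h : ∀ a y, f (ρ a y) = τ (φ a) (f y)) (P : PowerSeries H) (y : FPS Y) :
    FPS.map f (pact ρ P y) = pact τ (PowerSeries.map φ P) (FPS.map f y) := by
  funext n
  simp [pact_apply, h]

end Action

end FormalPowerSeries

/-! ### Equivariance, twisted bilinear maps and the cancellation of the R-matrix. -/

section Braiding

variable {A : Type*} [CommRing A] [Algebra ℂ A]

variable {V W X Y Z : Type*} [AddCommGroup V] [Module ℂ V] [AddCommGroup W] [Module ℂ W]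
  [AddCommGroup X] [Module ℂ X] [AddCommGroup Y] [Module ℂ Y] [AddCommGroup Z] [Module ℂ Z]
  [EnvModule A V] [EnvModule A W]

attribute [local instance] tensorEnvModule

/-- The action of the enveloping algebra. -/
abbrev uact (A : Type*) [CommRing A] [Algebra ℂ A] (V : Type*) [AddCommGroup V] [Module ℂ V]
    [EnvModule A V] : U A →ₐ[ℂ] Module.End ℂ V := EnvModule.act

/-- The tensor product of two actions. -/
def tensorAct {H K : Type*} [Ring H] [Algebra ℂ H] [Ring K] [Algebra ℂ K]
    (ρ : H →ₐ[ℂ] Module.End ℂ V) (τ : K →ₐ[ℂ] Module.End ℂ W) :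
    H ⊗[ℂ] K →ₐ[ℂ] Module.End ℂ (V ⊗[ℂ] W) :=
  Module.endTensorEndAlgHom.comp (Algebra.TensorProduct.map ρ τ)

theorem tensorAct_tmul {H K : Type*} [Ring H] [Algebra ℂ H] [Ring K] [Algebra ℂ K]
    (ρ : H →ₐ[ℂ] Module.End ℂ V) (τ : K →ₐ[ℂ] Module.End ℂ W) (a : H) (b : K) :
    tensorAct ρ τ (a ⊗ₜ b) = TensorProduct.map (ρ a) (τ b) := rfl

theorem uact_tensor (u : U A) : uact A (V ⊗[ℂ] W) u =
    tensorAct (uact A V) (uact A W) (coproduct A u) := rfl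

theorem coproduct_ι (X : Vect A) : coproduct A (UniversalEnvelopingAlgebra.ι ℂ X) =
    UniversalEnvelopingAlgebra.ι ℂ X ⊗ₜ 1 + 1 ⊗ₜ UniversalEnvelopingAlgebra.ι ℂ X :=
  UniversalEnvelopingAlgebra.lift_ι_apply _ _ _

theorem counit_ι (X : Vect A) : counit A (UniversalEnvelopingAlgebra.ι ℂ X) = 0 :=
  UniversalEnvelopingAlgebra.lift_ι_apply _ _ _

/-- The inclusion of vector fields into the subalgebra they generate lifts to the enveloping
algebra. Followed by the inclusion of the subalgebra, the lift is the identity by the universal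
property. -/
theorem adjoin_range_ι : Algebra.adjoin ℂ
    (Set.range (UniversalEnvelopingAlgebra.ι ℂ : Vect A → U A)) = ⊤ := by
  set S := Algebra.adjoin ℂ (Set.range (UniversalEnvelopingAlgebra.ι ℂ : Vect A → U A))
  let g : Vect A →ₗ⁅ℂ⁆ S :=
    { toFun := fun X => ⟨UniversalEnvelopingAlgebra.ι ℂ X, Algebra.subset_adjoin ⟨X, rfl⟩⟩
      map_add' := fun X Y => Subtype.ext (map_add _ X Y)
      map_smul' := fun c X => Subtype.ext (map_smul _ c X)
      map_lie' := fun {X Y} => Subtype.ext (LieHom.map_lie _ X Y) }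
  have h : S.val.comp (UniversalEnvelopingAlgebra.lift ℂ g) = AlgHom.id ℂ (U A) := by
    apply UniversalEnvelopingAlgebra.hom_ext
    ext X
    change ((UniversalEnvelopingAlgebra.lift ℂ g (UniversalEnvelopingAlgebra.ι ℂ X) : S) : U A) = _
    rw [UniversalEnvelopingAlgebra.lift_ι_apply]
    rfl
  rw [eq_top_iff]
  intro u _
  have := DFunLike.congr_fun h u
  rw [← AlgHom.id_apply (R := ℂ) u, ← this]
  exact (UniversalEnvelopingAlgebra.lift ℂ g u).2

theorem env_induction {p : U A → Prop} (hι : ∀ X : Vect A, p (UniversalEnvelopingAlgebra.ι ℂ X))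
    (hc : ∀ c : ℂ, p (algebraMap ℂ (U A) c)) (hadd : ∀ a b, p a → p b → p (a + b))
    (hmul : ∀ a b, p a → p b → p (a * b)) (u : U A) : p u := by
  have hu : u ∈ Algebra.adjoin ℂ (Set.range (UniversalEnvelopingAlgebra.ι ℂ : Vect A → U A)) := by
    rw [adjoin_range_ι]; trivial
  induction hu using Algebra.adjoin_induction with
  | mem x hx => obtain ⟨X, rfl⟩ := hx; exact hι X
  | algebraMap r => exact hc r
  | add x y _ _ hx hy => exact hadd x y hx hy
  | mul x y _ _ hx hy => exact hmul x y hx hy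

variable (A) in
/-- A linear map which commutes with the action of vector fields. -/
def IsEquivariant (f : V →ₗ[ℂ] W) : Prop := ∀ (u : U A) (v : V), f (uact A V u v) = uact A W u (f v)

/-- The elements with which f commutes form a subalgebra, so the generators suffice. -/
theorem isEquivariant_of_ι {f : V →ₗ[ℂ] W} (h : ∀ (X : Vect A) (v : V),
    f (uact A V (UniversalEnvelopingAlgebra.ι ℂ X) v) =
      uact A W (UniversalEnvelopingAlgebra.ι ℂ X) (f v)) : IsEquivariant A f := by
  intro u
  induction u using env_induction with
  | hι X => exact h X
  | hc c => intro v; simp [Algebra.algebraMap_eq_smul_one]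
  | hadd a b ha hb => intro v; simp [ha v, hb v]
  | hmul a b ha hb => intro v; simp [ha, hb]

variable (A) in
/-- A bilinear map which is equivariant under the action of vector fields. -/
def IsEquivariant₂ [EnvModule A X] (B : V →ₗ[ℂ] W →ₗ[ℂ] X) : Prop := IsEquivariant A (TensorProduct.lift B)

/-- Vector fields are primitive for the coproduct, so equivariance on V ⊗ W is the Leibniz rule for
B. -/
theorem isEquivariant₂_of_ι [EnvModule A X] {B : V →ₗ[ℂ] W →ₗ[ℂ] X} (h : ∀ (Ξ : Vect A) (v : V) (w : W),
    uact A X (UniversalEnvelopingAlgebra.ι ℂ Ξ) (B v w) =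
      B (uact A V (UniversalEnvelopingAlgebra.ι ℂ Ξ) v) w +
        B v (uact A W (UniversalEnvelopingAlgebra.ι ℂ Ξ) w)) : IsEquivariant₂ A B := by
  refine isEquivariant_of_ι fun Ξ x => ?_
  rw [uact_tensor, coproduct_ι, map_add, tensorAct_tmul, tensorAct_tmul]
  induction x with
  | zero => simp
  | add x y hx hy => simp only [map_add, hx, hy]
  | tmul v w =>
    rw [TensorProduct.lift.tmul, h]
    simp only [map_one, LinearMap.add_apply, TensorProduct.map_tmul, map_add,
      TensorProduct.lift.tmul, Module.End.one_apply]

theorem isEquivariant₂_mk : IsEquivariant₂ A (TensorProduct.mk ℂ V W) := by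
  intro u v
  rw [show TensorProduct.lift (TensorProduct.mk ℂ V W) = LinearMap.id by ext; rfl]
  rfl

theorem orbit_map {f : V →ₗ[ℂ] W} (hf : IsEquivariant A f) (v : FPS V) :
    orbit (A := A) (FPS.map f v) = (FPS.map f) ∘ₗ orbit v := by
  ext u n
  exact (hf u (v n)).symm

theorem twistBy_map [EnvModule A X] [EnvModule A Y] (T : PowerSeries (U A ⊗[ℂ] U A)) {f : V →ₗ[ℂ] X} {g : W →ₗ[ℂ] Y}
    (hf : IsEquivariant A f) (hg : IsEquivariant A g) (G : FPS X →ₗ[ℂ] FPS Y →ₗ[ℂ] FPS Z)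
    (v : FPS V) (w : FPS W) : twistBy T G (FPS.map f v) (FPS.map g w) =
      twistBy T (G.compl₁₂ (FPS.map f) (FPS.map g)) v w := by
  have e : TensorProduct.lift (G.compl₁₂ (FPS.map f) (FPS.map g)) =
      TensorProduct.lift G ∘ₗ TensorProduct.map (FPS.map f) (FPS.map g) := by ext; rfl
  funext n
  rw [twistBy_apply, twistBy_apply, e, orbit_map hf, orbit_map hg, TensorProduct.map_comp]
  rfl

theorem twistBy_eq_hsum (T : PowerSeries (U A ⊗[ℂ] U A)) (G : FPS V →ₗ[ℂ] FPS W →ₗ[ℂ] FPS X)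
    (v : FPS V) (w : FPS W) : twistBy T G v w = hsum fun i =>
      TensorProduct.lift G (TensorProduct.map (orbit v) (orbit w) (PowerSeries.coeff i T)) := by
  funext n
  exact twistBy_apply T G v w n

/-- A twisted map is an infinite sum over powers of ħ. A merely ℂ-linear f need not respect it; an
ħ-linear one does. -/
theorem twistBy_comp (T : PowerSeries (U A ⊗[ℂ] U A)) (G : FPS V →ₗ[ℂ] FPS W →ₗ[ℂ] FPS X)
    {f : FPS X →ₗ[ℂ] FPS Y} (hf : IsHLinear f) : twistBy T (G.compr₂ f) = (twistBy T G).compr₂ f := by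
  ext1 v; ext1 w
  rw [LinearMap.compr₂_apply, twistBy_eq_hsum, twistBy_eq_hsum, hf.map_hsum,
    TensorProduct.lift_compr₂]
  rfl

theorem orbit_orbit (v : FPS V) (a u : U A) : orbit (A := A) (orbit v a) u = orbit v (u * a) := by
  funext n
  simp [orbit]

/-- The outer series T acts on the arguments first and S acts on the result, whence the order S * T.
-/
theorem twistBy_twistBy (S T : PowerSeries (U A ⊗[ℂ] U A)) (G : FPS V →ₗ[ℂ] FPS W →ₗ[ℂ] FPS X) :
    twistBy T (twistBy S G) = twistBy (S * T) G := by
  ext1 v; ext1 w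
  funext n
  have key : ∀ (t : U A ⊗[ℂ] U A) (j : ℕ), TensorProduct.lift (twistBy S G)
      (TensorProduct.map (orbit v) (orbit w) t) j = ∑ kl ∈ Finset.HasAntidiagonal.antidiagonal j,
        TensorProduct.lift G
          (TensorProduct.map (orbit v) (orbit w) (PowerSeries.coeff kl.1 S * t)) kl.2 := by
    intro t j
    induction t with
    | zero => simp
    | add x y hx hy => simp [mul_add, hx, hy, Finset.sum_add_distrib]
    | tmul a b =>
      rw [TensorProduct.map_tmul, TensorProduct.lift.tmul, twistBy_apply]
      refine Finset.sum_congr rfl fun kl _ => ?_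
      induction PowerSeries.coeff kl.1 S with
      | zero => simp
      | add x y hx hy => simp only [map_add, add_mul, Pi.add_apply, hx, hy]
      | tmul c d => simp [orbit_orbit]
  rw [twistBy_apply, twistBy_apply]
  simp only [key, PowerSeries.coeff_mul, map_sum, Finset.sum_apply]
  -- The powers of ħ from S and from T arise in the opposite order to that of the Cauchy product;
  -- reassociating, swapping the two indices and reassociating back aligns them.
  have hc := sum_antidiagonal_assoc (fun k i l => TensorProduct.lift G
    (TensorProduct.map (orbit v) (orbit w) (PowerSeries.coeff k S * PowerSeries.coeff i T)) l) n
  rw [hc]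
  have hd := sum_antidiagonal_assoc (fun i k l => TensorProduct.lift G
    (TensorProduct.map (orbit v) (orbit w) (PowerSeries.coeff k S * PowerSeries.coeff i T)) l) n
  rw [← hd, ← hc]
  refine Finset.sum_congr rfl fun ij _ => ?_
  exact (Finset.Nat.sum_antidiagonal_swap (f := fun kl : ℕ × ℕ => TensorProduct.lift G
    (TensorProduct.map (orbit v) (orbit w) (PowerSeries.coeff kl.1 S * PowerSeries.coeff kl.2 T))
      ij.2))

theorem twistBy_one (G : FPS V →ₗ[ℂ] FPS W →ₗ[ℂ] FPS X) :
    twistBy (1 : PowerSeries (U A ⊗[ℂ] U A)) G = G := by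
  ext1 v; ext1 w
  funext n
  rw [twistBy_apply, Finset.sum_eq_single (0, n)]
  · have hv : orbit (A := A) v 1 = v := by funext n; simp [orbit]
    have hw : orbit (A := A) w 1 = w := by funext n; simp [orbit]
    simp [Algebra.TensorProduct.one_def, hv, hw]
  · rintro ⟨i, j⟩ hij hne
    rw [Finset.HasAntidiagonal.mem_antidiagonal] at hij
    have : i ≠ 0 := by rintro rfl; simp_all
    simp [PowerSeries.coeff_one, this]
  · simp

theorem twistBy_transposition_flip (T : PowerSeries (U A ⊗[ℂ] U A))
    (G : FPS V →ₗ[ℂ] FPS W →ₗ[ℂ] FPS X) :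
    (twistBy (transposition T) G).flip = twistBy T G.flip := by
  ext1 v; ext1 w
  funext n
  rw [LinearMap.flip_apply, twistBy_apply, twistBy_apply]
  refine Finset.sum_congr rfl fun ij _ => ?_
  rw [transposition, PowerSeries.coeff_map]
  induction PowerSeries.coeff ij.1 T with
  | zero => simp
  | add x y hx hy => simp only [map_add, Pi.add_apply, hx, hy]
  | tmul a b => simp

theorem twistBy_map₂ (T : PowerSeries (U A ⊗[ℂ] U A)) (B : V →ₗ[ℂ] W →ₗ[ℂ] X) (v : FPS V)
    (w : FPS W) : twistBy T (FPS.map₂ B) v w = FPS.map (TensorProduct.lift B)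
      (pact (tensorAct (uact A V) (uact A W)) T (htmul v w)) := by
  funext n
  rw [twistBy_apply]
  change _ = TensorProduct.lift B _
  rw [pact_apply, map_sum]
  refine Finset.sum_congr rfl fun ij _ => ?_
  induction PowerSeries.coeff ij.1 T with
  | zero => simp
  | add x y hx hy => simp only [map_add, Pi.add_apply, hx, hy, LinearMap.add_apply]
  | tmul a b =>
    rw [tensorAct_tmul, TensorProduct.map_tmul, TensorProduct.lift.tmul]
    simp [FPS.map₂, orbit]

namespace DrinfeldTwist

variable (𝓕 : DrinfeldTwist A)

theorem tmul_apply (v : FPS V) (w : FPS W) : 𝓕.tmul v w =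
    pact (tensorAct (uact A V) (uact A W)) (↑(𝓕.F⁻¹) : PowerSeries (U A ⊗[ℂ] U A)) (htmul v w) := by
  rw [tmul, twistBy_map₂]
  rw [show TensorProduct.lift (TensorProduct.mk ℂ V W) = LinearMap.id by ext; rfl]
  rfl

theorem star_apply (B : V →ₗ[ℂ] W →ₗ[ℂ] X) (v : FPS V) (w : FPS W) :
    𝓕.star B v w = FPS.map (TensorProduct.lift B) (𝓕.tmul v w) := rfl

theorem star_eq_twistBy (B : V →ₗ[ℂ] W →ₗ[ℂ] X) :
    𝓕.star B = twistBy (↑(𝓕.F⁻¹) : PowerSeries (U A ⊗[ℂ] U A)) (FPS.map₂ B) := by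
  ext1 v; ext1 w
  rw [star_apply, tmul_apply, twistBy_map₂]

theorem star_mk : 𝓕.star (TensorProduct.mk ℂ V W) = 𝓕.tmul := by
  rw [star_eq_twistBy]; rfl

theorem isHLinear_star_right (B : V →ₗ[ℂ] W →ₗ[ℂ] X) (v : FPS V) : IsHLinear (𝓕.star B v) := by
  intro w
  rw [star_apply, star_apply, tmul_apply, tmul_apply, map₂_hshift_right, isHLinear_pact,
    isHLinear_map]

theorem isHLinear_star_left (B : V →ₗ[ℂ] W →ₗ[ℂ] X) (w : FPS W) :
    IsHLinear ((𝓕.star B).flip w) := by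
  intro v
  rw [LinearMap.flip_apply, LinearMap.flip_apply, star_apply, star_apply, tmul_apply, tmul_apply,
    map₂_hshift_left, isHLinear_pact, isHLinear_map]

theorem map_star (B : V →ₗ[ℂ] W →ₗ[ℂ] X) (f : X →ₗ[ℂ] Y) (v : FPS V) (w : FPS W) :
    FPS.map f (𝓕.star B v w) = 𝓕.star (B.compr₂ f) v w := by
  rw [star_apply, star_apply, TensorProduct.lift_compr₂]; rfl

theorem star_map [EnvModule A X] [EnvModule A Y] {f : V →ₗ[ℂ] X} {g : W →ₗ[ℂ] Y} (hf : IsEquivariant A f) (hg : IsEquivariant A g)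
    (B : X →ₗ[ℂ] Y →ₗ[ℂ] Z) (v : FPS V) (w : FPS W) :
    𝓕.star B (FPS.map f v) (FPS.map g w) = 𝓕.star (B.compl₁₂ f g) v w := by
  rw [star_eq_twistBy, star_eq_twistBy, twistBy_map _ hf hg]
  congr 3

theorem star_add (B C : V →ₗ[ℂ] W →ₗ[ℂ] X) : 𝓕.star (B + C) = 𝓕.star B + 𝓕.star C := by
  have : TensorProduct.lift (B + C) = TensorProduct.lift B + TensorProduct.lift C := by
    ext; simp
  ext1 v; ext1 w
  rw [LinearMap.add_apply, LinearMap.add_apply, star_apply, star_apply, star_apply, this]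
  rfl

theorem star_smul (c : ℂ) (B : V →ₗ[ℂ] W →ₗ[ℂ] X) : 𝓕.star (c • B) = c • 𝓕.star B := by
  have : TensorProduct.lift (c • B) = c • TensorProduct.lift B := by
    ext; simp
  ext1 v; ext1 w
  rw [LinearMap.smul_apply, LinearMap.smul_apply, star_apply, star_apply, this]
  rfl

theorem transposition_transposition (T : PowerSeries (U A ⊗[ℂ] U A)) :
    transposition (transposition T) = T := by
  ext n
  rw [transposition, PowerSeries.coeff_map, PowerSeries.coeff_map]
  exact (Algebra.TensorProduct.comm ℂ (U A) (U A)).symm_apply_apply _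

/-- With R = F₂₁F⁻¹ one has F⁻¹R₂₁ = F⁻¹F(F₂₁)⁻¹ = (F₂₁)⁻¹. Deforming by F⁻¹ and then braiding is
therefore deforming the flipped map by F⁻¹, and no R-matrix is left. -/
theorem braid_star (B : W →ₗ[ℂ] V →ₗ[ℂ] X) : 𝓕.braid (𝓕.star B) = 𝓕.star B.flip := by
  have hi : transposition 𝓕.F * transposition (↑(𝓕.F⁻¹) : PowerSeries (U A ⊗[ℂ] U A)) = 1 := by
    rw [← map_mul, Units.mul_inv, map_one]
  have hR : (↑(𝓕.F⁻¹) : PowerSeries (U A ⊗[ℂ] U A)) * transposition 𝓕.R =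
      transposition (↑(𝓕.F⁻¹) : PowerSeries (U A ⊗[ℂ] U A)) := by
    rw [R, map_mul, transposition_transposition, ← mul_assoc, Units.inv_mul, one_mul]
  rw [braid, star_eq_twistBy, star_eq_twistBy, twistBy_twistBy, hR, twistBy_transposition_flip]
  congr 1
  ext v w n
  simp only [FPS.map₂, LinearMap.flip_apply, LinearMap.mk₂_apply]
  exact (Finset.Nat.sum_antidiagonal_swap (f := fun kl : ℕ × ℕ => B (w kl.1) (v kl.2))).symm

theorem braid_comp (G : FPS W →ₗ[ℂ] FPS V →ₗ[ℂ] FPS X) {f : FPS X →ₗ[ℂ] FPS Y} (hf : IsHLinear f) :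
    𝓕.braid (G.compr₂ f) = (𝓕.braid G).compr₂ f := by
  rw [braid, twistBy_comp _ _ hf]; rfl

theorem braid_of_R_eq_one (h : 𝓕.R = 1) (G : FPS W →ₗ[ℂ] FPS V →ₗ[ℂ] FPS X) :
    𝓕.braid G = G.flip := by
  rw [braid, h, map_one, twistBy_one]

end DrinfeldTwist

end Braiding

/-! ### Deformed trilinear maps: associativity, nesting and braiding. -/

section Triple

variable {A : Type*} [CommRing A] [Algebra ℂ A]

variable {L V W X Y Z : Type*} [AddCommGroup L] [Module ℂ L] [AddCommGroup V] [Module ℂ V]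
  [AddCommGroup W] [Module ℂ W] [AddCommGroup X] [Module ℂ X] [AddCommGroup Y] [Module ℂ Y]
  [AddCommGroup Z] [Module ℂ Z]

attribute [local instance] tensorEnvModule

theorem mk₃_apply {f : V → W → Z → X} {h₁ h₁' h₂ h₂' h₃ h₃'} (u : V) (v : W) (w : Z) :
    mk₃ f h₁ h₁' h₂ h₂' h₃ h₃' u v w = f u v w := rfl

/-- The trilinear map `(u, v, w) ↦ B (u, C (v, w))`. -/
def nestR (B : V →ₗ[ℂ] Y →ₗ[ℂ] X) (C : W →ₗ[ℂ] Z →ₗ[ℂ] Y) : V →ₗ[ℂ] W →ₗ[ℂ] Z →ₗ[ℂ] X :=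
  mk₃ (fun u v w => B u (C v w)) (by intros; simp) (by intros; simp) (by intros; simp)
    (by intros; simp) (by intros; simp) (by intros; simp)

/-- The trilinear map `(u, v, w) ↦ B (C (u, v), w)`. -/
def nestL (B : Y →ₗ[ℂ] Z →ₗ[ℂ] X) (C : V →ₗ[ℂ] W →ₗ[ℂ] Y) : V →ₗ[ℂ] W →ₗ[ℂ] Z →ₗ[ℂ] X :=
  mk₃ (fun u v w => B (C u v) w) (by intros; simp) (by intros; simp) (by intros; simp)
    (by intros; simp) (by intros; simp) (by intros; simp)

/-- The trilinear map `(u, v, w) ↦ T (u, w, v)`. -/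
def swapR (T : V →ₗ[ℂ] Z →ₗ[ℂ] W →ₗ[ℂ] X) : V →ₗ[ℂ] W →ₗ[ℂ] Z →ₗ[ℂ] X :=
  mk₃ (fun u v w => T u w v) (by intros; simp) (by intros; simp) (by intros; simp)
    (by intros; simp) (by intros; simp) (by intros; simp)

theorem map_id_eq : FPS.map (LinearMap.id : V →ₗ[ℂ] V) = LinearMap.id := rfl

/-- The linear map on the tensor product which corresponds to a trilinear map. -/
def lift₃ (T : V →ₗ[ℂ] W →ₗ[ℂ] Z →ₗ[ℂ] X) : V ⊗[ℂ] (W ⊗[ℂ] Z) →ₗ[ℂ] X :=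
  TensorProduct.lift ((TensorProduct.uncurry (.id ℂ) W Z X) ∘ₗ T)

theorem lift₃_tmul (T : V →ₗ[ℂ] W →ₗ[ℂ] Z →ₗ[ℂ] X) (u : V) (v : W) (w : Z) :
    lift₃ T (u ⊗ₜ (v ⊗ₜ w)) = T u v w := rfl

theorem htmul_pact_right {H K : Type*} [Ring H] [Algebra ℂ H] [Ring K] [Algebra ℂ K]
    (ρ : H →ₐ[ℂ] Module.End ℂ V) (τ : K →ₐ[ℂ] Module.End ℂ W) (Q : PowerSeries K) (u : FPS V)
    (y : FPS W) : htmul u (pact τ Q y) = pact (tensorAct ρ τ)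
      (PowerSeries.map (Algebra.TensorProduct.includeRight : K →ₐ[ℂ] H ⊗[ℂ] K).toRingHom Q)
        (htmul u y) := by
  funext n
  rw [pact_apply]
  simp only [FPS.map₂, LinearMap.mk₂_apply, pact_apply, TensorProduct.mk_apply,
    TensorProduct.tmul_sum, map_sum, PowerSeries.coeff_map, AlgHom.toRingHom_eq_coe,
    RingHom.coe_coe, Algebra.TensorProduct.includeRight_apply, tensorAct_tmul, map_one,
    TensorProduct.map_tmul, Module.End.one_apply]
  rw [← sum_antidiagonal_assoc (fun i j k => u i ⊗ₜ[ℂ] (τ (PowerSeries.coeff j Q)) (y k)) n,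
    ← sum_antidiagonal_assoc (fun j i k => u i ⊗ₜ[ℂ] (τ (PowerSeries.coeff j Q)) (y k)) n]
  refine Finset.sum_congr rfl fun ij _ => ?_
  exact (Finset.Nat.sum_antidiagonal_swap (f := fun kl : ℕ × ℕ =>
    u kl.2 ⊗ₜ[ℂ] (τ (PowerSeries.coeff kl.1 Q)) (y ij.2)))

theorem htmul_pact_left {H K : Type*} [Ring H] [Algebra ℂ H] [Ring K] [Algebra ℂ K]
    (ρ : H →ₐ[ℂ] Module.End ℂ V) (τ : K →ₐ[ℂ] Module.End ℂ W) (Q : PowerSeries H) (u : FPS V)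
    (y : FPS W) : htmul (pact ρ Q u) y = pact (tensorAct ρ τ)
      (PowerSeries.map (Algebra.TensorProduct.includeLeft : H →ₐ[ℂ] H ⊗[ℂ] K).toRingHom Q)
        (htmul u y) := by
  funext n
  rw [pact_apply]
  simp only [FPS.map₂, LinearMap.mk₂_apply, pact_apply, TensorProduct.mk_apply,
    TensorProduct.sum_tmul, map_sum, PowerSeries.coeff_map, AlgHom.toRingHom_eq_coe,
    RingHom.coe_coe, Algebra.TensorProduct.includeLeft_apply, tensorAct_tmul, map_one,
    TensorProduct.map_tmul, Module.End.one_apply]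
  exact sum_antidiagonal_assoc (fun i j k => ρ (PowerSeries.coeff i Q) (u j) ⊗ₜ[ℂ] y k) n

variable [EnvModule A L] [EnvModule A V] [EnvModule A W] [EnvModule A Z]

theorem isEquivariant_id : IsEquivariant A (LinearMap.id : V →ₗ[ℂ] V) := fun _ _ => rfl

theorem IsEquivariant.comp [EnvModule A X] {g : W →ₗ[ℂ] X} {f : V →ₗ[ℂ] W}
    (hg : IsEquivariant A g) (hf : IsEquivariant A f) : IsEquivariant A (g ∘ₗ f) := fun u v => by
  rw [LinearMap.comp_apply, hf, hg]; rfl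

variable (A V W Z) in
/-- The action of the threefold tensor product of the enveloping algebra. -/
abbrev uact₃ : U A ⊗[ℂ] (U A ⊗[ℂ] U A) →ₐ[ℂ] Module.End ℂ (V ⊗[ℂ] (W ⊗[ℂ] Z)) :=
  tensorAct (uact A V) (tensorAct (uact A W) (uact A Z))

namespace DrinfeldTwist

variable (𝓕 : DrinfeldTwist A)

/-- The inverse of `(1 ⊗ F)(id ⊗ Δ)F = (F ⊗ 1)(Δ ⊗ id)F`. -/
def F₃inv : (PowerSeries (U A ⊗[ℂ] (U A ⊗[ℂ] U A)))ˣ :=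
  (Units.map (PowerSeries.map
      (Algebra.TensorProduct.includeRight : U A ⊗[ℂ] U A →ₐ[ℂ] U A ⊗[ℂ] (U A ⊗[ℂ] U A)).toRingHom).toMonoidHom 𝓕.F *
    Units.map (PowerSeries.map
      (Algebra.TensorProduct.map (AlgHom.id ℂ (U A)) (coproduct A)).toRingHom).toMonoidHom 𝓕.F)⁻¹

theorem F₃inv_eq : 𝓕.F₃inv =
    (Units.map (PowerSeries.map
        (Algebra.TensorProduct.assoc ℂ ℂ ℂ (U A) (U A) (U A)).toRingHom).toMonoidHom
      (Units.map (PowerSeries.map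
        (Algebra.TensorProduct.includeLeft : U A ⊗[ℂ] U A →ₐ[ℂ] (U A ⊗[ℂ] U A) ⊗[ℂ] U A).toRingHom).toMonoidHom 𝓕.F *
      Units.map (PowerSeries.map
        (Algebra.TensorProduct.map (coproduct A) (AlgHom.id ℂ (U A))).toRingHom).toMonoidHom 𝓕.F))⁻¹ := by
  rw [F₃inv]
  congr 1
  ext1
  exact 𝓕.cocycle.symm

/-- The outer twist acts on the tensor product through the coproduct, hence as (id ⊗ Δ)F⁻¹; the
inner one acts as 1 ⊗ F⁻¹. -/
theorem tmul_tmul (u : FPS V) (v : FPS W) (w : FPS Z) : 𝓕.tmul u (𝓕.tmul v w) =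
    pact (uact₃ A V W Z) 𝓕.F₃inv (htmul u (htmul v w)) := by
  rw [tmul_apply, tmul_apply, htmul_pact_right (uact A V), F₃inv, mul_inv_rev, Units.val_mul,
    pact_mul]
  have h := map_pact (ρ := tensorAct (uact A V) (uact A (W ⊗[ℂ] Z))) (τ := uact₃ A V W Z)
    (Algebra.TensorProduct.map (AlgHom.id ℂ (U A)) (coproduct A)).toRingHom LinearMap.id (by
      intro a y
      induction a with
      | zero => simp
      | add x y hx hy => simp only [map_add, LinearMap.add_apply, hx, hy]
      | tmul a b => rfl) (↑(𝓕.F⁻¹))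
  exact h _

/-- The cocycle condition says that both bracketings act by one and the same element `F₃inv`. -/
theorem tmul_assoc (u : FPS V) (v : FPS W) (w : FPS Z) :
    FPS.map (TensorProduct.assoc ℂ V W Z).toLinearMap (𝓕.tmul (𝓕.tmul u v) w) =
      𝓕.tmul u (𝓕.tmul v w) := by
  rw [tmul_tmul, tmul_apply, tmul_apply, htmul_pact_left _ (uact A Z)]
  have h := map_pact (ρ := tensorAct (uact A (V ⊗[ℂ] W)) (uact A Z))
    (τ := tensorAct (tensorAct (uact A V) (uact A W)) (uact A Z))
    (Algebra.TensorProduct.map (coproduct A) (AlgHom.id ℂ (U A))).toRingHom LinearMap.id (by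
      intro a y
      induction a with
      | zero => simp
      | add x y hx hy => simp only [map_add, LinearMap.add_apply, hx, hy]
      | tmul a b => rfl) (↑(𝓕.F⁻¹))
  have h' := map_pact (ρ := tensorAct (tensorAct (uact A V) (uact A W)) (uact A Z))
    (τ := uact₃ A V W Z)
    (Algebra.TensorProduct.assoc ℂ ℂ ℂ (U A) (U A) (U A)).toRingHom
    (TensorProduct.assoc ℂ V W Z).toLinearMap (by
      intro a y
      induction a with
      | zero => simp
      | add x y hx hy => simp only [map_add, LinearMap.add_apply, hx, hy]
      | tmul a c =>
        induction a with
        | zero => simp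
        | add x y hx hy => simp only [TensorProduct.add_tmul, map_add, LinearMap.add_apply, hx, hy]
        | tmul a b =>
          have : tensorAct (uact A V) (tensorAct (uact A W) (uact A Z)) (a ⊗ₜ (b ⊗ₜ c)) ∘ₗ
              (TensorProduct.assoc ℂ V W Z).toLinearMap =
              (TensorProduct.assoc ℂ V W Z).toLinearMap ∘ₗ
                tensorAct (tensorAct (uact A V) (uact A W)) (uact A Z) ((a ⊗ₜ b) ⊗ₜ c) := by
            ext; rfl
          exact (LinearMap.congr_fun this y).symm)
  refine (congrArg _ (h _)).trans ?_
  rw [map_id_eq, LinearMap.id_apply, ← pact_mul, h', htmul_assoc, F₃inv_eq, ← map_inv,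
    mul_inv_rev]
  rfl

theorem star₃_apply (T : V →ₗ[ℂ] W →ₗ[ℂ] Z →ₗ[ℂ] X) (u : FPS V) (v : FPS W) (w : FPS Z) :
    𝓕.star₃ T u v w = FPS.map (lift₃ T) (𝓕.tmul u (𝓕.tmul v w)) := rfl

theorem star₃_eq_pact (T : V →ₗ[ℂ] W →ₗ[ℂ] Z →ₗ[ℂ] X) (u : FPS V) (v : FPS W) (w : FPS Z) :
    𝓕.star₃ T u v w =
      FPS.map (lift₃ T) (pact (uact₃ A V W Z) 𝓕.F₃inv (htmul u (htmul v w))) := by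
  rw [star₃_apply, tmul_tmul]

theorem star₃_add (S T : V →ₗ[ℂ] W →ₗ[ℂ] Z →ₗ[ℂ] X) (u : FPS V) (v : FPS W) (w : FPS Z) :
    𝓕.star₃ (S + T) u v w = 𝓕.star₃ S u v w + 𝓕.star₃ T u v w := by
  have : lift₃ (S + T) = lift₃ S + lift₃ T := by
    ext; simp [lift₃]
  rw [star₃_apply, star₃_apply, star₃_apply, this]
  rfl

theorem star₃_smul (c : ℂ) (T : V →ₗ[ℂ] W →ₗ[ℂ] Z →ₗ[ℂ] X) (u : FPS V) (v : FPS W) (w : FPS Z) :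
    𝓕.star₃ (c • T) u v w = c • 𝓕.star₃ T u v w := by
  have : lift₃ (c • T) = c • lift₃ T := by
    ext; simp [lift₃]
  rw [star₃_apply, star₃_apply, this]
  rfl

theorem map_star₃ (f : X →ₗ[ℂ] Y) (T : V →ₗ[ℂ] W →ₗ[ℂ] Z →ₗ[ℂ] X) (u : FPS V) (v : FPS W)
    (w : FPS Z) : FPS.map f (𝓕.star₃ T u v w) =
      𝓕.star₃ (mk₃ (fun u v w => f (T u v w)) (by intros; simp) (by intros; simp) (by intros; simp)
        (by intros; simp) (by intros; simp) (by intros; simp)) u v w := by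
  rw [star₃_apply, star₃_apply]
  have : lift₃ (mk₃ (fun u v w => f (T u v w)) (by intros; simp) (by intros; simp) (by intros; simp)
        (by intros; simp) (by intros; simp) (by intros; simp)) = f ∘ₗ lift₃ T := by
    ext; simp [lift₃, mk₃_apply]
  rw [this]
  rfl

/-- Equivariance of C lets the outer twist pass from values of C to the tensor product of its
arguments. B is outermost and needs no equivariance. -/
theorem star_star_right [EnvModule A Y] (B : V →ₗ[ℂ] Y →ₗ[ℂ] X) {C : W →ₗ[ℂ] Z →ₗ[ℂ] Y}
    (hC : IsEquivariant₂ A C) (u : FPS V) (v : FPS W) (w : FPS Z) :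
    𝓕.star B u (𝓕.star C v w) = 𝓕.star₃ (nestR B C) u v w := by
  rw [𝓕.star_apply C]
  have h := 𝓕.star_map isEquivariant_id hC B u (𝓕.tmul v w)
  rw [map_id_eq, LinearMap.id_apply] at h
  have e : TensorProduct.lift (B.compl₁₂ LinearMap.id (TensorProduct.lift C)) =
      lift₃ (nestR B C) := by
    ext; rfl
  rw [h, star₃_apply, star_apply, e]

/-- As for nesting on the right, with `tmul_assoc` to bring the left bracketing to the standard one.
-/
theorem star_star_left [EnvModule A Y] (B : Y →ₗ[ℂ] Z →ₗ[ℂ] X) {C : V →ₗ[ℂ] W →ₗ[ℂ] Y}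
    (hC : IsEquivariant₂ A C) (u : FPS V) (v : FPS W) (w : FPS Z) :
    𝓕.star B (𝓕.star C u v) w = 𝓕.star₃ (nestL B C) u v w := by
  rw [𝓕.star_apply C]
  have h := 𝓕.star_map hC isEquivariant_id B (𝓕.tmul u v) w
  rw [map_id_eq, LinearMap.id_apply] at h
  rw [h, star₃_apply, star_apply, ← tmul_assoc]
  have : TensorProduct.lift (B.compl₁₂ (TensorProduct.lift C) LinearMap.id) =
      lift₃ (nestL B C) ∘ₗ (TensorProduct.assoc ℂ V W Z).toLinearMap := by
    ext; rfl
  rw [this]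
  rfl

/-- With u fixed, the deformed map is the twisted tensor product of the last two arguments followed
by an ħ-linear map. Braiding passes through the latter, and `braid_star` applies to the former. -/
theorem braid_star₃_right (T : V →ₗ[ℂ] Z →ₗ[ℂ] W →ₗ[ℂ] X) (u : FPS V) (v : FPS W) (w : FPS Z) :
    𝓕.braid (𝓕.star₃ T u) v w = 𝓕.star₃ (swapR T) u v w := by
  have h : 𝓕.star₃ T u = (𝓕.tmul).compr₂
    (𝓕.star ((TensorProduct.uncurry (.id ℂ) Z W X) ∘ₗ T) u) := rfl
  rw [h, braid_comp _ _ (𝓕.isHLinear_star_right _ _), LinearMap.compr₂_apply, ← star_mk, braid_star,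
    𝓕.star_star_right]
  · congr 3
  -- The flipped tensor product is equivariant because the coproduct is cocommutative.
  · refine isEquivariant₂_of_ι fun Ξ v w => ?_
    rw [uact_tensor, coproduct_ι, map_add, tensorAct_tmul, tensorAct_tmul]
    simp only [LinearMap.flip_apply, TensorProduct.mk_apply, LinearMap.add_apply,
      TensorProduct.map_tmul, map_one, Module.End.one_apply]
    abel

theorem braid_star₃_left {G : FPS W →ₗ[ℂ] FPS V →ₗ[ℂ] FPS X} (T : W →ₗ[ℂ] V →ₗ[ℂ] Z →ₗ[ℂ] X)
    (w : FPS Z) (hG : ∀ v u, G v u = 𝓕.star₃ T v u w) (u : FPS V) (v : FPS W) :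
    𝓕.braid G u v = 𝓕.star₃ T.flip u v w := by
  let C : W ⊗[ℂ] V →ₗ[ℂ] Z →ₗ[ℂ] X := TensorProduct.lift T
  have h : G = 𝓕.tmul.compr₂ ((𝓕.star C).flip w) := by
    ext1 v; ext1 u
    rw [hG, LinearMap.compr₂_apply, LinearMap.flip_apply, ← star_mk,
      𝓕.star_star_left _ isEquivariant₂_mk]
    congr 1
  rw [h, braid_comp _ _ (𝓕.isHLinear_star_left _ _), LinearMap.compr₂_apply, ← star_mk, braid_star,
    LinearMap.flip_apply, 𝓕.star_star_left]
  · congr 1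
  · refine isEquivariant₂_of_ι fun Ξ v w => ?_
    rw [uact_tensor, coproduct_ι, map_add, tensorAct_tmul, tensorAct_tmul]
    simp only [LinearMap.flip_apply, TensorProduct.mk_apply, LinearMap.add_apply,
      TensorProduct.map_tmul, map_one, Module.End.one_apply]
    abel

/-- Each of the three terms is `star₃` of a classical trilinear map with arguments in the order l,
v, w, so the braided Leibniz rule is the deformation of the classical one. -/
theorem star_covariant [EnvModule A X] {gV : L →ₗ[ℂ] V →ₗ[ℂ] V} {gW : L →ₗ[ℂ] W →ₗ[ℂ] W}
    {gX : L →ₗ[ℂ] X →ₗ[ℂ] X} (hV : IsEquivariant₂ A gV) (hW : IsEquivariant₂ A gW)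
    {B : V →ₗ[ℂ] W →ₗ[ℂ] X} (hB : IsEquivariant₂ A B)
    (h : ∀ l v w, gX l (B v w) = B (gV l v) w + B v (gW l w)) (l : FPS L) (v : FPS V) (w : FPS W) :
    𝓕.star gX l (𝓕.star B v w) = 𝓕.star B (𝓕.star gV l v) w +
      𝓕.braid ((𝓕.star B).compl₂ ((𝓕.star gW).flip w)) l v := by
  rw [𝓕.star_star_right _ hB, 𝓕.star_star_left _ hV, 𝓕.braid_star₃_left (nestR B gW) w
    (fun v l => 𝓕.star_star_right B hW v l w), ← star₃_add]
  have hT : nestR gX B = nestL B gV + (nestR B gW).flip := by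
    ext l v w
    exact h l v w
  rw [hT]

end DrinfeldTwist

end Triple

/-! ### Multivectors, the action of so and its identification with bivectors. -/

section Multivectors

variable {η : Fin 4 → ℤˣ}

theorem lam_induction {k : ℕ} {p : Lam k → Prop} (u : Lam k)
    (hι : ∀ v : Fin k → Fin 4 → ℂ, p (exteriorPower.ιMulti ℂ k v)) (h0 : p 0)
    (hadd : ∀ u v, p u → p v → p (u + v)) (hsmul : ∀ (c : ℂ) u, p u → p (c • u)) : p u := by
  have hu : u ∈ Submodule.span ℂ (Set.range (exteriorPower.ιMulti ℂ k (M := Fin 4 → ℂ))) := by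
    rw [exteriorPower.ιMulti_span]; trivial
  induction hu using Submodule.span_induction with
  | mem x hx => obtain ⟨v, rfl⟩ := hx; exact hι v
  | zero => exact h0
  | add x y _ _ hx hy => exact hadd x y hx hy
  | smul c x _ hx => exact hsmul c x hx

theorem ιMulti_mul_ιMulti {k l : ℕ} (v : Fin k → Fin 4 → ℂ) (w : Fin l → Fin 4 → ℂ) :
    ExteriorAlgebra.ιMulti ℂ k v * ExteriorAlgebra.ιMulti ℂ l w =
      ExteriorAlgebra.ιMulti ℂ (k + l) (Fin.append v w) := by
  rw [ExteriorAlgebra.ιMulti_apply, ExteriorAlgebra.ιMulti_apply, ExteriorAlgebra.ιMulti_apply,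
    ← List.prod_append, ← List.ofFn_fin_append]
  congr 2
  funext i
  refine Fin.addCases (fun i => ?_) (fun i => ?_) i <;> simp

theorem lamMul_ιMulti {k l : ℕ} (v : Fin k → Fin 4 → ℂ) (w : Fin l → Fin 4 → ℂ) :
    lamMul rfl (exteriorPower.ιMulti ℂ k v) (exteriorPower.ιMulti ℂ l w) =
      exteriorPower.ιMulti ℂ (k + l) (Fin.append v w) :=
  Subtype.ext (ιMulti_mul_ιMulti v w)

/-- The linear map of the vector representation. -/
abbrev soVec (X : So η) : (Fin 4 → ℂ) →ₗ[ℂ] (Fin 4 → ℂ) :=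
  Matrix.toLin' (X : Matrix (Fin 4) (Fin 4) ℂ)

theorem soAct_ιMulti {k : ℕ} (X : So η) (v : Fin k → Fin 4 → ℂ) :
    soAct η k X (exteriorPower.ιMulti ℂ k v) =
      ∑ i, exteriorPower.ιMulti ℂ k (Function.update v i (soVec X (v i))) :=
  exteriorPower.alternatingMapLinearEquiv_apply_ιMulti _ _

/-- On decomposable multivectors the sum over the k + l slots splits into the slots of u and those
of v. -/
theorem soAct_lamMul {k l m : ℕ} (h : k + l = m) (X : So η) (u : Lam k) (v : Lam l) :
    soAct η m X (lamMul h u v) = lamMul h (soAct η k X u) v + lamMul h u (soAct η l X v) := by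
  subst h
  induction u using lam_induction with
  | h0 => simp
  | hadd u u' hu hu' => simp only [map_add, LinearMap.add_apply, hu, hu']; abel
  | hsmul c u hu => simp only [map_smul, LinearMap.smul_apply, hu, smul_add]
  | hι u =>
    induction v using lam_induction with
    | h0 => simp
    | hadd v v' hv hv' => simp only [map_add, hv, hv']; abel
    | hsmul c v hv => simp only [map_smul, hv, smul_add]
    | hι v =>
      rw [lamMul_ιMulti, soAct_ιMulti, soAct_ιMulti, soAct_ιMulti, Fin.sum_univ_add, map_sum,
        LinearMap.sum_apply, map_sum]
      simp only [lamMul_ιMulti, Fin.append_left, Fin.append_right]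
      congr 1 <;> refine Finset.sum_congr rfl fun i _ => congrArg _ ?_
      · funext j
        refine Fin.addCases (fun j => ?_) (fun j => ?_) j
        · rcases eq_or_ne j i with rfl | hj
          · simp
          · rw [Function.update_of_ne (by simpa using hj), Fin.append_left, Fin.append_left,
              Function.update_of_ne hj]
        · rw [Function.update_of_ne (by simp [Fin.ext_iff]; omega), Fin.append_right, Fin.append_right]
      · funext j
        refine Fin.addCases (fun j => ?_) (fun j => ?_) j
        · rw [Function.update_of_ne (by simp [Fin.ext_iff]; omega), Fin.append_left, Fin.append_left]
        · rcases eq_or_ne j i with rfl | hj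
          · simp
          · rw [Function.update_of_ne (by simpa using hj), Fin.append_right, Fin.append_right,
              Function.update_of_ne hj]

theorem soAct_bracket {k : ℕ} (X Y : So η) (u : Lam k) :
    soAct η k ⁅X, Y⁆ u = soAct η k X (soAct η k Y u) - soAct η k Y (soAct η k X u) := by
  induction u using lam_induction with
  | h0 => simp
  | hadd u u' hu hu' => simp only [map_add, hu, hu']; abel
  | hsmul c u hu => simp only [map_smul, hu, smul_sub]
  | hι v =>
    -- `sumUpdate` acts by precomposition, so the order of X and Y is reversed. The reversed
    -- commutator in `sumUpdate_comm` undoes this.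
    have e : ∀ X Y : So η, soAct η k X (soAct η k Y (exteriorPower.ιMulti ℂ k v)) =
        sumUpdate (soVec Y) (sumUpdate (soVec X) (exteriorPower.ιMulti ℂ k)) v := by
      intro X Y
      rw [soAct_ιMulti, map_sum, sumUpdate_apply]
      refine Finset.sum_congr rfl fun i _ => ?_
      rw [soAct_ιMulti, sumUpdate_apply]
    rw [e, e, sumUpdate_comm, soAct_ιMulti, sumUpdate_apply]
    refine Finset.sum_congr rfl fun i _ => ?_
    congr 2
    have : ((⁅X, Y⁆ : So η) : Matrix (Fin 4) (Fin 4) ℂ) = X * Y - Y * X := rfl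
    rw [soVec, this, map_sub, Matrix.toLin'_mul, Matrix.toLin'_mul]

theorem ι_mul_swap (x y : Fin 4 → ℂ) : ExteriorAlgebra.ι ℂ x * ExteriorAlgebra.ι ℂ y =
    -(ExteriorAlgebra.ι ℂ y * ExteriorAlgebra.ι ℂ x) :=
  eq_neg_of_add_eq_zero_left (ExteriorAlgebra.ι_add_mul_swap x y)

theorem coe_ιMulti_one (v : Fin 1 → Fin 4 → ℂ) : ((exteriorPower.ιMulti ℂ 1 v : Lam 1) :
    ExteriorAlgebra ℂ (Fin 4 → ℂ)) = ExteriorAlgebra.ι ℂ (v 0) := by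
  simp [ExteriorAlgebra.ιMulti_apply]

theorem coe_ιMulti_two (v : Fin 2 → Fin 4 → ℂ) : ((exteriorPower.ιMulti ℂ 2 v : Lam 2) :
    ExteriorAlgebra ℂ (Fin 4 → ℂ)) = ExteriorAlgebra.ι ℂ (v 0) * ExteriorAlgebra.ι ℂ (v 1) := by
  simp only [exteriorPower.ιMulti_apply_coe, ExteriorAlgebra.ιMulti_apply, List.ofFn_succ, List.ofFn_zero,
    List.prod_cons, List.prod_nil, mul_one]
  rfl

theorem coe_lamMul {k l m : ℕ} (h : k + l = m) (u : Lam k) (v : Lam l) :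
    ((lamMul h u v : Lam m) : ExteriorAlgebra ℂ (Fin 4 → ℂ)) = u * v := rfl

theorem lamMul_comm_one_one (h h' : 1 + 1 = 2) (u v : Lam 1) : lamMul h u v = -lamMul h' v u := by
  induction u using lam_induction with
  | h0 => simp
  | hadd u u' hu hu' => simp only [map_add, LinearMap.add_apply, hu, hu']; abel
  | hsmul c u hu => simp only [map_smul, LinearMap.smul_apply, hu, smul_neg]
  | hι u =>
    induction v using lam_induction with
    | h0 => simp
    | hadd v v' hv hv' => simp only [map_add, LinearMap.add_apply, hv, hv']; abel
    | hsmul c v hv => simp only [map_smul, LinearMap.smul_apply, hv, smul_neg]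
    | hι v =>
      ext1
      rw [Submodule.coe_neg, coe_lamMul, coe_lamMul, coe_ιMulti_one, coe_ιMulti_one, ι_mul_swap]

theorem lamMul_comm_one_two (h : 1 + 2 = 3) (h' : 2 + 1 = 3) (u : Lam 1) (v : Lam 2) :
    lamMul h u v = lamMul h' v u := by
  induction u using lam_induction with
  | h0 => simp
  | hadd u u' hu hu' => simp only [map_add, LinearMap.add_apply, hu, hu']
  | hsmul c u hu => simp only [map_smul, LinearMap.smul_apply, hu]
  | hι u =>
    induction v using lam_induction with
    | h0 => simp
    | hadd v v' hv hv' => simp only [map_add, LinearMap.add_apply, hv, hv']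
    | hsmul c v hv => simp only [map_smul, LinearMap.smul_apply, hv]
    | hι v =>
      ext1
      rw [coe_lamMul, coe_lamMul, coe_ιMulti_one, coe_ιMulti_two, ← mul_assoc, ι_mul_swap, neg_mul,
        mul_assoc, ι_mul_swap (u 0), mul_neg, neg_neg, mul_assoc]

theorem soToLam_apply (X : So η) : soToLam η X =
    ∑ a, ∑ b, ((X : Matrix (Fin 4) (Fin 4) ℂ) a b * ((η b : ℤ) : ℂ)) •
      exteriorPower.ιMulti ℂ 2 ![Pi.single a (1 : ℂ), Pi.single b (1 : ℂ)] := rfl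

theorem so_skew (X : So η) (a b : Fin 4) : (X : Matrix (Fin 4) (Fin 4) ℂ) b a * ((η b : ℤ) : ℂ) =
    -((η a : ℤ) : ℂ) * (X : Matrix (Fin 4) (Fin 4) ℂ) a b := by
  have h := X.2
  rw [mem_skewAdjointMatricesLieSubalgebra] at h
  have h2 : (X : Matrix (Fin 4) (Fin 4) ℂ).transpose * Matrix.diagonal (fun i => ((η i : ℤ) : ℂ)) =
      Matrix.diagonal (fun i => ((η i : ℤ) : ℂ)) * -(X : Matrix (Fin 4) (Fin 4) ℂ) :=
    (mem_skewAdjointMatricesSubmodule _ _).1 h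
  have h3 := congrFun (congrFun h2 a) b
  rw [Matrix.mul_diagonal, Matrix.diagonal_mul, Matrix.transpose_apply, Matrix.neg_apply] at h3
  rw [h3]; ring

theorem eta_sq (η : Fin 4 → ℤˣ) (a : Fin 4) : ((η a : ℤ) : ℂ) * ((η a : ℤ) : ℂ) = 1 := by
  rcases Int.units_eq_one_or (η a) with h | h <;> simp [h]

/-- The bivector `E_a ∧ E_b`. -/
abbrev bivec (x y : Fin 4 → ℂ) : Lam 2 := exteriorPower.ιMulti ℂ 2 ![x, y]

theorem soVec_single (X : So η) (b : Fin 4) : soVec X (Pi.single b (1 : ℂ)) =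
    ∑ c, (X : Matrix (Fin 4) (Fin 4) ℂ) c b • (Pi.single c (1 : ℂ) : Fin 4 → ℂ) := by
  funext i
  simp [soVec, Pi.single_apply, Finset.sum_apply]

/-- The bivector of Y has the matrix Yη, on which X acts by XYη + YηXᵀ. Since ηXᵀ = -Xη for X in so,
this is [X, Y]η. -/
theorem soAct_soToLam (X Y : So η) : soAct η 2 X (soToLam η Y) = soToLam η ⁅X, Y⁆ := by
  have hb : ∀ (a b : Fin 4), soAct η 2 X (bivec (Pi.single a 1) (Pi.single b 1)) =
      ∑ c, (X : Matrix (Fin 4) (Fin 4) ℂ) c a • bivec (Pi.single c 1) (Pi.single b 1) +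
        ∑ c, (X : Matrix (Fin 4) (Fin 4) ℂ) c b • bivec (Pi.single a 1) (Pi.single c 1) := by
    intro a b
    have u0 : ∀ x y z : Fin 4 → ℂ, Function.update ![x, y] 0 z = ![z, y] := fun x y z => by
      ext i : 1; fin_cases i <;> rfl
    have u1 : ∀ x y z : Fin 4 → ℂ, Function.update ![x, y] 1 z = ![x, z] := fun x y z => by
      ext i : 1; fin_cases i <;> rfl
    rw [soAct_ιMulti, Fin.sum_univ_two, u0, u1]
    simp only [Matrix.cons_val_zero, Matrix.cons_val_one, soVec_single]
    congr 1
    · have := (exteriorPower.ιMulti ℂ 2 (M := Fin 4 → ℂ)).map_update_sum (t := Finset.univ) 0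
        (g := fun c => (X : Matrix (Fin 4) (Fin 4) ℂ) c a • (Pi.single c (1 : ℂ) : Fin 4 → ℂ))
        (m := ![0, Pi.single b 1])
      simp only [u0] at this
      rw [this]
      refine Finset.sum_congr rfl fun c _ => ?_
      have := (exteriorPower.ιMulti ℂ 2 (M := Fin 4 → ℂ)).map_update_smul ![0, Pi.single b 1] 0
        ((X : Matrix (Fin 4) (Fin 4) ℂ) c a) (Pi.single c (1 : ℂ) : Fin 4 → ℂ)
      simpa only [u0] using this
    · have := (exteriorPower.ιMulti ℂ 2 (M := Fin 4 → ℂ)).map_update_sum (t := Finset.univ) 1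
        (g := fun c => (X : Matrix (Fin 4) (Fin 4) ℂ) c b • (Pi.single c (1 : ℂ) : Fin 4 → ℂ))
        (m := ![Pi.single a 1, 0])
      simp only [u1] at this
      rw [this]
      refine Finset.sum_congr rfl fun c _ => ?_
      have := (exteriorPower.ιMulti ℂ 2 (M := Fin 4 → ℂ)).map_update_smul ![Pi.single a 1, 0] 1
        ((X : Matrix (Fin 4) (Fin 4) ℂ) c b) (Pi.single c (1 : ℂ) : Fin 4 → ℂ)
      simpa only [u1] using this
  rw [soToLam_apply, soToLam_apply]
  simp only [map_sum, map_smul, hb, smul_add, Finset.smul_sum, smul_smul, Finset.sum_add_distrib]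
  have hXY : ((⁅X, Y⁆ : So η) : Matrix (Fin 4) (Fin 4) ℂ) = X * Y - Y * X := rfl
  have hR : ∀ P Q : Matrix (Fin 4) (Fin 4) ℂ,
      ∑ a, ∑ b, ((P - Q) a b * ((η b : ℤ) : ℂ)) • bivec (Pi.single a 1) (Pi.single b 1) =
      ∑ a, ∑ b, (P a b * ((η b : ℤ) : ℂ)) • bivec (Pi.single a 1) (Pi.single b 1) +
        -∑ a, ∑ b, (Q a b * ((η b : ℤ) : ℂ)) • bivec (Pi.single a 1) (Pi.single b 1) := by
    intro P Q
    rw [← sub_eq_add_neg, ← Finset.sum_sub_distrib]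
    refine Finset.sum_congr rfl fun a _ => ?_
    rw [← Finset.sum_sub_distrib]
    refine Finset.sum_congr rfl fun b _ => ?_
    refine Eq.trans ?_ (sub_smul (P a b * ((η b : ℤ) : ℂ)) (Q a b * ((η b : ℤ) : ℂ)) _)
    rw [Matrix.sub_apply, sub_mul]
  rw [hXY]
  refine Eq.trans ?_ (hR _ _).symm
  congr 1
  · calc _ = ∑ a, ∑ c, ∑ b, ((Y : Matrix (Fin 4) (Fin 4) ℂ) a b * ((η b : ℤ) : ℂ) *
          (X : Matrix (Fin 4) (Fin 4) ℂ) c a) • bivec (Pi.single c 1) (Pi.single b 1) :=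
            Finset.sum_congr rfl fun a _ => Finset.sum_comm
      _ = ∑ c, ∑ a, ∑ b, ((Y : Matrix (Fin 4) (Fin 4) ℂ) a b * ((η b : ℤ) : ℂ) *
          (X : Matrix (Fin 4) (Fin 4) ℂ) c a) • bivec (Pi.single c 1) (Pi.single b 1) :=
            Finset.sum_comm
      _ = _ := by
        refine Finset.sum_congr rfl fun c _ => ?_
        rw [Finset.sum_comm]
        refine Finset.sum_congr rfl fun b _ => ?_
        rw [← Finset.sum_smul, Matrix.mul_apply, Finset.sum_mul]
        congr 1
        exact Finset.sum_congr rfl fun a _ => by ring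
  · rw [← Finset.sum_neg_distrib]
    refine Finset.sum_congr rfl fun a _ => ?_
    rw [Finset.sum_comm, ← Finset.sum_neg_distrib]
    refine Finset.sum_congr rfl fun c _ => ?_
    rw [← Finset.sum_smul, Matrix.mul_apply, Finset.sum_mul]
    refine Eq.trans ?_ (neg_smul _ _)
    congr 1
    rw [← Finset.sum_neg_distrib]
    refine Finset.sum_congr rfl fun b _ => ?_
    have h := so_skew X b c
    have h1 := eta_sq η b
    have h2 := eta_sq η c
    -- The skewness relation is multiplied by the two signs η_b and η_c; the resulting squares are
    -- 1.
    linear_combination (Y : Matrix (Fin 4) (Fin 4) ℂ) a b * ((η b : ℤ) : ℂ) *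
      ((η c : ℤ) : ℂ) * h - (Y : Matrix (Fin 4) (Fin 4) ℂ) a b * (X : Matrix (Fin 4) (Fin 4) ℂ) c b *
        ((η b : ℤ) : ℂ) * h2 - (Y : Matrix (Fin 4) (Fin 4) ℂ) a b *
          (X : Matrix (Fin 4) (Fin 4) ℂ) b c * ((η c : ℤ) : ℂ) * h1

end Multivectors

/-! ### Forms with values: Leibniz rules, graded symmetry and gauge action. -/

section ValuedForms

variable {A : Type*} [CommRing A] [Algebra ℂ A] {η : Fin 4 → ℤˣ}

variable {W W₁ W₂ W₃ : Type*} [AddCommGroup W] [Module ℂ W] [AddCommGroup W₁] [Module ℂ W₁]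
  [AddCommGroup W₂] [Module ℂ W₂] [AddCommGroup W₃] [Module ℂ W₃] {p q r : ℕ}

/-- The form `α ⊗ w` with values. -/
def vtmul : Form A p →ₗ[ℂ] W →ₗ[ℂ] VForm A p W := TensorProduct.mk ℂ (Form A p) W

theorem vform_induction {P : VForm A p W → Prop} (x : VForm A p W) (h0 : P 0)
    (hadd : ∀ x y, P x → P y → P (x + y)) (ht : ∀ α w, P (vtmul α w)) : P x :=
  TensorProduct.induction_on x h0 ht hadd

theorem formMul_vtmul (h : p + q = r) (B : W₁ →ₗ[ℂ] W₂ →ₗ[ℂ] W₃) (α : Form A p) (β : Form A q)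
    (w : W₁) (z : W₂) :
    formMul h B (vtmul α w) (vtmul β z) = vtmul (wedge h α β) (B w z) := rfl

theorem vLie_vtmul (X : Vect A) (α : Form A p) (w : W) :
    vLie p X (vtmul α w) = vtmul (lieForm X α) w := rfl

theorem uact_vform (X : Vect A) (x : VForm A p W) :
    uact A (VForm A p W) (UniversalEnvelopingAlgebra.ι ℂ X) x = vLie p X x := by
  have h : uact A (Form A p) (UniversalEnvelopingAlgebra.ι ℂ X) = lieRep p X :=
    UniversalEnvelopingAlgebra.lift_ι_apply _ _ _
  change (Module.End.rTensorAlgHom ℂ (Form A p) W) (uact A (Form A p) _) x = _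
  rw [h]; rfl

theorem uact_vect (X Y : Vect A) :
    uact A (Vect A) (UniversalEnvelopingAlgebra.ι ℂ X) Y = ⁅X, Y⁆ := by
  have h : uact A (Vect A) (UniversalEnvelopingAlgebra.ι ℂ X) = LieAlgebra.ad ℂ (Vect A) X :=
    UniversalEnvelopingAlgebra.lift_ι_apply _ _ _
  rw [h]; rfl

theorem uact_prod {V : Type*} [AddCommGroup V] [Module ℂ V] [EnvModule A V] [EnvModule A W]
    (u : U A) (x : V × W) : uact A (V × W) u x = (uact A V u x.1, uact A W u x.2) := rfl

theorem vLie_lie (X Y : Vect A) (x : VForm A p W) :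
    vLie p ⁅X, Y⁆ x = vLie p X (vLie p Y x) - vLie p Y (vLie p X x) := by
  induction x using vform_induction with
  | h0 => simp
  | hadd x y hx hy => simp only [map_add, hx, hy]; abel
  | ht α w =>
    simp only [vLie_vtmul]
    have : lieForm ⁅X, Y⁆ α = lieForm X (lieForm Y α) - lieForm Y (lieForm X α) :=
      LinearMap.congr_fun (LieHom.map_lie (lieRep p) X Y) α
    rw [this, map_sub]; rfl

theorem vd_vtmul_zero (h : 0 + 1 = 1) (α : Form A 0) (w : W) :
    vd 0 1 h (vtmul α w) = vtmul (extD 0 α) w := rfl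

theorem vd_vtmul_one (h : 1 + 1 = 2) (α : Form A 1) (w : W) :
    vd 1 2 h (vtmul α w) = vtmul (extD 1 α) w := rfl

theorem vd_vtmul_two (h : 2 + 1 = 3) (α : Form A 2) (w : W) :
    vd 2 3 h (vtmul α w) = vtmul (extD 2 α) w := rfl

theorem vLie_formMul (h : p + q = r) (B : W₁ →ₗ[ℂ] W₂ →ₗ[ℂ] W₃) (X : Vect A) (x : VForm A p W₁)
    (y : VForm A q W₂) : vLie r X (formMul h B x y) =
      formMul h B (vLie p X x) y + formMul h B x (vLie q X y) := by
  induction x using vform_induction with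
  | h0 => simp
  | hadd x x' hx hx' => simp only [map_add, LinearMap.add_apply, hx, hx']; abel
  | ht α w =>
    induction y using vform_induction with
    | h0 => simp
    | hadd y y' hy hy' => simp only [map_add, hy, hy']; abel
    | ht β z =>
      simp only [vLie_vtmul, formMul_vtmul, lieForm_wedge, map_add, LinearMap.add_apply]

/-- Form degree and value degree contribute independent signs s and t; no mixed sign occurs. -/
theorem formMul_swap {h h' : _} {B : W₁ →ₗ[ℂ] W₂ →ₗ[ℂ] W₃} {C : W₂ →ₗ[ℂ] W₁ →ₗ[ℂ] W₃} {s t : ℂ}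
    (hs : ∀ (α : Form A p) (β : Form A q), wedge (r := r) h α β = s • wedge h' β α)
    (ht : ∀ w z, B w z = t • C z w) (x : VForm A p W₁) (y : VForm A q W₂) :
    formMul h B x y = (s * t) • formMul h' C y x := by
  induction x using vform_induction with
  | h0 => simp
  | hadd x x' hx hx' => simp only [map_add, LinearMap.add_apply, hx, hx', smul_add]
  | ht α w =>
    induction y using vform_induction with
    | h0 => simp
    | hadd y y' hy hy' => simp only [map_add, LinearMap.add_apply, hy, hy', smul_add]
    | ht β z =>
      simp only [formMul_vtmul, hs, ht, map_smul, LinearMap.smul_apply, smul_smul, mul_comm]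

theorem vd_vLie_zero (h : 0 + 1 = 1) (X : Vect A) (x : VForm A 0 W) :
    vd 0 1 h (vLie 0 X x) = vLie 1 X (vd 0 1 h x) := by
  induction x using vform_induction with
  | h0 => simp
  | hadd x y hx hy => simp only [map_add, hx, hy]
  | ht α w => rw [vLie_vtmul, vd_vtmul_zero, vd_vtmul_zero, vLie_vtmul, lieForm_extD_zero]

theorem vd_vLie_one (h : 1 + 1 = 2) (X : Vect A) (x : VForm A 1 W) :
    vd 1 2 h (vLie 1 X x) = vLie 2 X (vd 1 2 h x) := by
  induction x using vform_induction with
  | h0 => simp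
  | hadd x y hx hy => simp only [map_add, hx, hy]
  | ht α w => rw [vLie_vtmul, vd_vtmul_one, vd_vtmul_one, vLie_vtmul, lieForm_extD_one]

theorem vd_vLie_two (h : 2 + 1 = 3) (X : Vect A) (x : VForm A 2 W) :
    vd 2 3 h (vLie 2 X x) = vLie 3 X (vd 2 3 h x) := by
  induction x using vform_induction with
  | h0 => simp
  | hadd x y hx hy => simp only [map_add, hx, hy]
  | ht α w => rw [vLie_vtmul, vd_vtmul_two, vd_vtmul_two, vLie_vtmul, lieForm_extD_two]

theorem vd_vd_zero (h : 0 + 1 = 1) (h' : 1 + 1 = 2) (x : VForm A 0 W) :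
    vd 1 2 h' (vd 0 1 h x) = 0 := by
  induction x using vform_induction with
  | h0 => simp
  | hadd x y hx hy => simp only [map_add, hx, hy, add_zero]
  | ht α w => rw [vd_vtmul_zero, vd_vtmul_one, extD_extD_zero, map_zero]; rfl

theorem vd_formMul_zero_one (h : 0 + 1 = 1) (h' : 1 + 1 = 2) (h'' : 0 + 2 = 2)
    (B : W₁ →ₗ[ℂ] W₂ →ₗ[ℂ] W₃) (x : VForm A 0 W₁) (y : VForm A 1 W₂) :
    vd 1 2 h' (formMul h B x y) =
      formMul h' B (vd 0 1 h x) y + formMul h'' B x (vd 1 2 h' y) := by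
  induction x using vform_induction with
  | h0 => simp
  | hadd x x' hx hx' => simp only [map_add, LinearMap.add_apply, hx, hx']; abel
  | ht α w =>
    induction y using vform_induction with
    | h0 => simp
    | hadd y y' hy hy' => simp only [map_add, hy, hy']; abel
    | ht β z =>
      simp only [vd_vtmul_zero, vd_vtmul_one, formMul_vtmul, extD_wedge_zero_one, map_add,
        LinearMap.add_apply]

theorem vd_formMul_zero_two (h : 0 + 2 = 2) (h' : 2 + 1 = 3) (h'' : 0 + 3 = 3) (h₁ : 0 + 1 = 1)
    (h₂ : 1 + 2 = 3) (B : W₁ →ₗ[ℂ] W₂ →ₗ[ℂ] W₃) (x : VForm A 0 W₁) (y : VForm A 2 W₂) :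
    vd 2 3 h' (formMul h B x y) =
      formMul h₂ B (vd 0 1 h₁ x) y + formMul h'' B x (vd 2 3 h' y) := by
  induction x using vform_induction with
  | h0 => simp
  | hadd x x' hx hx' => simp only [map_add, LinearMap.add_apply, hx, hx']; abel
  | ht α w =>
    induction y using vform_induction with
    | h0 => simp
    | hadd y y' hy hy' => simp only [map_add, hy, hy']; abel
    | ht β z =>
      simp only [vd_vtmul_zero, vd_vtmul_two, formMul_vtmul, extD_wedge_zero_two, map_add,
        LinearMap.add_apply]

theorem vd_formMul_one_one (h : 1 + 1 = 2) (h' : 2 + 1 = 3) (h'' : 1 + 2 = 3)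
    (B : W₁ →ₗ[ℂ] W₂ →ₗ[ℂ] W₃) (x : VForm A 1 W₁) (y : VForm A 1 W₂) :
    vd 2 3 h' (formMul h B x y) =
      formMul h' B (vd 1 2 h x) y - formMul h'' B x (vd 1 2 h y) := by
  induction x using vform_induction with
  | h0 => simp
  | hadd x x' hx hx' => simp only [map_add, LinearMap.add_apply, hx, hx']; abel
  | ht α w =>
    induction y using vform_induction with
    | h0 => simp
    | hadd y y' hy hy' => simp only [map_add, hy, hy']; abel
    | ht β z =>
      simp only [vd_vtmul_one, vd_vtmul_two, formMul_vtmul, extD_wedge_one_one, map_sub,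
        LinearMap.sub_apply]

/-- The action of gauge parameters on forms with values in a representation of `so`. -/
def gact (κ : So η →ₗ[ℂ] W →ₗ[ℂ] W) (p : ℕ) : V0 A η →ₗ[ℂ] VForm A p W →ₗ[ℂ] VForm A p W :=
  LinearMap.mk₂ ℂ (fun l x => -formMul (zero_add p) κ l.2 x + vLie p l.1 x)
    (by intros; simp; abel) (by intros; simp) (by intros; simp; abel) (by intros; simp)

theorem gact_apply (κ : So η →ₗ[ℂ] W →ₗ[ℂ] W) (l : V0 A η) (x : VForm A p W) :
    gact κ p l x = -formMul (zero_add p) κ l.2 x + vLie p l.1 x := rfl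

theorem ell2Gauge_apply (l : V0 A η) (a : V1 A η) :
    ell2Gauge l a = (gact (soAct η 1) 1 l a.1, gact (soBracket η) 1 l a.2) := rfl

/-- The form part of ρ is a function and can be pulled out of either factor of a wedge, so the
Leibniz rule is that of the values. -/
theorem formMul_zero_formMul {κ₁ : So η →ₗ[ℂ] W₁ →ₗ[ℂ] W₁} {κ₂ : So η →ₗ[ℂ] W₂ →ₗ[ℂ] W₂}
    {κ₃ : So η →ₗ[ℂ] W₃ →ₗ[ℂ] W₃} {B : W₁ →ₗ[ℂ] W₂ →ₗ[ℂ] W₃}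
    (hB : ∀ X w z, κ₃ X (B w z) = B (κ₁ X w) z + B w (κ₂ X z)) (h : p + q = r)
    (ρ : VForm A 0 (So η)) (x : VForm A p W₁) (y : VForm A q W₂) :
    formMul (zero_add r) κ₃ ρ (formMul h B x y) =
      formMul h B (formMul (zero_add p) κ₁ ρ x) y + formMul h B x (formMul (zero_add q) κ₂ ρ y) := by
  induction ρ using vform_induction with
  | h0 => simp
  | hadd x x' hx hx' => simp only [map_add, LinearMap.add_apply, hx, hx']; abel
  | ht f X =>
    induction x using vform_induction with
    | h0 => simp
    | hadd x x' hx hx' => simp only [map_add, LinearMap.add_apply, hx, hx']; abel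
    | ht α w =>
      induction y using vform_induction with
      | h0 => simp
      | hadd y y' hy hy' => simp only [map_add, hy, hy']; abel
      | ht β z =>
        simp only [formMul_vtmul, hB, map_add, wedge_zero_eq_smul, wedge_fun_smul_left,
          wedge_fun_smul_right]

theorem gact_formMul {κ₁ : So η →ₗ[ℂ] W₁ →ₗ[ℂ] W₁} {κ₂ : So η →ₗ[ℂ] W₂ →ₗ[ℂ] W₂}
    {κ₃ : So η →ₗ[ℂ] W₃ →ₗ[ℂ] W₃} {B : W₁ →ₗ[ℂ] W₂ →ₗ[ℂ] W₃}
    (hB : ∀ X w z, κ₃ X (B w z) = B (κ₁ X w) z + B w (κ₂ X z)) (h : p + q = r) (l : V0 A η)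
    (x : VForm A p W₁) (y : VForm A q W₂) : gact κ₃ r l (formMul h B x y) =
      formMul h B (gact κ₁ p l x) y + formMul h B x (gact κ₂ q l y) := by
  simp only [gact_apply, formMul_zero_formMul hB, vLie_formMul, map_add, map_neg,
    LinearMap.add_apply, LinearMap.neg_apply]
  abel

/-- The Lie derivative commutes with d, so the defect comes only from differentiating ρ. This dρ is
the source of all anomalies below. -/
theorem vd_gact_one (κ : So η →ₗ[ℂ] W →ₗ[ℂ] W) (l : V0 A η) (x : VForm A 1 W) :
    vd 1 2 rfl (gact κ 1 l x) =
      gact κ 2 l (vd 1 2 rfl x) - formMul (p := 1) (q := 1) rfl κ (vd 0 1 rfl l.2) x := by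
  rw [gact_apply, gact_apply, map_add, map_neg, vd_vLie_one, vd_formMul_zero_one _ _ (zero_add 2)]
  abel

theorem vd_gact_two (κ : So η →ₗ[ℂ] W →ₗ[ℂ] W) (l : V0 A η) (x : VForm A 2 W) :
    vd 2 3 rfl (gact κ 2 l x) =
      gact κ 3 l (vd 2 3 rfl x) - formMul (p := 1) (q := 2) rfl κ (vd 0 1 rfl l.2) x := by
  rw [gact_apply, gact_apply, map_add, map_neg, vd_vLie_two, vd_formMul_zero_two _ _ (zero_add 3) rfl rfl]
  abel

attribute [local instance] tensorEnvModule

theorem isEquivariant₂_formMul (h : p + q = r) (B : W₁ →ₗ[ℂ] W₂ →ₗ[ℂ] W₃) :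
    IsEquivariant₂ A (formMul h B : VForm A p W₁ →ₗ[ℂ] _) :=
  isEquivariant₂_of_ι fun X x y => by simp only [uact_vform, vLie_formMul]

/-- Besides the Leibniz rule for the product with ρ, this uses that L_[X, ξ] is the commutator of
L_X and L_ξ, since vector fields act on the parameter ξ by the bracket. -/
theorem isEquivariant₂_ell2Gauge : IsEquivariant₂ A (ell2Gauge : V0 A η →ₗ[ℂ] _) :=
  isEquivariant₂_of_ι fun X l x => by
    simp only [ell2Gauge_apply, uact_prod, uact_vform, uact_vect, gact_apply, map_add, map_neg,
      vLie_formMul, vLie_lie, Prod.mk_add_mk]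
    refine Prod.ext ?_ ?_ <;> simp only <;> abel

theorem isEquivariant_vd_zero (h : 0 + 1 = 1) :
    IsEquivariant A (vd 0 1 h : VForm A 0 W →ₗ[ℂ] VForm A 1 W) :=
  isEquivariant_of_ι fun X x => by rw [uact_vform, uact_vform, vd_vLie_zero]

theorem isEquivariant_vd_one (h : 1 + 1 = 2) :
    IsEquivariant A (vd 1 2 h : VForm A 1 W →ₗ[ℂ] VForm A 2 W) :=
  isEquivariant_of_ι fun X x => by rw [uact_vform, uact_vform, vd_vLie_one]

theorem isEquivariant_fst {V : Type*} [AddCommGroup V] [Module ℂ V] [EnvModule A V]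
    [EnvModule A W] : IsEquivariant A (LinearMap.fst ℂ V W) := fun _ _ => rfl

theorem isEquivariant_snd {V : Type*} [AddCommGroup V] [Module ℂ V] [EnvModule A V]
    [EnvModule A W] : IsEquivariant A (LinearMap.snd ℂ V W) := fun _ _ => rfl

theorem isEquivariant_ell1 : IsEquivariant A (ell1 : V0 A η →ₗ[ℂ] V1 A η) :=
  isEquivariant_of_ι fun X l => by
    refine Prod.ext (map_zero (uact A (VForm A 1 (Lam 1)) (UniversalEnvelopingAlgebra.ι ℂ X))).symm ?_
    exact isEquivariant_vd_zero _ (UniversalEnvelopingAlgebra.ι ℂ X) l.2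

end ValuedForms

/-! ### Signs and derivation properties of the products of fields. -/

section ClassicalIdentities

variable {A : Type*} [CommRing A] [Algebra ℂ A] {η : Fin 4 → ℤˣ}

theorem soBracket_bracket (X Y Z : So η) : soBracket η X (soBracket η Y Z) =
    soBracket η (soBracket η X Y) Z + soBracket η Y (soBracket η X Z) := leibniz_lie X Y Z

theorem lamMul_soToLam_covariant {k m : ℕ} (h : k + 2 = m) (X : So η) (u : Lam k) (Y : So η) :
    soAct η m X (((lamMul h).compl₂ (soToLam η)) u Y) =
      ((lamMul h).compl₂ (soToLam η)) (soAct η k X u) Y +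
        ((lamMul h).compl₂ (soToLam η)) u (soBracket η X Y) := by
  rw [LinearMap.compl₂_apply, soAct_lamMul, soAct_soToLam]; rfl

theorem soToLam_lamMul_covariant {k m : ℕ} (h : 2 + k = m) (X Y : So η) (u : Lam k) :
    soAct η m X ((lamMul h ∘ₗ soToLam η) Y u) =
      (lamMul h ∘ₗ soToLam η) (soBracket η X Y) u +
        (lamMul h ∘ₗ soToLam η) Y (soAct η k X u) := by
  rw [LinearMap.comp_apply, soAct_lamMul, soAct_soToLam]; rfl

theorem soAct_covariant {k : ℕ} (X Y : So η) (u : Lam k) : soAct η k X (soAct η k Y u) =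
    soAct η k (soBracket η X Y) u + soAct η k Y (soAct η k X u) := by
  change _ = soAct η k ⁅X, Y⁆ u + _
  rw [soAct_bracket]; abel

/-- A two-form commutes with a one-form, while two vectors anticommute. -/
theorem curly_comm_two_one (h : 2 + 1 = 3) (h' : 1 + 1 = 2) (h'' : 1 + 2 = 3)
    (x : VForm A 2 (Lam 1)) (y : VForm A 1 (Lam 1)) : curly h h' x y = -curly h'' h' y x := by
  refine (formMul_swap (h' := h'') (C := lamMul h') (s := 1) (t := -1) (fun α β => ?_)
    (fun w z => ?_) x y).trans ?_
  · rw [one_smul]; exact (wedge_one_two_comm β α).symm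
  · rw [neg_one_smul]; exact lamMul_comm_one_one _ _ _ _
  · rw [one_mul, neg_one_smul]; rfl

theorem soCurly_comm (h : 2 + 1 = 3) (h' : 1 + 2 = 3) (x : VForm A 2 (So η))
    (y : VForm A 1 (Lam 1)) : soCurly h h x y = curlySo h' h' y x := by
  refine (formMul_swap (h' := h') (C := (lamMul h').compl₂ (soToLam η)) (s := 1) (t := 1)
    (fun α β => ?_) (fun w z => ?_) x y).trans ?_
  · rw [one_smul]; exact (wedge_one_two_comm β α).symm
  · rw [one_smul]; exact (lamMul_comm_one_two h' h _ _).symm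
  · rw [one_mul, one_smul]; rfl

/-- The sign of the wedge of one-forms cancels that of the Lie bracket. -/
theorem soBr_comm (h : 1 + 1 = 2) (x y : VForm A 1 (So η)) : soBr h x y = soBr h y x := by
  refine (formMul_swap (h' := h) (C := soBracket η) (s := -1) (t := -1) (fun α β => ?_)
    (fun w z => ?_) x y).trans ?_
  · exact (wedge_one_one_comm _ _).trans (neg_one_smul ℂ _).symm
  · exact (lie_skew w z).symm.trans (neg_one_smul ℂ _).symm
  · rw [neg_mul_neg, one_mul, one_smul]; rfl

/-- The values satisfy an ungraded Leibniz rule; the minus sign arises from moving the one-form x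
past the one-form y. -/
theorem soTri_curly (h : 1 + 2 = 3) (h' : 1 + 1 = 2) (h'' : 2 + 1 = 3) (x : VForm A 1 (So η))
    (y z : VForm A 1 (Lam 1)) : soTri (k := 2) h x (curly h' h' y z) =
      curly h'' h' (soTri (k := 1) h' x y) z - curly h h' y (soTri (k := 1) h' x z) := by
  induction x using vform_induction with
  | h0 => simp
  | hadd x x' hx hx' => simp only [map_add, LinearMap.add_apply, hx, hx']; abel
  | ht f X =>
    induction y using vform_induction with
    | h0 => simp
    | hadd x x' hx hx' => simp only [map_add, LinearMap.add_apply, hx, hx']; abel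
    | ht α w =>
      induction z using vform_induction with
      | h0 => simp
      | hadd y y' hy hy' => simp only [map_add, hy, hy']; abel
      | ht β z =>
        simp only [soTri, curly, formMul_vtmul, soAct_lamMul, map_add]
        have h1 : wedge h'' (wedge h' f α) β = wedge h f (wedge h' α β) := wedge_assoc_one f α β
        have h2 : wedge h α (wedge h' f β) = -wedge h f (wedge h' α β) := by
          have e1 : wedge h'' (wedge h' α f) β = wedge h α (wedge h' f β) := wedge_assoc_one α f β
          have e2 : wedge h' α f = -wedge h' f α := wedge_one_one_comm α f
          rw [← e1, e2, ← h1, map_neg, LinearMap.neg_apply]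
        rw [h1, h2, map_neg, LinearMap.neg_apply, sub_neg_eq_add]

end ClassicalIdentities

/-! ### The braided variation of a deformed expression and its classical anomaly. -/

section Covariance

variable {A : Type*} [CommRing A] [Algebra ℂ A] {η : Fin 4 → ℤˣ}

variable {L V W X Y Z V' W' Z' : Type*} [AddCommGroup L] [Module ℂ L] [AddCommGroup V] [Module ℂ V]
  [AddCommGroup W] [Module ℂ W] [AddCommGroup X] [Module ℂ X] [AddCommGroup Y] [Module ℂ Y]
  [AddCommGroup Z] [Module ℂ Z] [AddCommGroup V'] [Module ℂ V'] [AddCommGroup W'] [Module ℂ W']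
  [AddCommGroup Z'] [Module ℂ Z']

attribute [local instance] tensorEnvModule

/-- The trilinear map `(u, v, w) ↦ T (f u, g v, h w)`. -/
def comp₃ (T : V →ₗ[ℂ] W →ₗ[ℂ] Z →ₗ[ℂ] X) (f : V' →ₗ[ℂ] V) (g : W' →ₗ[ℂ] W) (h : Z' →ₗ[ℂ] Z) :
    V' →ₗ[ℂ] W' →ₗ[ℂ] Z' →ₗ[ℂ] X :=
  mk₃ (fun u v w => T (f u) (g v) (h w)) (by intros; simp) (by intros; simp) (by intros; simp)
    (by intros; simp) (by intros; simp) (by intros; simp)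

variable [EnvModule A L] [EnvModule A V] [EnvModule A W] [EnvModule A Z] [EnvModule A V']
  [EnvModule A W'] [EnvModule A Z']

theorem isEquivariant_map {f : V →ₗ[ℂ] V'} {g : W →ₗ[ℂ] W'} (hf : IsEquivariant A f)
    (hg : IsEquivariant A g) : IsEquivariant A (TensorProduct.map f g) :=
  isEquivariant_of_ι fun Ξ x => by
    induction x with
    | zero => simp
    | add x y hx hy => simp only [map_add, hx, hy]
    | tmul v w =>
      rw [uact_tensor, uact_tensor, coproduct_ι, map_add, map_add, tensorAct_tmul, tensorAct_tmul,
        tensorAct_tmul, tensorAct_tmul]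
      simp only [LinearMap.add_apply, TensorProduct.map_tmul, map_one, Module.End.one_apply, map_add,
        hf _ v, hg _ w]

/-- The sum of actions on the factors of a tensor product. -/
def tensorGauge (gW : L →ₗ[ℂ] W →ₗ[ℂ] W) (gZ : L →ₗ[ℂ] Z →ₗ[ℂ] Z) :
    L →ₗ[ℂ] W ⊗[ℂ] Z →ₗ[ℂ] W ⊗[ℂ] Z :=
  LinearMap.rTensorHom Z ∘ₗ gW + LinearMap.lTensorHom W ∘ₗ gZ

theorem tensorGauge_tmul (gW : L →ₗ[ℂ] W →ₗ[ℂ] W) (gZ : L →ₗ[ℂ] Z →ₗ[ℂ] Z) (l : L) (w : W) (z : Z) :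
    tensorGauge gW gZ l (w ⊗ₜ z) = gW l w ⊗ₜ z + w ⊗ₜ gZ l z := rfl

theorem IsEquivariant₂.ι_apply [EnvModule A X] {B : V →ₗ[ℂ] W →ₗ[ℂ] X} (hB : IsEquivariant₂ A B)
    (Ξ : Vect A) (v : V) (w : W) : uact A X (UniversalEnvelopingAlgebra.ι ℂ Ξ) (B v w) =
      B (uact A V (UniversalEnvelopingAlgebra.ι ℂ Ξ) v) w +
        B v (uact A W (UniversalEnvelopingAlgebra.ι ℂ Ξ) w) := by
  have := hB (UniversalEnvelopingAlgebra.ι ℂ Ξ) (v ⊗ₜ w)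
  rw [uact_tensor, coproduct_ι, map_add, tensorAct_tmul, tensorAct_tmul] at this
  simpa only [LinearMap.add_apply, TensorProduct.map_tmul, map_one, Module.End.one_apply, map_add,
    TensorProduct.lift.tmul] using this.symm

theorem isEquivariant₂_tensorGauge {gW : L →ₗ[ℂ] W →ₗ[ℂ] W} {gZ : L →ₗ[ℂ] Z →ₗ[ℂ] Z}
    (hW : IsEquivariant₂ A gW) (hZ : IsEquivariant₂ A gZ) :
    IsEquivariant₂ A (tensorGauge gW gZ) :=
  isEquivariant₂_of_ι fun Ξ l x => by
    induction x with
    | zero => simp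
    | add x y hx hy => simp only [map_add, hx, hy]; abel
    | tmul w z =>
      rw [tensorGauge_tmul, map_add]
      simp only [uact_tensor, coproduct_ι, map_add, tensorAct_tmul, LinearMap.add_apply,
        TensorProduct.map_tmul, map_one, Module.End.one_apply, hW.ι_apply, hZ.ι_apply,
        tensorGauge_tmul, TensorProduct.add_tmul, TensorProduct.tmul_add]
      abel

variable (A) in
/-- A trilinear map which is equivariant under the action of vector fields. -/
def IsEquivariant₃ [EnvModule A X] (T : V →ₗ[ℂ] W →ₗ[ℂ] Z →ₗ[ℂ] X) : Prop :=
  IsEquivariant A (lift₃ T)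

theorem isEquivariant₃_of_ι [EnvModule A X] {T : V →ₗ[ℂ] W →ₗ[ℂ] Z →ₗ[ℂ] X}
    (h : ∀ (Ξ : Vect A) (u : V) (v : W) (w : Z),
    uact A X (UniversalEnvelopingAlgebra.ι ℂ Ξ) (T u v w) =
      T (uact A V (UniversalEnvelopingAlgebra.ι ℂ Ξ) u) v w +
        T u (uact A W (UniversalEnvelopingAlgebra.ι ℂ Ξ) v) w +
          T u v (uact A Z (UniversalEnvelopingAlgebra.ι ℂ Ξ) w)) : IsEquivariant₃ A T :=
  isEquivariant₂_of_ι fun Ξ u x => by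
    induction x with
    | zero => simp
    | add x y hx hy => simp only [map_add, hx, hy]; abel
    | tmul v w =>
      rw [uact_tensor, coproduct_ι, map_add, tensorAct_tmul, tensorAct_tmul]
      simp only [LinearMap.add_apply, TensorProduct.map_tmul, map_one, Module.End.one_apply, map_add]
      exact (h Ξ u v w).trans (add_assoc _ _ _)

namespace DrinfeldTwist

variable (𝓕 : DrinfeldTwist A)

theorem tmul_map {f : V' →ₗ[ℂ] V} {g : W' →ₗ[ℂ] W} (hf : IsEquivariant A f)
    (hg : IsEquivariant A g) (v : FPS V') (w : FPS W') :
    𝓕.tmul (FPS.map f v) (FPS.map g w) = FPS.map (TensorProduct.map f g) (𝓕.tmul v w) := by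
  rw [← star_mk, 𝓕.star_map hf hg, ← star_mk, map_star]
  rfl

theorem star₃_map {f : V' →ₗ[ℂ] V} {g : W' →ₗ[ℂ] W} {h : Z' →ₗ[ℂ] Z} (hf : IsEquivariant A f)
    (hg : IsEquivariant A g) (hh : IsEquivariant A h) (T : V →ₗ[ℂ] W →ₗ[ℂ] Z →ₗ[ℂ] X) (u : FPS V')
    (v : FPS W') (w : FPS Z') : 𝓕.star₃ T (FPS.map f u) (FPS.map g v) (FPS.map h w) =
      𝓕.star₃ (comp₃ T f g h) u v w := by
  rw [star₃_apply, 𝓕.tmul_map hg hh, 𝓕.tmul_map hf (isEquivariant_map hg hh), star₃_apply]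
  have : lift₃ (comp₃ T f g h) = lift₃ T ∘ₗ TensorProduct.map f (TensorProduct.map g h) := by
    ext; rfl
  rw [this]; rfl

/-- Two uses of `star_covariant`: for the curried map on V and W ⊗ Z, and then inside W ⊗ Z for the
tensor product itself. The second braiding is nested in the first, exactly as in the braided Leibniz
rule. G₁ and G₂ are described by their values only, so that any presentation of them fits. -/
theorem star₃_covariant [EnvModule A X] {gV : L →ₗ[ℂ] V →ₗ[ℂ] V} {gW : L →ₗ[ℂ] W →ₗ[ℂ] W}
    {gZ : L →ₗ[ℂ] Z →ₗ[ℂ] Z} {gX : L →ₗ[ℂ] X →ₗ[ℂ] X} (hV : IsEquivariant₂ A gV)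
    (hW : IsEquivariant₂ A gW) (hZ : IsEquivariant₂ A gZ)
    {T : V →ₗ[ℂ] W →ₗ[ℂ] Z →ₗ[ℂ] X} (hT : IsEquivariant₃ A T)
    (h : ∀ l u v w, gX l (T u v w) = T (gV l u) v w + T u (gW l v) w + T u v (gZ l w))
    (l : FPS L) (u : FPS V) (v : FPS W) (w : FPS Z) {G₁ G₂ : FPS V →ₗ[ℂ] FPS L →ₗ[ℂ] FPS X}
    (h₁ : ∀ u l, G₁ u l = 𝓕.star₃ T u (𝓕.star gW l v) w)
    (h₂ : ∀ u l, G₂ u l = 𝓕.braid ((𝓕.star₃ T u).compl₂ ((𝓕.star gZ).flip w)) l v) :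
    𝓕.star gX l (𝓕.star₃ T u v w) =
      𝓕.star₃ T (𝓕.star gV l u) v w + 𝓕.braid G₁ l u + 𝓕.braid G₂ l u := by
  have hg := isEquivariant₂_tensorGauge hW hZ
  have hT' : ∀ u v w, 𝓕.star₃ T u v w =
    𝓕.star ((TensorProduct.uncurry (.id ℂ) W Z X) ∘ₗ T) u (𝓕.tmul v w) := fun _ _ _ => rfl
  rw [hT', 𝓕.star_covariant (gW := tensorGauge gW gZ) hV hg hT, ← hT', add_assoc,
    ← LinearMap.add_apply, ← LinearMap.add_apply, ← braid_add]
  · suffices hG : (𝓕.star (TensorProduct.uncurry (.id ℂ) W Z X ∘ₗ T)).compl₂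
        ((𝓕.star (tensorGauge gW gZ)).flip (𝓕.tmul v w)) = G₁ + G₂ by rw [hG]
    ext1 u; ext1 l
    rw [LinearMap.compl₂_apply, LinearMap.flip_apply, LinearMap.add_apply, LinearMap.add_apply, h₁,
      h₂, ← star_mk, 𝓕.star_covariant hW hZ isEquivariant₂_mk (fun l v w => rfl), map_add, star_mk,
      ← hT']
    refine congrArg (_ + ·) ?_
    exact (LinearMap.congr_fun (LinearMap.congr_fun (𝓕.braid_comp
      (𝓕.tmul.compl₂ ((𝓕.star gZ).flip w)) (𝓕.isHLinear_star_right
        (TensorProduct.uncurry (.id ℂ) W Z X ∘ₗ T) u)) l) v).symm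
  · intro l u x
    induction x with
    | zero => simp
    | add x y hx hy => simp only [map_add, hx, hy]; abel
    | tmul v w => exact (h l u v w).trans (by rw [add_assoc]; simp [tensorGauge_tmul])

end DrinfeldTwist

namespace DrinfeldTwist

variable (𝓕 : DrinfeldTwist A)

theorem star_map_left {f : V' →ₗ[ℂ] V} (hf : IsEquivariant A f) (B : V →ₗ[ℂ] W →ₗ[ℂ] X)
    (v : FPS V') (w : FPS W) : 𝓕.star B (FPS.map f v) w = 𝓕.star (B ∘ₗ f) v w :=
  𝓕.star_map hf isEquivariant_id B v w

theorem star_map_right {f : W' →ₗ[ℂ] W} (hf : IsEquivariant A f) (B : V →ₗ[ℂ] W →ₗ[ℂ] X)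
    (v : FPS V) (w : FPS W') : 𝓕.star B v (FPS.map f w) = 𝓕.star (B.compl₂ f) v w :=
  𝓕.star_map isEquivariant_id hf B v w

theorem star_zero : 𝓕.star (0 : V →ₗ[ℂ] W →ₗ[ℂ] X) = 0 := by
  have h := 𝓕.star_smul 0 (0 : V →ₗ[ℂ] W →ₗ[ℂ] X)
  rwa [zero_smul, zero_smul] at h

end DrinfeldTwist

/-- The failure of the classical Leibniz rule for an expression with the given quadratic and cubic
parts. -/
def anomaly (δ : L →ₗ[ℂ] V) (gV : L →ₗ[ℂ] V →ₗ[ℂ] V) (gX : L →ₗ[ℂ] X →ₗ[ℂ] X)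
    (b : V →ₗ[ℂ] V →ₗ[ℂ] X) (t : V →ₗ[ℂ] V →ₗ[ℂ] V →ₗ[ℂ] X) : L →ₗ[ℂ] V →ₗ[ℂ] V →ₗ[ℂ] X :=
  nestL b gV + (nestR b gV).flip + comp₃ t δ .id .id +
    (comp₃ t .id δ .id).flip + (swapR (comp₃ t .id .id δ)).flip - nestR gX b

namespace DrinfeldTwist

variable (𝓕 : DrinfeldTwist A)

/-- After braiding, the two contributions of the shift δ are star deformations of maps in the same
order of arguments, and by h₁ these maps cancel classically. Only the terms with gV remain. -/
theorem quadratic_variation {δ : L →ₗ[ℂ] V} {gV : L →ₗ[ℂ] V →ₗ[ℂ] V} (hδ : IsEquivariant A δ)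
    (hV : IsEquivariant₂ A gV) (b : V →ₗ[ℂ] V →ₗ[ℂ] X)
    (h₁ : ∀ l a, b (δ l) a + b a (δ l) = 0) (lam : FPS L) (Φ : FPS V) {N : FPS L →ₗ[ℂ] FPS V}
    (hN : ∀ l, N l = FPS.map δ l + 𝓕.star gV l Φ) :
    𝓕.star b (N lam) Φ + 𝓕.braid ((𝓕.star b).compl₂ N) lam Φ =
      𝓕.star₃ (nestL b gV) lam Φ Φ + 𝓕.star₃ (nestR b gV).flip lam Φ Φ := by
  have q₁ : 𝓕.star b (N lam) Φ = 𝓕.star (b ∘ₗ δ) lam Φ + 𝓕.star₃ (nestL b gV) lam Φ Φ := by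
    rw [hN, LinearMap.map_add₂, 𝓕.star_star_left _ hV, 𝓕.star_map_left hδ]
  have q₂ : (𝓕.star b).compl₂ N = 𝓕.star (b.compl₂ δ) + (𝓕.star b).compl₂ ((𝓕.star gV).flip Φ) := by
    ext1 v; ext1 l
    rw [LinearMap.compl₂_apply, hN, map_add, LinearMap.add_apply, LinearMap.add_apply,
      𝓕.star_map_right hδ, LinearMap.compl₂_apply, LinearMap.flip_apply]
  have hz : 𝓕.star (b ∘ₗ δ) lam Φ + 𝓕.star (b.compl₂ δ).flip lam Φ = 0 := by
    have : b ∘ₗ δ + (b.compl₂ δ).flip = 0 := by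
      ext1 l; ext1 a; exact h₁ l a
    rw [← LinearMap.add_apply, ← LinearMap.add_apply, ← star_add, this, star_zero]
    rfl
  rw [q₁, q₂, braid_add, LinearMap.add_apply, LinearMap.add_apply, braid_star,
    𝓕.braid_star₃_left (nestR b gV) Φ fun v l => 𝓕.star_star_right b hV v l Φ]
  rw [add_add_add_comm, hz, zero_add]

/-- Split N into its shift and its linear part. By `star₃_covariant` the linear parts add up to the
gauge action on t, and the three shifts, brought to the order l, Φ, Φ, are kept for comparison with
the quadratic part. -/
theorem cubic_variation [EnvModule A X] {δ : L →ₗ[ℂ] V} {gV : L →ₗ[ℂ] V →ₗ[ℂ] V}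
    {gX : L →ₗ[ℂ] X →ₗ[ℂ] X} (hδ : IsEquivariant A δ) (hV : IsEquivariant₂ A gV)
    {t : V →ₗ[ℂ] V →ₗ[ℂ] V →ₗ[ℂ] X} (ht : IsEquivariant₃ A t)
    (h₃ : ∀ l u v w, gX l (t u v w) = t (gV l u) v w + t u (gV l v) w + t u v (gV l w))
    (lam : FPS L) (Φ : FPS V) {N : FPS L →ₗ[ℂ] FPS V}
    (hN : ∀ l, N l = FPS.map δ l + 𝓕.star gV l Φ) {G₁ G₂ : FPS V →ₗ[ℂ] FPS L →ₗ[ℂ] FPS X}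
    (hG₁ : ∀ u l, G₁ u l = 𝓕.star₃ t u (N l) Φ)
    (hG₂ : ∀ u l, G₂ u l = 𝓕.braid ((𝓕.star₃ t u).compl₂ N) l Φ) :
    𝓕.star₃ t (N lam) Φ Φ + 𝓕.braid G₁ lam Φ + 𝓕.braid G₂ lam Φ =
      𝓕.star₃ (comp₃ t δ .id .id) lam Φ Φ + 𝓕.star₃ (comp₃ t .id δ .id).flip lam Φ Φ +
      𝓕.star₃ (swapR (comp₃ t .id .id δ)).flip lam Φ Φ + 𝓕.star gX lam (𝓕.star₃ t Φ Φ Φ) := by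
  have hi := isEquivariant_id (A := A) (V := V)
  let H₁ : FPS V →ₗ[ℂ] FPS L →ₗ[ℂ] FPS X :=
    LinearMap.mk₂ ℂ (fun u l => 𝓕.star₃ t u (𝓕.star gV l Φ) Φ)
      (by intros; simp) (by intros; simp) (by intros; simp) (by intros; simp)
  let K₁ : FPS V →ₗ[ℂ] FPS L →ₗ[ℂ] FPS X :=
    LinearMap.mk₂ ℂ (fun u l => 𝓕.star₃ (comp₃ t .id δ .id) u l Φ)
      (by intros; simp) (by intros; simp) (by intros; simp) (by intros; simp)
  let K₂ : FPS V →ₗ[ℂ] FPS L →ₗ[ℂ] FPS X :=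
    LinearMap.mk₂ ℂ (fun u l => 𝓕.star₃ (swapR (comp₃ t .id .id δ)) u l Φ)
      (by intros; simp) (by intros; simp) (by intros; simp) (by intros; simp)
  have c₁ : 𝓕.star₃ t (N lam) Φ Φ =
      𝓕.star₃ (comp₃ t δ .id .id) lam Φ Φ + 𝓕.star₃ t (𝓕.star gV lam Φ) Φ Φ := by
    rw [hN, map_add, LinearMap.add_apply, LinearMap.add_apply, ← 𝓕.star₃_map hδ hi hi]
    simp only [map_id_eq, LinearMap.id_apply]
  have c₂ : G₁ = K₁ + H₁ := by
    ext1 u; ext1 l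
    rw [hG₁, hN, map_add, LinearMap.add_apply]
    refine congrArg (· + _) ?_
    exact 𝓕.star₃_map hi hδ hi t u l Φ
  have c₃ : ∀ u, (𝓕.star₃ t u).compl₂ N = 𝓕.star₃ (comp₃ t .id .id δ) u +
        (𝓕.star₃ t u).compl₂ ((𝓕.star gV).flip Φ) := by
    intro u
    ext1 v; ext1 l
    rw [LinearMap.compl₂_apply, hN, map_add]
    exact congrArg (· + _) (𝓕.star₃_map hi hi hδ t u v l)
  let H₂ : FPS V →ₗ[ℂ] FPS L →ₗ[ℂ] FPS X := LinearMap.mk₂ ℂ (fun u l =>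
      𝓕.braid ((𝓕.star₃ t u).compl₂ ((𝓕.star gV).flip Φ)) l Φ) (by
        intro u u' l
        have : (𝓕.star₃ t (u + u')).compl₂ ((𝓕.star gV).flip Φ) =
            (𝓕.star₃ t u).compl₂ ((𝓕.star gV).flip Φ) +
              (𝓕.star₃ t u').compl₂ ((𝓕.star gV).flip Φ) := by ext; simp
        rw [this, braid_add]; rfl) (by
        intro c u l
        have : (𝓕.star₃ t (c • u)).compl₂ ((𝓕.star gV).flip Φ) =
            c • (𝓕.star₃ t u).compl₂ ((𝓕.star gV).flip Φ) := by ext; simp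
        rw [this, braid_smul]; rfl)
      (by intros; simp) (by intros; simp)
  have c₄ : G₂ = K₂ + H₂ := by
    ext1 u; ext1 l
    rw [hG₂, c₃, braid_add, LinearMap.add_apply, LinearMap.add_apply, braid_star₃_right]
    rfl
  have k₁ := 𝓕.braid_star₃_left (G := K₁) _ Φ (fun _ _ => rfl) lam Φ
  have k₂ := 𝓕.braid_star₃_left (G := K₂) _ Φ (fun _ _ => rfl) lam Φ
  have hc := 𝓕.star₃_covariant (G₁ := H₁) (G₂ := H₂) hV hV hV ht h₃ lam Φ Φ Φ (fun _ _ => rfl)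
    (fun _ _ => rfl)
  rw [c₁, c₂, c₄, braid_add, braid_add, hc, LinearMap.add_apply, LinearMap.add_apply,
    LinearMap.add_apply, LinearMap.add_apply, k₁, k₂]
  abel

theorem star₃_anomaly (δ : L →ₗ[ℂ] V) (gV : L →ₗ[ℂ] V →ₗ[ℂ] V) (gX : L →ₗ[ℂ] X →ₗ[ℂ] X)
    (b : V →ₗ[ℂ] V →ₗ[ℂ] X) (t : V →ₗ[ℂ] V →ₗ[ℂ] V →ₗ[ℂ] X) (u : FPS L) (v w : FPS V) :
    𝓕.star₃ (anomaly δ gV gX b t) u v w = 𝓕.star₃ (nestL b gV) u v w +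
      𝓕.star₃ (nestR b gV).flip u v w + 𝓕.star₃ (comp₃ t δ .id .id) u v w +
      𝓕.star₃ (comp₃ t .id δ .id).flip u v w +
      𝓕.star₃ (swapR (comp₃ t .id .id δ)).flip u v w - 𝓕.star₃ (nestR gX b) u v w := by
  have e : anomaly δ gV gX b t + nestR gX b = nestL b gV + (nestR b gV).flip + comp₃ t δ .id .id +
      (comp₃ t .id δ .id).flip + (swapR (comp₃ t .id .id δ)).flip := by
    ext l a a'
    exact sub_add_cancel _ _
  have h := 𝓕.star₃_add (anomaly δ gV gX b t) (nestR gX b) u v w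
  rw [e, star₃_add, star₃_add, star₃_add, star₃_add] at h
  rw [h]
  exact (add_sub_cancel_right _ _).symm

/-- The expression `b(A, A) + t(A, A, A)` which is the star deformation of classical brackets. -/
def deform (b : V1 A η →ₗ[ℂ] V1 A η →ₗ[ℂ] X)
    (t : V1 A η →ₗ[ℂ] V1 A η →ₗ[ℂ] V1 A η →ₗ[ℂ] X) : Expression A η X := (𝓕.star b, 𝓕.star₃ t)

/-- Collect by degree in the field: degree one vanishes by h₁, degree three is the gauge action on t
by h₃, and in degree two the variation of b and the shifts in t miss the gauge action on b by the
anomaly. -/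
theorem variation_deform [EnvModule A X] {g : V0 A η →ₗ[ℂ] X →ₗ[ℂ] X}
    {b : V1 A η →ₗ[ℂ] V1 A η →ₗ[ℂ] X} {t : V1 A η →ₗ[ℂ] V1 A η →ₗ[ℂ] V1 A η →ₗ[ℂ] X}
    (hb : IsEquivariant₂ A b) (ht : IsEquivariant₃ A t)
    (h₁ : ∀ l a, b (ell1 l) a + b a (ell1 l) = 0)
    (h₃ : ∀ l u v w, g l (t u v w) =
      t (ell2Gauge l u) v w + t u (ell2Gauge l v) w + t u v (ell2Gauge l w))
    (lam : FPS (V0 A η)) (Φ : FPS (V1 A η)) :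
    (𝓕.deform b t).variation 𝓕 lam Φ = 𝓕.star g lam ((𝓕.deform b t).eval Φ) +
      𝓕.star₃ (anomaly ell1 ell2Gauge g b t) lam Φ Φ := by
  have hG := isEquivariant₂_ell2Gauge (A := A) (η := η)
  have hl := isEquivariant_ell1 (A := A) (η := η)
  have hV : ∀ l, 𝓕.gaugeVar Φ l = FPS.map ell1 l + 𝓕.star ell2Gauge l Φ := fun _ => rfl
  have hq := 𝓕.quadratic_variation hl hG b h₁ lam Φ hV
  have hc := 𝓕.cubic_variation (G₁ := LinearMap.mk₂ ℂ
      (fun Φ' lam' => 𝓕.star₃ t Φ' (𝓕.gaugeVar Φ lam') Φ) (by intros; simp) (by intros; simp)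
      (by intros; simp) (by intros; simp)) (G₂ := LinearMap.mk₂ ℂ
      (fun Φ' lam' => 𝓕.braid ((𝓕.star₃ t Φ').compl₂ (𝓕.gaugeVar Φ)) lam' Φ)
      (by
        intro u u' l
        have : (𝓕.star₃ t (u + u')).compl₂ (𝓕.gaugeVar Φ) = (𝓕.star₃ t u).compl₂ (𝓕.gaugeVar Φ) +
            (𝓕.star₃ t u').compl₂ (𝓕.gaugeVar Φ) := by ext; simp
        rw [this, braid_add]; rfl)
      (by
        intro c u l
        have : (𝓕.star₃ t (c • u)).compl₂ (𝓕.gaugeVar Φ) =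
            c • (𝓕.star₃ t u).compl₂ (𝓕.gaugeVar Φ) := by ext; simp
        rw [this, braid_smul]; rfl)
      (by intros; simp) (by intros; simp)) hl hG ht h₃ lam Φ hV (fun _ _ => rfl) (fun _ _ => rfl)
  have hv : (𝓕.deform b t).variation 𝓕 lam Φ = _ + _ := congrArg₂ (· + ·) hq hc
  have e1 : 𝓕.star g lam ((𝓕.deform b t).eval Φ) =
      𝓕.star₃ (nestR g b) lam Φ Φ + 𝓕.star g lam (𝓕.star₃ t Φ Φ Φ) :=
    (LinearMap.map_add (𝓕.star g lam) (𝓕.star b Φ Φ) (𝓕.star₃ t Φ Φ Φ)).trans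
      (congrArg (· + _) (𝓕.star_star_right g hb lam Φ Φ))
  have h : ∀ a b c d e f y : FPS X, a + b + (c + d + e + y) = f + y + (a + b + c + d + e - f) :=
    fun _ _ _ _ _ _ _ => by abel
  exact (hv.trans (h _ _ _ _ _ _ _)).trans (congrArg₂ (· + ·) e1 (𝓕.star₃_anomaly _ _ _ _ _ _ _ _)).symm

end DrinfeldTwist

end Covariance

/-! ### Gauge covariance and equivariance of the products; the covariance criterion. -/

section Leibniz

variable {A : Type*} [CommRing A] [Algebra ℂ A] {η : Fin 4 → ℤˣ} {p q r k l m : ℕ}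

theorem gact_curly (h : p + q = r) (h' : k + l = m) (lam : V0 A η) (x : VForm A p (Lam k))
    (y : VForm A q (Lam l)) : gact (soAct η m) r lam (curly h h' x y) =
      curly h h' (gact (soAct η k) p lam x) y + curly h h' x (gact (soAct η l) q lam y) :=
  gact_formMul (soAct_lamMul h') h lam x y

theorem gact_curlySo (h : p + q = r) (h' : k + 2 = m) (lam : V0 A η) (x : VForm A p (Lam k))
    (y : VForm A q (So η)) : gact (soAct η m) r lam (curlySo h h' x y) =
      curlySo h h' (gact (soAct η k) p lam x) y + curlySo h h' x (gact (soBracket η) q lam y) :=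
  gact_formMul (lamMul_soToLam_covariant h') h lam x y

theorem gact_soCurly (h : p + q = r) (h' : 2 + k = m) (lam : V0 A η) (x : VForm A p (So η))
    (y : VForm A q (Lam k)) : gact (soAct η m) r lam (soCurly h h' x y) =
      soCurly h h' (gact (soBracket η) p lam x) y + soCurly h h' x (gact (soAct η k) q lam y) :=
  gact_formMul (soToLam_lamMul_covariant h') h lam x y

theorem gact_soBr (h : p + q = r) (lam : V0 A η) (x : VForm A p (So η)) (y : VForm A q (So η)) :
    gact (soBracket η) r lam (soBr h x y) =
      soBr h (gact (soBracket η) p lam x) y + soBr h x (gact (soBracket η) q lam y) :=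
  gact_formMul soBracket_bracket h lam x y

theorem gact_soTri (h : p + q = r) (lam : V0 A η) (x : VForm A p (So η)) (y : VForm A q (Lam k)) :
    gact (soAct η k) r lam (soTri h x y) =
      soTri h (gact (soBracket η) p lam x) y + soTri h x (gact (soAct η k) q lam y) :=
  gact_formMul soAct_covariant h lam x y

theorem vd_gact_lam_one (h : 1 + 1 = 2) (h' : 0 + 1 = 1) (lam : V0 A η) (x : VForm A 1 (Lam k)) :
    vd 1 2 h (gact (soAct η k) 1 lam x) =
      gact (soAct η k) 2 lam (vd 1 2 h x) - soTri h (vd 0 1 h' lam.2) x :=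
  vd_gact_one _ lam x

theorem vd_gact_lam_two (h : 2 + 1 = 3) (h' : 0 + 1 = 1) (h'' : 1 + 2 = 3) (lam : V0 A η)
    (x : VForm A 2 (Lam k)) : vd 2 3 h (gact (soAct η k) 2 lam x) =
      gact (soAct η k) 3 lam (vd 2 3 h x) - soTri h'' (vd 0 1 h' lam.2) x :=
  vd_gact_two _ lam x

theorem vd_gact_so_one (h : 1 + 1 = 2) (h' : 0 + 1 = 1) (lam : V0 A η) (x : VForm A 1 (So η)) :
    vd 1 2 h (gact (soBracket η) 1 lam x) =
      gact (soBracket η) 2 lam (vd 1 2 h x) - soBr h (vd 0 1 h' lam.2) x :=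
  vd_gact_one _ lam x

theorem vd_curly (h : 1 + 1 = 2) (h' : 2 + 1 = 3) (h'' : 1 + 2 = 3) (h₁ : k + l = m)
    (x : VForm A 1 (Lam k)) (y : VForm A 1 (Lam l)) : vd 2 3 h' (curly h h₁ x y) =
      curly h' h₁ (vd 1 2 h x) y - curly h'' h₁ x (vd 1 2 h y) :=
  vd_formMul_one_one h h' h'' _ x y

theorem vLie_curly (h : p + q = r) (h' : k + l = m) (Ξ : Vect A) (x : VForm A p (Lam k))
    (y : VForm A q (Lam l)) : vLie r Ξ (curly h h' x y) =
      curly h h' (vLie p Ξ x) y + curly h h' x (vLie q Ξ y) := vLie_formMul _ _ _ _ _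

theorem vLie_curlySo (h : p + q = r) (h' : k + 2 = m) (Ξ : Vect A) (x : VForm A p (Lam k))
    (y : VForm A q (So η)) : vLie r Ξ (curlySo h h' x y) =
      curlySo h h' (vLie p Ξ x) y + curlySo h h' x (vLie q Ξ y) := vLie_formMul _ _ _ _ _

theorem vLie_soCurly (h : p + q = r) (h' : 2 + k = m) (Ξ : Vect A) (x : VForm A p (So η))
    (y : VForm A q (Lam k)) : vLie r Ξ (soCurly h h' x y) =
      soCurly h h' (vLie p Ξ x) y + soCurly h h' x (vLie q Ξ y) := vLie_formMul _ _ _ _ _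

theorem vLie_soBr (h : p + q = r) (Ξ : Vect A) (x : VForm A p (So η)) (y : VForm A q (So η)) :
    vLie r Ξ (soBr h x y) = soBr h (vLie p Ξ x) y + soBr h x (vLie q Ξ y) := vLie_formMul _ _ _ _ _

theorem vLie_soTri (h : p + q = r) (Ξ : Vect A) (x : VForm A p (So η)) (y : VForm A q (Lam k)) :
    vLie r Ξ (soTri h x y) = soTri h (vLie p Ξ x) y + soTri h x (vLie q Ξ y) :=
  vLie_formMul _ _ _ _ _

theorem ell1_fst (lam : V0 A η) : (ell1 lam).1 = 0 := rfl

theorem ell1_snd (lam : V0 A η) : (ell1 lam).2 = vd 0 1 rfl lam.2 := rfl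

/-- Classical brackets which are equivariant and covariant up to derivatives of the gauge
parameter. -/
structure IsAdmissible (b : V1 A η →ₗ[ℂ] V1 A η →ₗ[ℂ] VForm A p (Lam k))
    (t : V1 A η →ₗ[ℂ] V1 A η →ₗ[ℂ] V1 A η →ₗ[ℂ] VForm A p (Lam k)) : Prop where
  quad_equivariant : ∀ (Ξ : Vect A) (a a' : V1 A η), vLie p Ξ (b a a') =
    b (vLie 1 Ξ a.1, vLie 1 Ξ a.2) a' + b a (vLie 1 Ξ a'.1, vLie 1 Ξ a'.2)
  cub_equivariant : ∀ (Ξ : Vect A) (a a' a'' : V1 A η), vLie p Ξ (t a a' a'') =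
    t (vLie 1 Ξ a.1, vLie 1 Ξ a.2) a' a'' + t a (vLie 1 Ξ a'.1, vLie 1 Ξ a'.2) a'' +
      t a a' (vLie 1 Ξ a''.1, vLie 1 Ξ a''.2)
  quad_ell1 : ∀ (lam : V0 A η) (a : V1 A η), b (ell1 lam) a + b a (ell1 lam) = 0
  cub_covariant : ∀ (lam : V0 A η) (a a' a'' : V1 A η), gact (soAct η k) p lam (t a a' a'') =
    t (ell2Gauge lam a) a' a'' + t a (ell2Gauge lam a') a'' + t a a' (ell2Gauge lam a'')

theorem IsAdmissible.add {b b' : V1 A η →ₗ[ℂ] V1 A η →ₗ[ℂ] VForm A p (Lam k)}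
    {t t' : V1 A η →ₗ[ℂ] V1 A η →ₗ[ℂ] V1 A η →ₗ[ℂ] VForm A p (Lam k)} (h : IsAdmissible b t)
    (h' : IsAdmissible b' t') : IsAdmissible (b + b') (t + t') where
  quad_equivariant Ξ a a' := by
    simp only [LinearMap.add_apply, map_add, h.quad_equivariant, h'.quad_equivariant]; abel
  cub_equivariant Ξ a a' a'' := by
    simp only [LinearMap.add_apply, map_add, h.cub_equivariant, h'.cub_equivariant]; abel
  quad_ell1 lam a := by
    simp only [LinearMap.add_apply]
    rw [add_add_add_comm, h.quad_ell1, h'.quad_ell1, add_zero]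
  cub_covariant lam a a' a'' := by
    simp only [LinearMap.add_apply, map_add, h.cub_covariant, h'.cub_covariant]; abel

/-- The anomaly of classical brackets with values in multivector forms. -/
abbrev fieldAnomaly (b : V1 A η →ₗ[ℂ] V1 A η →ₗ[ℂ] VForm A p (Lam k))
    (t : V1 A η →ₗ[ℂ] V1 A η →ₗ[ℂ] V1 A η →ₗ[ℂ] VForm A p (Lam k)) :
    V0 A η →ₗ[ℂ] V1 A η →ₗ[ℂ] V1 A η →ₗ[ℂ] VForm A p (Lam k) :=
  anomaly ell1 ell2Gauge (gaugeAct p k) b t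

theorem fieldAnomaly_apply (b : V1 A η →ₗ[ℂ] V1 A η →ₗ[ℂ] VForm A p (Lam k))
    (t : V1 A η →ₗ[ℂ] V1 A η →ₗ[ℂ] V1 A η →ₗ[ℂ] VForm A p (Lam k)) (lam : V0 A η) (a a' : V1 A η) :
    fieldAnomaly b t lam a a' = b (ell2Gauge lam a) a' + b a (ell2Gauge lam a') +
      t (ell1 lam) a a' + t a (ell1 lam) a' + t a a' (ell1 lam) - gact (soAct η k) p lam (b a a') :=
  rfl

theorem fieldAnomaly_add (b b' : V1 A η →ₗ[ℂ] V1 A η →ₗ[ℂ] VForm A p (Lam k))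
    (t t' : V1 A η →ₗ[ℂ] V1 A η →ₗ[ℂ] V1 A η →ₗ[ℂ] VForm A p (Lam k)) :
    fieldAnomaly (b + b') (t + t') = fieldAnomaly b t + fieldAnomaly b' t' := by
  refine LinearMap.ext fun lam => LinearMap.ext fun a => LinearMap.ext fun a' => ?_
  simp only [fieldAnomaly_apply, LinearMap.add_apply, map_add]
  abel

attribute [local instance] tensorEnvModule

theorem variation_of_isAdmissible (𝓕 : DrinfeldTwist A)
    {b : V1 A η →ₗ[ℂ] V1 A η →ₗ[ℂ] VForm A p (Lam k)}
    {t : V1 A η →ₗ[ℂ] V1 A η →ₗ[ℂ] V1 A η →ₗ[ℂ] VForm A p (Lam k)} (h : IsAdmissible b t)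
    (lam : FPS (V0 A η)) (Φ : FPS (V1 A η)) :
    (𝓕.deform b t).variation 𝓕 lam Φ = 𝓕.star (gaugeAct p k) lam ((𝓕.deform b t).eval Φ) +
      𝓕.star₃ (fieldAnomaly b t) lam Φ Φ := by
  have e : ∀ (Ξ : Vect A) (a : V1 A η), uact A (V1 A η) (UniversalEnvelopingAlgebra.ι ℂ Ξ) a =
      (vLie 1 Ξ a.1, vLie 1 Ξ a.2) := fun Ξ a => Prod.ext (uact_vform Ξ a.1) (uact_vform Ξ a.2)
  have hb : IsEquivariant₂ A b := isEquivariant₂_of_ι fun Ξ a a' =>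
    (uact_vform Ξ (b a a')).trans ((h.quad_equivariant Ξ a a').trans (congrArg₂ (· + ·)
      (congrArg (fun x => b x a') (e Ξ a).symm) (congrArg (b a) (e Ξ a').symm)))
  have ht : IsEquivariant₃ A t := isEquivariant₃_of_ι fun Ξ a a' a'' =>
    (uact_vform Ξ (t a a' a'')).trans ((h.cub_equivariant Ξ a a' a'').trans (congrArg₂ (· + ·)
      (congrArg₂ (· + ·) (congrArg (fun x => t x a' a'') (e Ξ a).symm)
        (congrArg (fun x => t a x a'') (e Ξ a').symm)) (congrArg (t a a') (e Ξ a'').symm)))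
  exact 𝓕.variation_deform (g := gaugeAct p k) hb ht h.quad_ell1 h.cub_covariant lam Φ

/-- The deformed anomaly is precisely the failure of covariance, so the criterion serves the
negative statements as well. -/
theorem isCovariant_deform_iff (𝓕 : DrinfeldTwist A)
    {b : V1 A η →ₗ[ℂ] V1 A η →ₗ[ℂ] VForm A p (Lam k)}
    {t : V1 A η →ₗ[ℂ] V1 A η →ₗ[ℂ] V1 A η →ₗ[ℂ] VForm A p (Lam k)} (h : IsAdmissible b t) :
    (𝓕.deform b t).IsCovariant 𝓕 ↔ ∀ (lam : FPS (V0 A η)) (Φ : FPS (V1 A η)),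
      𝓕.star₃ (fieldAnomaly b t) lam Φ Φ = 0 := by
  refine forall_congr' fun lam => forall_congr' fun Φ => ?_
  rw [variation_of_isAdmissible 𝓕 h]
  exact add_eq_left

theorem star₃_zero (𝓕 : DrinfeldTwist A) {L V W X : Type*} [AddCommGroup L] [Module ℂ L]
    [AddCommGroup V] [Module ℂ V] [AddCommGroup W] [Module ℂ W] [AddCommGroup X] [Module ℂ X]
    [EnvModule A L] [EnvModule A V] [EnvModule A W] (u : FPS L) (v : FPS V) (w : FPS W) :
    𝓕.star₃ (0 : L →ₗ[ℂ] V →ₗ[ℂ] W →ₗ[ℂ] X) u v w = 0 := by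
  have h := 𝓕.star₃_smul 0 (0 : L →ₗ[ℂ] V →ₗ[ℂ] W →ₗ[ℂ] X) u v w
  rwa [zero_smul, zero_smul] at h

theorem isCovariant_deform (𝓕 : DrinfeldTwist A)
    {b : V1 A η →ₗ[ℂ] V1 A η →ₗ[ℂ] VForm A p (Lam k)}
    {t : V1 A η →ₗ[ℂ] V1 A η →ₗ[ℂ] V1 A η →ₗ[ℂ] VForm A p (Lam k)} (h : IsAdmissible b t)
    (h0 : fieldAnomaly b t = 0) : (𝓕.deform b t).IsCovariant 𝓕 :=
  (isCovariant_deform_iff 𝓕 h).2 fun lam Φ => by rw [h0, star₃_zero]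

end Leibniz

/-! ### The classical maps behind each expression and their anomalies. -/

section Brackets

variable {A : Type*} [CommRing A] [Algebra ℂ A] {η : Fin 4 → ℤˣ}

variable (A η) in
/-- The projection to the first component of a field. -/
abbrev fieldE : V1 A η →ₗ[ℂ] VForm A 1 (Lam 1) := LinearMap.fst ℂ _ _

variable (A η) in
/-- The projection to the second component of a field. -/
abbrev fieldΩ : V1 A η →ₗ[ℂ] VForm A 1 (So η) := LinearMap.snd ℂ _ _

variable (A η) in
/-- `(e, ω), (e', ω') ↦ e ⋏ de'`. -/
def quadETL : V1 A η →ₗ[ℂ] V1 A η →ₗ[ℂ] VForm A 3 (Lam 2) :=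
  (curly (p := 1) (q := 2)).compl₁₂ (fieldE A η) (d₁ ∘ₗ fieldE A η)

variable (A η) in
/-- `e ⋏ (ω' ∧ e'')`. -/
def cubETL : V1 A η →ₗ[ℂ] V1 A η →ₗ[ℂ] V1 A η →ₗ[ℂ] VForm A 3 (Lam 2) :=
  comp₃ (nestR curly (soTri (p := 1) (q := 1) (r := 2) (k := 1))) (fieldE A η) (fieldΩ A η)
    (fieldE A η)

variable (A η) in
/-- `de ⋏ e'`. -/
def quadTRE : V1 A η →ₗ[ℂ] V1 A η →ₗ[ℂ] VForm A 3 (Lam 2) :=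
  (curly (p := 2) (q := 1)).compl₁₂ (d₁ ∘ₗ fieldE A η) (fieldE A η)

variable (A η) in
/-- `(ω' ∧ e) ⋏ e''`. -/
def cubTRE : V1 A η →ₗ[ℂ] V1 A η →ₗ[ℂ] V1 A η →ₗ[ℂ] VForm A 3 (Lam 2) :=
  comp₃ (nestL curly (soTri (p := 1) (q := 1) (r := 2) (k := 1)).flip) (fieldE A η) (fieldΩ A η)
    (fieldE A η)

variable (A η) in
/-- `d(e ⋏ e')`. -/
def quadD : V1 A η →ₗ[ℂ] V1 A η →ₗ[ℂ] VForm A 3 (Lam 2) :=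
  ((curly (p := 1) (q := 1) (r := 2)).compl₁₂ (fieldE A η) (fieldE A η)).compr₂ (vd 2 3)

variable (A η) in
/-- `ω ▷ (e' ⋏ e'')`. -/
def cubDL : V1 A η →ₗ[ℂ] V1 A η →ₗ[ℂ] V1 A η →ₗ[ℂ] VForm A 3 (Lam 2) :=
  comp₃ (nestR (soTri (p := 1) (q := 2)) (curly (p := 1) (q := 1))) (fieldΩ A η) (fieldE A η)
    (fieldE A η)

variable (A η) in
/-- `ω'' ▷ (e ⋏ e')`. -/
def cubDR : V1 A η →ₗ[ℂ] V1 A η →ₗ[ℂ] V1 A η →ₗ[ℂ] VForm A 3 (Lam 2) :=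
  comp₃ (nestL (soTri (p := 1) (q := 2)).flip (curly (p := 1) (q := 1))) (fieldE A η) (fieldE A η)
    (fieldΩ A η)

variable (A η) in
/-- `e ⋏ dω'`. -/
def quadER : V1 A η →ₗ[ℂ] V1 A η →ₗ[ℂ] VForm A 3 (Lam 3) :=
  (curlySo (p := 1) (q := 2)).compl₁₂ (fieldE A η) (d₁ ∘ₗ fieldΩ A η)

variable (A η) in
/-- `½ e ⋏ [ω', ω'']`. -/
def cubER : V1 A η →ₗ[ℂ] V1 A η →ₗ[ℂ] V1 A η →ₗ[ℂ] VForm A 3 (Lam 3) :=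
  (1 / 2 : ℂ) • comp₃ (nestR curlySo (soBr (p := 1) (q := 1) (r := 2))) (fieldE A η) (fieldΩ A η)
    (fieldΩ A η)

variable (A η) in
/-- `dω ⋏ e'`. -/
def quadRE : V1 A η →ₗ[ℂ] V1 A η →ₗ[ℂ] VForm A 3 (Lam 3) :=
  (soCurly (p := 2) (q := 1)).compl₁₂ (d₁ ∘ₗ fieldΩ A η) (fieldE A η)

variable (A η) in
/-- `½ [ω, ω'] ⋏ e''`. -/
def cubRE : V1 A η →ₗ[ℂ] V1 A η →ₗ[ℂ] V1 A η →ₗ[ℂ] VForm A 3 (Lam 3) :=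
  (1 / 2 : ℂ) • comp₃ (nestL soCurly (soBr (p := 1) (q := 1) (r := 2))) (fieldΩ A η) (fieldΩ A η)
    (fieldE A η)

variable (A η) in
/-- `e ⋏ e' ⋏ e''`. -/
def cubEEE : V1 A η →ₗ[ℂ] V1 A η →ₗ[ℂ] V1 A η →ₗ[ℂ] VForm A 3 (Lam 3) :=
  comp₃ (nestR curly (curly (p := 1) (q := 1) (r := 2) (k := 1) (l := 1) (m := 2))) (fieldE A η)
    (fieldE A η) (fieldE A η)

variable (A η) in
/-- `e' ⋏ [ω, ω'']`. -/
def cubEωω : V1 A η →ₗ[ℂ] V1 A η →ₗ[ℂ] V1 A η →ₗ[ℂ] VForm A 3 (Lam 3) :=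
  comp₃ (nestR curlySo (soBr (p := 1) (q := 1) (r := 2))).flip (fieldΩ A η) (fieldE A η)
    (fieldΩ A η)

theorem quadETL_apply (a b : V1 A η) : quadETL A η a b = curly rfl rfl a.1 (vd 1 2 rfl b.1) := rfl
theorem cubETL_apply (a b c : V1 A η) : cubETL A η a b c =
  curly rfl rfl a.1 (soTri (r := 2) rfl b.2 c.1) := rfl
theorem quadTRE_apply (a b : V1 A η) : quadTRE A η a b = curly rfl rfl (vd 1 2 rfl a.1) b.1 := rfl
theorem cubTRE_apply (a b c : V1 A η) : cubTRE A η a b c =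
  curly rfl rfl (soTri (r := 2) rfl b.2 a.1) c.1 := rfl
theorem quadD_apply (a b : V1 A η) :
  quadD A η a b = vd 2 3 rfl (curly (r := 2) rfl rfl a.1 b.1) := rfl
theorem cubDL_apply (a b c : V1 A η) : cubDL A η a b c =
  soTri rfl a.2 (curly (r := 2) (m := 2) rfl rfl b.1 c.1) := rfl
theorem cubDR_apply (a b c : V1 A η) : cubDR A η a b c =
  soTri rfl c.2 (curly (r := 2) (m := 2) rfl rfl a.1 b.1) := rfl
theorem quadER_apply (a b : V1 A η) : quadER A η a b = curlySo rfl rfl a.1 (vd 1 2 rfl b.2) := rfl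
theorem cubER_apply (a b c : V1 A η) : cubER A η a b c =
  (1 / 2 : ℂ) • curlySo rfl rfl a.1 (soBr (r := 2) rfl b.2 c.2) := rfl
theorem quadRE_apply (a b : V1 A η) : quadRE A η a b = soCurly rfl rfl (vd 1 2 rfl a.2) b.1 := rfl
theorem cubRE_apply (a b c : V1 A η) : cubRE A η a b c =
  (1 / 2 : ℂ) • soCurly rfl rfl (soBr (r := 2) rfl a.2 b.2) c.1 := rfl
theorem cubEEE_apply (a b c : V1 A η) : cubEEE A η a b c =
  curly rfl rfl a.1 (curly (r := 2) (m := 2) rfl rfl b.1 c.1) := rfl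
theorem cubEωω_apply (a b c : V1 A η) : cubEωω A η a b c =
  curlySo rfl rfl b.1 (soBr (r := 2) rfl a.2 c.2) := rfl

theorem isAdmissible_ETL : IsAdmissible (quadETL A η) (cubETL A η) where
  quad_equivariant Ξ a a' := by simp only [quadETL_apply, vLie_curly, vd_vLie_one]
  cub_equivariant Ξ a a' a'' := by
    simp only [cubETL_apply, vLie_curly, vLie_soTri, map_add]; abel
  quad_ell1 lam a := by simp only [quadETL_apply, ell1_fst, map_zero, LinearMap.zero_apply, add_zero]
  cub_covariant lam a a' a'' := by
    simp only [cubETL_apply, gact_curly, gact_soTri, map_add, ell2Gauge_apply]; abel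

/-- The variation of de fails to be covariant by -dρ e; the shift of ω in ω ∧ e restores it. -/
theorem fieldAnomaly_ETL : fieldAnomaly (quadETL A η) (cubETL A η) = 0 := by
  refine LinearMap.ext fun lam => LinearMap.ext fun a => LinearMap.ext fun a' => ?_
  simp only [fieldAnomaly_apply, quadETL_apply, cubETL_apply, ell2Gauge_apply, ell1_fst, ell1_snd,
    gact_curly, vd_gact_lam_one rfl rfl, map_sub, map_zero, LinearMap.zero_apply]
  abel

theorem isAdmissible_TRE : IsAdmissible (quadTRE A η) (cubTRE A η) where
  quad_equivariant Ξ a a' := by simp only [quadTRE_apply, vLie_curly, vd_vLie_one]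
  cub_equivariant Ξ a a' a'' := by
    simp only [cubTRE_apply, vLie_curly, vLie_soTri, map_add, LinearMap.add_apply]; abel
  quad_ell1 lam a := by simp only [quadTRE_apply, ell1_fst, map_zero, LinearMap.zero_apply, add_zero]
  cub_covariant lam a a' a'' := by
    simp only [cubTRE_apply, gact_curly, gact_soTri, map_add, LinearMap.add_apply, ell2Gauge_apply]
    abel

theorem fieldAnomaly_TRE : fieldAnomaly (quadTRE A η) (cubTRE A η) = 0 := by
  refine LinearMap.ext fun lam => LinearMap.ext fun a => LinearMap.ext fun a' => ?_
  simp only [fieldAnomaly_apply, quadTRE_apply, cubTRE_apply, ell2Gauge_apply, ell1_fst, ell1_snd,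
    gact_curly, vd_gact_lam_one rfl rfl, map_sub, map_zero, LinearMap.zero_apply,
    LinearMap.sub_apply]
  abel

theorem isAdmissible_DL : IsAdmissible (quadD A η) (cubDL A η) where
  quad_equivariant Ξ a a' := by simp only [quadD_apply, ← vd_vLie_two, vLie_curly, map_add]
  cub_equivariant Ξ a a' a'' := by
    simp only [cubDL_apply, vLie_curly, vLie_soTri, map_add]; abel
  quad_ell1 lam a := by simp only [quadD_apply, ell1_fst, map_zero, LinearMap.zero_apply, add_zero]
  cub_covariant lam a a' a'' := by
    simp only [cubDL_apply, gact_curly, gact_soTri, map_add, ell2Gauge_apply]; abel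

/-- The Leibniz rule is read backwards to make e ⋏ e' one covariant two-form Φ. Then dΦ fails by -dρ
▷ Φ, which the shift of ω in ω ▷ Φ cancels. -/
theorem fieldAnomaly_DL : fieldAnomaly (quadD A η) (cubDL A η) = 0 := by
  refine LinearMap.ext fun lam => LinearMap.ext fun a => LinearMap.ext fun a' => ?_
  simp only [fieldAnomaly_apply, quadD_apply, cubDL_apply, ell2Gauge_apply, ell1_fst, ell1_snd,
    ← map_add, ← gact_curly, vd_gact_lam_two rfl rfl rfl, map_zero, LinearMap.zero_apply]
  rw [sub_add_cancel, add_zero, add_zero, sub_self]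

theorem isAdmissible_DR : IsAdmissible (quadD A η) (cubDR A η) where
  quad_equivariant := isAdmissible_DL.quad_equivariant
  cub_equivariant Ξ a a' a'' := by
    simp only [cubDR_apply, vLie_curly, vLie_soTri, map_add]; abel
  quad_ell1 := isAdmissible_DL.quad_ell1
  cub_covariant lam a a' a'' := by
    simp only [cubDR_apply, gact_curly, gact_soTri, map_add, ell2Gauge_apply]; abel

theorem fieldAnomaly_DR : fieldAnomaly (quadD A η) (cubDR A η) = 0 := by
  refine LinearMap.ext fun lam => LinearMap.ext fun a => LinearMap.ext fun a' => ?_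
  simp only [fieldAnomaly_apply, quadD_apply, cubDR_apply, ell2Gauge_apply, ell1_fst, ell1_snd,
    ← map_add, ← gact_curly, vd_gact_lam_two rfl rfl rfl, map_zero, LinearMap.zero_apply]
  rw [add_zero, add_zero, sub_add_cancel, sub_self]

theorem isAdmissible_ER_zero : IsAdmissible (quadER A η) 0 where
  quad_equivariant Ξ a a' := by simp only [quadER_apply, vLie_curlySo, vd_vLie_one]
  cub_equivariant Ξ a a' a'' := by simp
  quad_ell1 lam a := by
    simp only [quadER_apply, ell1_fst, ell1_snd, vd_vd_zero, map_zero, LinearMap.zero_apply, add_zero]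
  cub_covariant lam a a' a'' := by simp

theorem isAdmissible_RE_zero : IsAdmissible (quadRE A η) 0 where
  quad_equivariant Ξ a a' := by simp only [quadRE_apply, vLie_soCurly, vd_vLie_one]
  cub_equivariant Ξ a a' a'' := by simp
  quad_ell1 lam a := by
    simp only [quadRE_apply, ell1_fst, ell1_snd, vd_vd_zero, map_zero, LinearMap.zero_apply, add_zero]
  cub_covariant lam a a' a'' := by simp

theorem isAdmissible_ER : IsAdmissible (quadER A η) (cubER A η) where
  quad_equivariant := isAdmissible_ER_zero.quad_equivariant
  cub_equivariant Ξ a a' a'' := by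
    simp only [cubER_apply, map_smul, vLie_curlySo, vLie_soBr, map_add, ← smul_add]
    congr 1; abel
  quad_ell1 := isAdmissible_ER_zero.quad_ell1
  cub_covariant lam a a' a'' := by
    simp only [cubER_apply, map_smul, gact_curlySo, gact_soBr, map_add, ell2Gauge_apply, ← smul_add]
    congr 1; abel

theorem isAdmissible_RE : IsAdmissible (quadRE A η) (cubRE A η) where
  quad_equivariant := isAdmissible_RE_zero.quad_equivariant
  cub_equivariant Ξ a a' a'' := by
    simp only [cubRE_apply, map_smul, vLie_soCurly, vLie_soBr, map_add, LinearMap.add_apply,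
      ← smul_add]
  quad_ell1 := isAdmissible_RE_zero.quad_ell1
  cub_covariant lam a a' a'' := by
    simp only [cubRE_apply, map_smul, gact_soCurly, gact_soBr, map_add, LinearMap.add_apply,
      ell2Gauge_apply, ← smul_add]

theorem half_smul_add_half_smul {V : Type*} [AddCommGroup V] [Module ℂ V] (x : V) :
    (1 / 2 : ℂ) • x + (1 / 2 : ℂ) • x = x := by module

theorem fieldAnomaly_EDω_apply (lam : V0 A η) (a a' : V1 A η) :
    fieldAnomaly (quadER A η) 0 lam a a' =
      -curlySo rfl rfl a.1 (soBr (r := 2) rfl (vd 0 1 rfl lam.2) a'.2) := by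
  simp only [fieldAnomaly_apply, quadER_apply, ell2Gauge_apply, gact_curlySo,
    vd_gact_so_one rfl rfl, map_sub, LinearMap.zero_apply]
  abel

theorem fieldAnomaly_DωE_apply (lam : V0 A η) (a a' : V1 A η) :
    fieldAnomaly (quadRE A η) 0 lam a a' =
      -soCurly rfl rfl (soBr (r := 2) rfl (vd 0 1 rfl lam.2) a.2) a'.1 := by
  simp only [fieldAnomaly_apply, quadRE_apply, ell2Gauge_apply, gact_soCurly,
    vd_gact_so_one rfl rfl, map_sub, LinearMap.zero_apply, LinearMap.sub_apply]
  abel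

/-- Shifting either entry of ½[ω, ω] yields half of [dρ, ω], because the bracket of one-forms is
symmetric. The halves together cancel the defect of dω. -/
theorem fieldAnomaly_ER : fieldAnomaly (quadER A η) (cubER A η) = 0 := by
  refine LinearMap.ext fun lam => LinearMap.ext fun a => LinearMap.ext fun a' => ?_
  have h := fieldAnomaly_EDω_apply lam a a'
  have h2 := half_smul_add_half_smul
    (curlySo (m := 3) rfl rfl a.1 (soBr (r := 2) rfl (vd 0 1 rfl lam.2) a'.2))
  rw [fieldAnomaly_apply] at h ⊢
  simp only [LinearMap.zero_apply, add_zero, cubER_apply, ell1_fst, ell1_snd, map_zero, smul_zero,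
    soBr_comm _ a'.2] at h ⊢
  rw [add_assoc (_ + _), h2, add_sub_right_comm, h, neg_add_cancel]

theorem fieldAnomaly_RE : fieldAnomaly (quadRE A η) (cubRE A η) = 0 := by
  refine LinearMap.ext fun lam => LinearMap.ext fun a => LinearMap.ext fun a' => ?_
  have h := fieldAnomaly_DωE_apply lam a a'
  have h2 := half_smul_add_half_smul
    (soCurly (m := 3) rfl rfl (soBr (r := 2) rfl (vd 0 1 rfl lam.2) a.2) a'.1)
  rw [fieldAnomaly_apply] at h ⊢
  simp only [LinearMap.zero_apply, add_zero, cubRE_apply, ell1_fst, ell1_snd, map_zero, smul_zero,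
    soBr_comm _ a.2] at h ⊢
  rw [add_assoc (_ + _), h2, add_sub_right_comm, h, neg_add_cancel]

theorem isAdmissible_EEE : IsAdmissible (0 : V1 A η →ₗ[ℂ] _) (cubEEE A η) where
  quad_equivariant Ξ a a' := by simp
  cub_equivariant Ξ a a' a'' := by
    simp only [cubEEE_apply, vLie_curly, map_add]; abel
  quad_ell1 lam a := by simp
  cub_covariant lam a a' a'' := by
    simp only [cubEEE_apply, gact_curly, map_add, ell2Gauge_apply]; abel

theorem fieldAnomaly_EEE : fieldAnomaly (0 : V1 A η →ₗ[ℂ] _) (cubEEE A η) = 0 := by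
  refine LinearMap.ext fun lam => LinearMap.ext fun a => LinearMap.ext fun a' => ?_
  simp only [fieldAnomaly_apply, cubEEE_apply, ell1_fst, map_zero, LinearMap.zero_apply, add_zero,
    sub_self]

theorem isAdmissible_Eωω : IsAdmissible (0 : V1 A η →ₗ[ℂ] _) (cubEωω A η) where
  quad_equivariant Ξ a a' := by simp
  cub_equivariant Ξ a a' a'' := by
    simp only [cubEωω_apply, vLie_curlySo, vLie_soBr, map_add]; abel
  quad_ell1 lam a := by simp
  cub_covariant lam a a' a'' := by
    simp only [cubEωω_apply, gact_curlySo, gact_soBr, map_add, ell2Gauge_apply]; abel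

/-- A shift of the first or of the last argument leaves e respectively before or after the other ω
in the argument order. The two terms are thus the opposites of the anomalies of e ⋏ dω and dω ⋏ e.
-/
theorem fieldAnomaly_Eωω_apply (lam : V0 A η) (a a' : V1 A η) :
    fieldAnomaly (0 : V1 A η →ₗ[ℂ] _) (cubEωω A η) lam a a' =
      curlySo rfl rfl a.1 (soBr (r := 2) rfl (vd 0 1 rfl lam.2) a'.2) +
        soCurly rfl rfl (soBr (r := 2) rfl (vd 0 1 rfl lam.2) a.2) a'.1 := by
  simp only [fieldAnomaly_apply, cubEωω_apply, ell1_fst, ell1_snd, map_zero, LinearMap.zero_apply,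
    add_zero, zero_add, sub_zero]
  rw [soBr_comm _ a.2, soCurly_comm]

theorem isAdmissible_sum :
    IsAdmissible (quadER A η + quadRE A η + 0) (0 + 0 + cubEωω A η) :=
  (isAdmissible_ER_zero.add isAdmissible_RE_zero).add isAdmissible_Eωω

theorem fieldAnomaly_sum :
    fieldAnomaly (quadER A η + quadRE A η + 0) (0 + 0 + cubEωω A η) = 0 := by
  rw [fieldAnomaly_add, fieldAnomaly_add]
  refine LinearMap.ext fun lam => LinearMap.ext fun a => LinearMap.ext fun a' => ?_
  simp only [LinearMap.add_apply, fieldAnomaly_EDω_apply, fieldAnomaly_DωE_apply,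
    fieldAnomaly_Eωω_apply, LinearMap.zero_apply]
  abel

end Brackets

/-! ### Each braided expression is the deformation of classical maps. -/

section Expressions

variable {A : Type*} [CommRing A] [Algebra ℂ A] {η : Fin 4 → ℤˣ}

attribute [local instance] tensorEnvModule

theorem isEquivariant_fieldE : IsEquivariant A (fieldE A η) := isEquivariant_fst

theorem isEquivariant_fieldΩ : IsEquivariant A (fieldΩ A η) := isEquivariant_snd

theorem IsEquivariant₂.flip {V W X : Type*} [AddCommGroup V] [Module ℂ V] [AddCommGroup W]
    [Module ℂ W] [AddCommGroup X] [Module ℂ X] [EnvModule A V] [EnvModule A W] [EnvModule A X]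
    {B : V →ₗ[ℂ] W →ₗ[ℂ] X} (hB : IsEquivariant₂ A B) : IsEquivariant₂ A B.flip :=
  isEquivariant₂_of_ι fun Ξ v w => by
    simp only [LinearMap.flip_apply, hB.ι_apply, add_comm]

theorem expression_ext {X : Type*} [AddCommGroup X] [Module ℂ X] {S T : Expression A η X}
    (h₂ : ∀ a b, S.1 a b = T.1 a b) (h₃ : ∀ a b c, S.2 a b c = T.2 a b c) : S = T :=
  Prod.ext (LinearMap.ext₂ h₂) (LinearMap.ext fun a => LinearMap.ext₂ (h₃ a))

namespace DrinfeldTwist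

variable (𝓕 : DrinfeldTwist A)

section Generic

variable {U V W X Y Z : Type*} [AddCommGroup U] [Module ℂ U] [AddCommGroup V] [Module ℂ V]
  [AddCommGroup W] [Module ℂ W] [AddCommGroup X] [Module ℂ X] [AddCommGroup Y] [Module ℂ Y]
  [AddCommGroup Z] [Module ℂ Z] [EnvModule A U] [EnvModule A V] [EnvModule A W] [EnvModule A Y]

theorem braid_compl₂_flip (B : V →ₗ[ℂ] Y →ₗ[ℂ] X) {C : U →ₗ[ℂ] W →ₗ[ℂ] Y}
    (hC : IsEquivariant₂ A C) (w : FPS W) (u : FPS U) (v : FPS V) :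
    𝓕.braid ((𝓕.star B).compl₂ ((𝓕.star C).flip w)) u v = 𝓕.star₃ (nestR B C).flip u v w :=
  𝓕.braid_star₃_left (nestR B C) w (fun v u => 𝓕.star_star_right B hC v u w) u v

theorem star_eq_neg_smul_map (π : Z →ₗ[ℂ] X) (c : ℂ) {B : V →ₗ[ℂ] W →ₗ[ℂ] Z}
    {b : V →ₗ[ℂ] W →ₗ[ℂ] X} (h : ∀ v w, b v w = -(c • π (B v w))) (v : FPS V) (w : FPS W) :
    𝓕.star b v w = -(c • FPS.map π (𝓕.star B v w)) := by
  have : b = (-c) • B.compr₂ π := LinearMap.ext₂ fun v w => by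
    rw [h, ← neg_smul]; rfl
  rw [this, star_smul, map_star, ← neg_smul]; rfl

theorem star₃_eq_neg_smul_map (π : Z →ₗ[ℂ] X) (c : ℂ) {T : U →ₗ[ℂ] V →ₗ[ℂ] W →ₗ[ℂ] Z}
    {t : U →ₗ[ℂ] V →ₗ[ℂ] W →ₗ[ℂ] X} (h : ∀ u v w, t u v w = -(c • π (T u v w))) (u : FPS U)
    (v : FPS V) (w : FPS W) : 𝓕.star₃ t u v w = -(c • FPS.map π (𝓕.star₃ T u v w)) := by
  rw [map_star₃, ← neg_smul, ← star₃_smul]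
  refine LinearMap.congr_fun (LinearMap.congr_fun₂ (congrArg 𝓕.star₃ ?_) u v) w
  refine LinearMap.ext fun u => LinearMap.ext₂ fun v w => ?_
  rw [h, ← neg_smul]; rfl

end Generic

theorem exprETL_eq : 𝓕.exprETL η = 𝓕.deform (quadETL A η) (cubETL A η) := by
  refine expression_ext (fun a b => ?_) fun a b c => ?_
  · exact 𝓕.star_map isEquivariant_fieldE ((isEquivariant_vd_one rfl).comp isEquivariant_fieldE)
      curly a b
  · exact (𝓕.star_star_right _ (isEquivariant₂_formMul _ _) _ _ _).trans
      (𝓕.star₃_map isEquivariant_fieldE isEquivariant_fieldΩ isEquivariant_fieldE _ a b c)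

/-- The R-matrix in the right torsion merely flips the classical product: e enters before ω although
ω acts on e. -/
theorem exprTRE_eq : 𝓕.exprTRE η = 𝓕.deform (quadTRE A η) (cubTRE A η) := by
  refine expression_ext (fun a b => ?_) fun a b c => ?_
  · exact 𝓕.star_map ((isEquivariant_vd_one rfl).comp isEquivariant_fieldE) isEquivariant_fieldE
      curly a b
  · change 𝓕.star curly (𝓕.braid (𝓕.star soTri) (ePart a) (ωPart b)) (ePart c) = _
    rw [braid_star]
    exact (𝓕.star_star_left _ (isEquivariant₂_formMul _ _).flip _ _ _).trans
      (𝓕.star₃_map isEquivariant_fieldE isEquivariant_fieldΩ isEquivariant_fieldE _ a b c)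

theorem map_vd_ee (a b : FPS (V1 A η)) :
    D₂ (𝓕.ee (ePart a) (ePart b)) = 𝓕.star (quadD A η) a b := by
  rw [D₂, map_star]
  exact 𝓕.star_map isEquivariant_fieldE isEquivariant_fieldE _ a b

theorem exprDL_eq : 𝓕.exprDL η = 𝓕.deform (quadD A η) (cubDL A η) := by
  refine expression_ext (fun a b => ?_) fun a b c => ?_
  · exact 𝓕.map_vd_ee a b
  · exact (𝓕.star_star_right _ (isEquivariant₂_formMul _ _) _ _ _).trans
      (𝓕.star₃_map isEquivariant_fieldΩ isEquivariant_fieldE isEquivariant_fieldE _ a b c)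

theorem exprDR_eq : 𝓕.exprDR η = 𝓕.deform (quadD A η) (cubDR A η) := by
  refine expression_ext (fun a b => ?_) fun a b c => ?_
  · exact 𝓕.map_vd_ee a b
  · change 𝓕.braid (𝓕.star soTri) (𝓕.star curly (ePart a) (ePart b)) (ωPart c) = _
    rw [braid_star]
    exact (𝓕.star_star_left _ (isEquivariant₂_formMul _ _) _ _ _).trans
      (𝓕.star₃_map isEquivariant_fieldE isEquivariant_fieldE isEquivariant_fieldΩ _ a b c)

theorem curR_dω (a b : FPS (V1 A η)) : (𝓕.star curlySo (ePart a) (D₁ (ωPart b)) :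
    FPS (VForm A 3 (Lam 3))) = 𝓕.star (quadER A η) a b :=
  𝓕.star_map isEquivariant_fieldE ((isEquivariant_vd_one rfl).comp isEquivariant_fieldΩ) curlySo a b

theorem curL_dω (a b : FPS (V1 A η)) : (𝓕.star soCurly (D₁ (ωPart a)) (ePart b) :
    FPS (VForm A 3 (Lam 3))) = 𝓕.star (quadRE A η) a b :=
  𝓕.star_map ((isEquivariant_vd_one rfl).comp isEquivariant_fieldΩ) isEquivariant_fieldE soCurly a b

theorem exprER_eq : 𝓕.exprER η = 𝓕.deform (quadER A η) (cubER A η) := by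
  refine expression_ext (fun a b => ?_) fun a b c => ?_
  · exact 𝓕.curR_dω a b
  · refine Eq.trans ?_ (𝓕.star₃_smul _ _ a b c).symm
    refine congrArg (fun x : FPS (VForm A 3 (Lam 3)) => (1 / 2 : ℂ) • x) ?_
    exact (𝓕.star_star_right _ (isEquivariant₂_formMul _ _) _ _ _).trans
      (𝓕.star₃_map isEquivariant_fieldE isEquivariant_fieldΩ isEquivariant_fieldΩ _ a b c)

theorem exprRE_eq : 𝓕.exprRE η = 𝓕.deform (quadRE A η) (cubRE A η) := by
  refine expression_ext (fun a b => ?_) fun a b c => ?_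
  · exact 𝓕.curL_dω a b
  · refine Eq.trans ?_ (𝓕.star₃_smul _ _ a b c).symm
    refine congrArg (fun x : FPS (VForm A 3 (Lam 3)) => (1 / 2 : ℂ) • x) ?_
    exact (𝓕.star_star_left _ (isEquivariant₂_formMul _ _) _ _ _).trans
      (𝓕.star₃_map isEquivariant_fieldΩ isEquivariant_fieldΩ isEquivariant_fieldE _ a b c)

theorem exprEEE_eq : 𝓕.exprEEE η = 𝓕.deform 0 (cubEEE A η) := by
  refine expression_ext (fun a b => ?_) fun a b c => ?_
  · exact (LinearMap.congr_fun₂ 𝓕.star_zero a b).symm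
  · exact (𝓕.star_star_right _ (isEquivariant₂_formMul _ _) _ _ _).trans
      (𝓕.star₃_map isEquivariant_fieldE isEquivariant_fieldE isEquivariant_fieldE _ a b c)

theorem exprEDω_eq : 𝓕.exprEDω η = 𝓕.deform (quadER A η) 0 := by
  refine expression_ext (fun a b => ?_) fun a b c => ?_
  · exact 𝓕.curR_dω a b
  · exact (star₃_zero (X := VForm A 3 (Lam 3)) 𝓕 a b c).symm

theorem exprDωE_eq : 𝓕.exprDωE η = 𝓕.deform (quadRE A η) 0 := by
  refine expression_ext (fun a b => ?_) fun a b c => ?_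
  · exact 𝓕.curL_dω a b
  · exact (star₃_zero (X := VForm A 3 (Lam 3)) 𝓕 a b c).symm

/-- The R-matrix that moves e to the front is absorbed by flipping the first two arguments, so e
occupies the middle place of the classical map. -/
theorem exprEωω_eq : 𝓕.exprEωω η = 𝓕.deform 0 (cubEωω A η) := by
  refine expression_ext (fun a b => ?_) fun a b c => ?_
  · exact (LinearMap.congr_fun₂ 𝓕.star_zero a b).symm
  · have h := 𝓕.braid_compl₂_flip (curlySo (A := A) (η := η) (p := 1) (q := 2) (r := 3) (k := 1) (m := 3))
      (C := soBr (A := A) (η := η) (p := 1) (q := 1) (r := 2)) (isEquivariant₂_formMul _ _)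
      (ωPart c) (ωPart a) (ePart b)
    exact h.trans (𝓕.star₃_map isEquivariant_fieldΩ isEquivariant_fieldE isEquivariant_fieldΩ _ a b c)

theorem deform_add {X : Type*} [AddCommGroup X] [Module ℂ X] (b b' : V1 A η →ₗ[ℂ] V1 A η →ₗ[ℂ] X)
    (t t' : V1 A η →ₗ[ℂ] V1 A η →ₗ[ℂ] V1 A η →ₗ[ℂ] X) :
    𝓕.deform (b + b') (t + t') = 𝓕.deform b t + 𝓕.deform b' t' :=
  expression_ext (fun a a' => by rw [deform, star_add]; rfl) fun a a' a'' => 𝓕.star₃_add _ _ _ _ _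

theorem expr_eq_deform {X : Type*} [AddCommGroup X] [Module ℂ X] (π : V2 A →ₗ[ℂ] X) (Λ : ℝ)
    {S : Expression A η X} {b : V1 A η →ₗ[ℂ] V1 A η →ₗ[ℂ] X}
    {t : V1 A η →ₗ[ℂ] V1 A η →ₗ[ℂ] V1 A η →ₗ[ℂ] X}
    (h₂ : ∀ a a', S.1 a a' = -((1 / 2 : ℂ) • FPS.map π (𝓕.star ell2 a a')))
    (h₃ : ∀ a a' a'', S.2 a a' a'' = -((1 / 6 : ℂ) • FPS.map π (𝓕.star₃ (ell3 Λ) a a' a'')))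
    (hb : ∀ a a', b a a' = -((1 / 2 : ℂ) • π (ell2 a a')))
    (ht : ∀ a a' a'', t a a' a'' = -((1 / 6 : ℂ) • π (ell3 Λ a a' a''))) : S = 𝓕.deform b t :=
  expression_ext (fun a a' => (h₂ a a').trans (𝓕.star_eq_neg_smul_map π _ hb a a').symm)
    fun a a' a'' => (h₃ a a' a'').trans (𝓕.star₃_eq_neg_smul_map π _ ht a a' a'').symm

end DrinfeldTwist

end Expressions

/-! ### Decomposition of the brackets; the torsion and Einstein equations and covariance. -/

section FieldEquations

variable {A : Type*} [CommRing A] [Algebra ℂ A] {η : Fin 4 → ℤˣ}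

attribute [local instance] tensorEnvModule

namespace DrinfeldTwist

variable (𝓕 : DrinfeldTwist A)

section Generic

variable {U V W X : Type*} [AddCommGroup U] [Module ℂ U] [AddCommGroup V] [Module ℂ V]
  [AddCommGroup W] [Module ℂ W] [AddCommGroup X] [Module ℂ X] [EnvModule A U] [EnvModule A V]
  [EnvModule A W]

theorem star_sum {n : ℕ} (c : Fin n → ℂ) (B : Fin n → V →ₗ[ℂ] W →ₗ[ℂ] X) {b : V →ₗ[ℂ] W →ₗ[ℂ] X}
    (h : ∀ v w, b v w = ∑ i, c i • B i v w) (v : FPS V) (w : FPS W) :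
    𝓕.star b v w = ∑ i, c i • 𝓕.star (B i) v w := by
  let S : (V →ₗ[ℂ] W →ₗ[ℂ] X) →ₗ[ℂ] FPS X :=
    { toFun := fun b => 𝓕.star b v w
      map_add' := fun b b' => by rw [star_add]; rfl
      map_smul' := fun c b => by rw [star_smul]; rfl }
  have hb : b = ∑ i, c i • B i := LinearMap.ext₂ fun v w => by
    rw [h, LinearMap.sum_apply, LinearMap.sum_apply]; rfl
  change S b = ∑ i, c i • S (B i)
  rw [hb, map_sum]
  exact Finset.sum_congr rfl fun i _ => map_smul _ _ _

theorem star₃_sum {n : ℕ} (c : Fin n → ℂ) (T : Fin n → U →ₗ[ℂ] V →ₗ[ℂ] W →ₗ[ℂ] X)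
    {t : U →ₗ[ℂ] V →ₗ[ℂ] W →ₗ[ℂ] X} (h : ∀ u v w, t u v w = ∑ i, c i • T i u v w) (u : FPS U)
    (v : FPS V) (w : FPS W) : 𝓕.star₃ t u v w = ∑ i, c i • 𝓕.star₃ (T i) u v w := by
  let S : (U →ₗ[ℂ] V →ₗ[ℂ] W →ₗ[ℂ] X) →ₗ[ℂ] FPS X :=
    { toFun := fun t => 𝓕.star₃ t u v w
      map_add' := fun t t' => 𝓕.star₃_add _ _ _ _ _
      map_smul' := fun c t => 𝓕.star₃_smul _ _ _ _ _ }
  have hb : t = ∑ i, c i • T i := LinearMap.ext fun u => LinearMap.ext₂ fun v w => by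
    rw [h, LinearMap.sum_apply, LinearMap.sum_apply, LinearMap.sum_apply]; rfl
  change S t = ∑ i, c i • S (T i)
  rw [hb, map_sum]
  exact Finset.sum_congr rfl fun i _ => map_smul _ _ _

end Generic

theorem eval_deform_sum {X : Type*} [AddCommGroup X] [Module ℂ X] {n : ℕ} (c : Fin n → ℂ)
    (B : Fin n → V1 A η →ₗ[ℂ] V1 A η →ₗ[ℂ] X)
    (T : Fin n → V1 A η →ₗ[ℂ] V1 A η →ₗ[ℂ] V1 A η →ₗ[ℂ] X) {b : V1 A η →ₗ[ℂ] V1 A η →ₗ[ℂ] X}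
    {t : V1 A η →ₗ[ℂ] V1 A η →ₗ[ℂ] V1 A η →ₗ[ℂ] X} (hb : ∀ a a', b a a' = ∑ i, c i • B i a a')
    (ht : ∀ a a' a'', t a a' a'' = ∑ i, c i • T i a a' a'') (Φ : FPS (V1 A η)) :
    (𝓕.deform b t).eval Φ = ∑ i, c i • (𝓕.deform (B i) (T i)).eval Φ := by
  have h : ∀ i, c i • (𝓕.deform (B i) (T i)).eval Φ =
      c i • 𝓕.star (B i) Φ Φ + c i • 𝓕.star₃ (T i) Φ Φ Φ := fun i => smul_add _ _ _
  rw [Finset.sum_congr rfl fun i _ => h i, Finset.sum_add_distrib]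
  exact congrArg₂ (· + ·) (𝓕.star_sum c B hb Φ Φ) (𝓕.star₃_sum c T ht Φ Φ Φ)

/-- Admissibility and the anomaly depend linearly on the pair (b, t), so linear combinations inherit
covariance. -/
theorem isCovariant_deform_sum {p k n : ℕ} (c : Fin n → ℂ)
    (B : Fin n → V1 A η →ₗ[ℂ] V1 A η →ₗ[ℂ] VForm A p (Lam k))
    (T : Fin n → V1 A η →ₗ[ℂ] V1 A η →ₗ[ℂ] V1 A η →ₗ[ℂ] VForm A p (Lam k))
    {b : V1 A η →ₗ[ℂ] V1 A η →ₗ[ℂ] VForm A p (Lam k)}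
    {t : V1 A η →ₗ[ℂ] V1 A η →ₗ[ℂ] V1 A η →ₗ[ℂ] VForm A p (Lam k)}
    (hb : ∀ a a', b a a' = ∑ i, c i • B i a a')
    (ht : ∀ a a' a'', t a a' a'' = ∑ i, c i • T i a a' a'')
    (h : ∀ i, IsAdmissible (B i) (T i)) (h0 : ∀ i, fieldAnomaly (B i) (T i) = 0) :
    (𝓕.deform b t).IsCovariant 𝓕 := by
  refine isCovariant_deform 𝓕 ⟨fun Ξ a a' => ?_, fun Ξ a a' a'' => ?_, fun lam a => ?_,
    fun lam a a' a'' => ?_⟩ (LinearMap.ext fun lam => LinearMap.ext₂ fun a a' => ?_)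
  · simp only [hb, map_sum, map_smul, (h _).quad_equivariant, smul_add, Finset.sum_add_distrib]
  · simp only [ht, map_sum, map_smul, (h _).cub_equivariant, smul_add, Finset.sum_add_distrib]
  · rw [hb, hb, ← Finset.sum_add_distrib]
    exact Finset.sum_eq_zero fun i _ => by rw [← smul_add, (h i).quad_ell1, smul_zero]
  · simp only [ht, map_sum, map_smul, (h _).cub_covariant, smul_add, Finset.sum_add_distrib]
  · have e : fieldAnomaly b t lam a a' = ∑ i, c i • fieldAnomaly (B i) (T i) lam a a' := by
      simp only [fieldAnomaly_apply, hb, ht, map_sum, map_smul, smul_add, smul_sub,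
        Finset.sum_add_distrib, Finset.sum_sub_distrib]
    rw [e]
    exact Finset.sum_eq_zero fun i _ => by
      rw [h0 i]
      exact smul_zero (c i)

variable (A η) in
/-- The classical bracket `-½ ℓ₂`, with values in `Ω³(⋀²)`. -/
def quadω : V1 A η →ₗ[ℂ] V1 A η →ₗ[ℂ] VForm A 3 (Lam 2) :=
  LinearMap.mk₂ ℂ (fun a a' => -((1 / 2 : ℂ) • (ell2 a a').2))
    (by intros; simp only [map_add, LinearMap.add_apply, Prod.snd_add]; module)
    (by intros; simp only [map_smul, LinearMap.smul_apply, Prod.smul_snd]; module)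
    (by intros; simp only [map_add, Prod.snd_add]; module)
    (by intros; simp only [map_smul, Prod.smul_snd]; module)

variable (A η) in
/-- The classical bracket `-½ ℓ₂`, with values in `Ω³(⋀³)`. -/
def quadE : V1 A η →ₗ[ℂ] V1 A η →ₗ[ℂ] VForm A 3 (Lam 3) :=
  LinearMap.mk₂ ℂ (fun a a' => -((1 / 2 : ℂ) • (ell2 a a').1))
    (by intros; simp only [map_add, LinearMap.add_apply, Prod.fst_add]; module)
    (by intros; simp only [map_smul, LinearMap.smul_apply, Prod.smul_fst]; module)
    (by intros; simp only [map_add, Prod.fst_add]; module)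
    (by intros; simp only [map_smul, Prod.smul_fst]; module)

variable (A η) in
/-- The classical bracket `-⅙ ℓ₃`, with values in `Ω³(⋀²)`. -/
def cubω : V1 A η →ₗ[ℂ] V1 A η →ₗ[ℂ] V1 A η →ₗ[ℂ] VForm A 3 (Lam 2) :=
  mk₃ (fun a a' a'' => -((1 / 6 : ℂ) • ell3Tors a a' a''))
    (by intros; simp only [map_add, LinearMap.add_apply]; module)
    (by intros; simp only [map_smul, LinearMap.smul_apply]; module)
    (by intros; simp only [map_add, LinearMap.add_apply]; module)
    (by intros; simp only [map_smul, LinearMap.smul_apply]; module)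
    (by intros; simp only [map_add]; module)
    (by intros; simp only [map_smul]; module)

variable (A η) in
/-- The classical bracket `-⅙ ℓ₃`, with values in `Ω³(⋀³)`. -/
def cubE (Λ : ℝ) : V1 A η →ₗ[ℂ] V1 A η →ₗ[ℂ] V1 A η →ₗ[ℂ] VForm A 3 (Lam 3) :=
  mk₃ (fun a a' a'' => -((1 / 6 : ℂ) • ell3Curv Λ a a' a''))
    (by intros; simp only [map_add, LinearMap.add_apply]; module)
    (by intros; simp only [map_smul, LinearMap.smul_apply]; module)
    (by intros; simp only [map_add, LinearMap.add_apply]; module)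
    (by intros; simp only [map_smul, LinearMap.smul_apply]; module)
    (by intros; simp only [map_add]; module)
    (by intros; simp only [map_smul]; module)

theorem exprω_eq (Λ : ℝ) : 𝓕.exprω η Λ = 𝓕.deform (quadω A η) (cubω A η) :=
  𝓕.expr_eq_deform (LinearMap.snd ℂ _ _) Λ (fun _ _ => rfl) (fun _ _ _ => rfl)
    (fun _ _ => rfl) fun _ _ _ => rfl

theorem exprE_eq (Λ : ℝ) : 𝓕.exprE η Λ = 𝓕.deform (quadE A η) (cubE A η Λ) :=
  𝓕.expr_eq_deform (LinearMap.fst ℂ _ _) Λ (fun _ _ => rfl) (fun _ _ _ => rfl)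
    (fun _ _ => rfl) fun _ _ _ => rfl

/-- As d(e⋏e') = de⋏e' - e⋏de', the coefficients add up to ½ for e⋏de' and -½ for de⋏e', the latter
being ½ e'⋏de. -/
theorem quadω_eq (a a' : V1 A η) : quadω A η a a' =
    ∑ i, (![1 / 6, -1 / 6, -1 / 6, -1 / 6] : Fin 4 → ℂ) i •
      (![quadETL A η, quadTRE A η, quadD A η, quadD A η] i) a a' := by
  change -((1 / 2 : ℂ) • -(curly rfl rfl a.1 (vd 1 2 rfl a'.1) +
      curly rfl rfl a'.1 (vd 1 2 rfl a.1))) = _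
  rw [Fin.sum_univ_four]
  change _ = (1 / 6 : ℂ) • quadETL A η a a' + (-1 / 6 : ℂ) • quadTRE A η a a' +
    (-1 / 6 : ℂ) • quadD A η a a' + (-1 / 6 : ℂ) • quadD A η a a'
  have c := curly_comm_two_one (A := A) rfl rfl rfl
  simp only [quadETL_apply, quadTRE_apply, quadD_apply, vd_curly rfl rfl rfl, c]
  module

/-- The six orderings in ℓ₃ are distributed without overlap: one each to the left and right torsion
terms, and two to either covariant derivative by `soTri_curly`. The arguments stay distinct, since
star deformation remembers their order. -/
theorem cubω_eq (a a' a'' : V1 A η) : cubω A η a a' a'' =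
    ∑ i, (![1 / 6, -1 / 6, -1 / 6, -1 / 6] : Fin 4 → ℂ) i •
      (![cubETL A η, cubTRE A η, cubDL A η, cubDR A η] i) a a' a'' := by
  change -((1 / 6 : ℂ) • -(curly rfl rfl a.1 (soTri (k := 1) (r := 2) rfl a'.2 a''.1) +
        curly rfl rfl a.1 (soTri (k := 1) (r := 2) rfl a''.2 a'.1) +
        curly rfl rfl a'.1 (soTri (k := 1) (r := 2) rfl a.2 a''.1) +
        curly rfl rfl a'.1 (soTri (k := 1) (r := 2) rfl a''.2 a.1) +
        curly rfl rfl a''.1 (soTri (k := 1) (r := 2) rfl a.2 a'.1) +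
        curly rfl rfl a''.1 (soTri (k := 1) (r := 2) rfl a'.2 a.1))) = _
  rw [Fin.sum_univ_four]
  change _ = (1 / 6 : ℂ) • cubETL A η a a' a'' + (-1 / 6 : ℂ) • cubTRE A η a a' a'' +
    (-1 / 6 : ℂ) • cubDL A η a a' a'' + (-1 / 6 : ℂ) • cubDR A η a a' a''
  have c := curly_comm_two_one (A := A) rfl rfl rfl
  have s := soTri_curly (A := A) (η := η) rfl rfl rfl
  simp only [cubETL_apply, cubTRE_apply, cubDL_apply, cubDR_apply, s, c]
  module

theorem quadE_eq (Λ : ℝ) (a a' : V1 A η) : quadE A η a a' =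
    ∑ i, (![1 / 3, 1 / 3, Λ, 1 / 6] : Fin 4 → ℂ) i •
      (![quadER A η, quadRE A η, 0, quadER A η + quadRE A η + 0] i) a a' := by
  change -((1 / 2 : ℂ) • -(curlySo rfl rfl a.1 (vd 1 2 rfl a'.2) +
      curlySo rfl rfl a'.1 (vd 1 2 rfl a.2))) = _
  rw [Fin.sum_univ_four]
  change _ = (1 / 3 : ℂ) • quadER A η a a' + (1 / 3 : ℂ) • quadRE A η a a' + (Λ : ℂ) • 0 +
    (1 / 6 : ℂ) • (quadER A η a a' + quadRE A η a a' + 0)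
  have c := soCurly_comm (A := A) (η := η) rfl rfl
  simp only [quadER_apply, quadRE_apply, c]
  module

/-- The three places of e among the arguments correspond to e⋏R, to R⋏e and to the braided term. The
½ inside the curvature turns the coefficient 1/3 into the 1/6 of ℓ₃. In degree two, where curvature
contributes dω without that ½, the last combination supplies the missing 1/6. -/
theorem cubE_eq (Λ : ℝ) (a a' a'' : V1 A η) : cubE A η Λ a a' a'' =
    ∑ i, (![1 / 3, 1 / 3, Λ, 1 / 6] : Fin 4 → ℂ) i •
      (![cubER A η, cubRE A η, cubEEE A η, 0 + 0 + cubEωω A η] i) a a' a'' := by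
  change -((1 / 6 : ℂ) • -(curlySo rfl rfl a.1 (soBr (r := 2) rfl a'.2 a''.2) +
        curlySo rfl rfl a'.1 (soBr (r := 2) rfl a.2 a''.2) +
        curlySo rfl rfl a''.1 (soBr (r := 2) rfl a.2 a'.2) +
        (6 * (Λ : ℂ)) • curly rfl rfl a.1 (curly (r := 2) (m := 2) rfl rfl a'.1 a''.1))) = _
  rw [Fin.sum_univ_four]
  change _ = (1 / 3 : ℂ) • cubER A η a a' a'' + (1 / 3 : ℂ) • cubRE A η a a' a'' +
    (Λ : ℂ) • cubEEE A η a a' a'' + (1 / 6 : ℂ) • (0 + 0 + cubEωω A η a a' a'')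
  have c := soCurly_comm (A := A) (η := η) rfl rfl
  simp only [cubER_apply, cubRE_apply, cubEEE_apply, cubEωω_apply, c]
  module

theorem deform_add_add_eq {X : Type*} [AddCommGroup X] [Module ℂ X]
    {b b' b'' : V1 A η →ₗ[ℂ] V1 A η →ₗ[ℂ] X}
    {t t' t'' : V1 A η →ₗ[ℂ] V1 A η →ₗ[ℂ] V1 A η →ₗ[ℂ] X} {S S' S'' : Expression A η X}
    (h : S = 𝓕.deform b t) (h' : S' = 𝓕.deform b' t') (h'' : S'' = 𝓕.deform b'' t'')
    {B : V1 A η →ₗ[ℂ] V1 A η →ₗ[ℂ] X} {T : V1 A η →ₗ[ℂ] V1 A η →ₗ[ℂ] V1 A η →ₗ[ℂ] X}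
    (hB : ∀ a a', B a a' = b a a' + b' a a' + b'' a a')
    (hT : ∀ a a' a'', T a a' a'' = t a a' a'' + t' a a' a'' + t'' a a' a'') :
    S + S' + S'' = 𝓕.deform B T := by
  have hB' : B = b + b' + b'' := LinearMap.ext₂ hB
  have hT' : T = t + t' + t'' := LinearMap.ext fun a => LinearMap.ext₂ (hT a)
  rw [h, h', h'', hB', hT']
  exact ((𝓕.deform_add (b + b') b'' (t + t') t'').trans
    (congrArg (· + 𝓕.deform b'' t'') (𝓕.deform_add b b' t t'))).symm

theorem exprSum_eq : 𝓕.exprEDω η + 𝓕.exprDωE η + 𝓕.exprEωω η =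
    𝓕.deform (quadER A η + quadRE A η + 0) (0 + 0 + cubEωω A η) :=
  𝓕.deform_add_add_eq 𝓕.exprEDω_eq 𝓕.exprDωE_eq 𝓕.exprEωω_eq (fun _ _ => rfl) fun _ _ _ => rfl

theorem smul_congr₄ {X : Type*} [AddCommGroup X] [Module ℂ X] {x₁ x₂ x₃ x₄ y₁ y₂ y₃ y₄ : X}
    (c₁ c₂ c₃ c₄ : ℂ) (h₁ : x₁ = y₁) (h₂ : x₂ = y₂) (h₃ : x₃ = y₃) (h₄ : x₄ = y₄) :
    c₁ • x₁ + c₂ • x₂ + c₃ • x₃ + c₄ • x₄ = c₁ • y₁ + c₂ • y₂ + c₃ • y₃ + c₄ • y₄ := by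
  rw [h₁, h₂, h₃, h₄]

theorem eval_add {X : Type*} [AddCommGroup X] [Module ℂ X] (S T : Expression A η X)
    (Φ : FPS (V1 A η)) : (S + T).eval Φ = S.eval Φ + T.eval Φ := add_add_add_comm _ _ _ _

theorem torsion_equation (Λ : ℝ) (e : FPS (VForm A 1 (Lam 1))) (ω : FPS (VForm A 1 (So η))) :
    𝓕.eqω Λ e ω = (1 / 6 : ℂ) • ((𝓕.cur) e (𝓕.torsionL e ω) - (𝓕.cur) (𝓕.torsionR e ω) e
        - 𝓕.covDL ω (𝓕.ee e e) - 𝓕.covDR ω (𝓕.ee e e)) := by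
  refine (𝓕.eval_exprω Λ e ω).symm.trans ?_
  rw [exprω_eq, 𝓕.eval_deform_sum _ _ _ quadω_eq cubω_eq, Fin.sum_univ_four]
  refine (smul_congr₄ _ _ _ _
    ((congrArg (Expression.eval · _) 𝓕.exprETL_eq.symm).trans (𝓕.eval_exprETL e ω))
    ((congrArg (Expression.eval · _) 𝓕.exprTRE_eq.symm).trans (𝓕.eval_exprTRE e ω))
    ((congrArg (Expression.eval · _) 𝓕.exprDL_eq.symm).trans (𝓕.eval_exprDL e ω))
    ((congrArg (Expression.eval · _) 𝓕.exprDR_eq.symm).trans (𝓕.eval_exprDR e ω))).trans ?_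
  simp only [Matrix.cons_val]
  module

theorem einstein_equation (Λ : ℝ) (e : FPS (VForm A 1 (Lam 1))) (ω : FPS (VForm A 1 (So η))) :
    𝓕.eqE Λ e ω = (1 / 6 : ℂ) • ((2 : ℂ) • (𝓕.curR) e (𝓕.curvature ω)
        + (2 : ℂ) • (𝓕.curL) (𝓕.curvature ω) e + (6 * Λ : ℂ) • (𝓕.cur) e (𝓕.ee e e)
        + ((𝓕.curR) e (D₁ ω) + (𝓕.curL) (D₁ ω) e + 𝓕.braidedTerm ω e ω)) := by
  refine (𝓕.eval_exprE Λ e ω).symm.trans ?_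
  rw [exprE_eq, 𝓕.eval_deform_sum _ _ _ (quadE_eq Λ) (cubE_eq Λ), Fin.sum_univ_four]
  have h := congrArg₂ (· + ·) (congrArg₂ (· + ·) (𝓕.eval_exprEDω e ω) (𝓕.eval_exprDωE e ω))
    (𝓕.eval_exprEωω e ω)
  refine (smul_congr₄ _ _ _ _
    ((congrArg (Expression.eval · _) 𝓕.exprER_eq.symm).trans (𝓕.eval_exprER e ω))
    ((congrArg (Expression.eval · _) 𝓕.exprRE_eq.symm).trans (𝓕.eval_exprRE e ω))
    ((congrArg (Expression.eval · _) 𝓕.exprEEE_eq.symm).trans (𝓕.eval_exprEEE e ω))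
    (((congrArg (Expression.eval · _) 𝓕.exprSum_eq.symm).trans (eval_add _ _ _)).trans
      ((congrArg (· + _) (eval_add _ _ _)).trans h))).trans ?_
  simp only [Matrix.cons_val]
  module

theorem isCovariant_exprETL : (𝓕.exprETL η).IsCovariant 𝓕 :=
  𝓕.exprETL_eq (η := η) ▸ isCovariant_deform 𝓕 isAdmissible_ETL fieldAnomaly_ETL

theorem isCovariant_exprTRE : (𝓕.exprTRE η).IsCovariant 𝓕 :=
  𝓕.exprTRE_eq (η := η) ▸ isCovariant_deform 𝓕 isAdmissible_TRE fieldAnomaly_TRE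

theorem isCovariant_exprDL : (𝓕.exprDL η).IsCovariant 𝓕 :=
  𝓕.exprDL_eq (η := η) ▸ isCovariant_deform 𝓕 isAdmissible_DL fieldAnomaly_DL

theorem isCovariant_exprDR : (𝓕.exprDR η).IsCovariant 𝓕 :=
  𝓕.exprDR_eq (η := η) ▸ isCovariant_deform 𝓕 isAdmissible_DR fieldAnomaly_DR

theorem isCovariant_exprER : (𝓕.exprER η).IsCovariant 𝓕 :=
  𝓕.exprER_eq (η := η) ▸ isCovariant_deform 𝓕 isAdmissible_ER fieldAnomaly_ER

theorem isCovariant_exprRE : (𝓕.exprRE η).IsCovariant 𝓕 :=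
  𝓕.exprRE_eq (η := η) ▸ isCovariant_deform 𝓕 isAdmissible_RE fieldAnomaly_RE

theorem isCovariant_exprEEE : (𝓕.exprEEE η).IsCovariant 𝓕 :=
  𝓕.exprEEE_eq (η := η) ▸ isCovariant_deform 𝓕 isAdmissible_EEE fieldAnomaly_EEE

theorem isCovariant_exprω (Λ : ℝ) : (𝓕.exprω η Λ).IsCovariant 𝓕 := by
  rw [exprω_eq]
  refine isCovariant_deform_sum 𝓕 _ _ _ quadω_eq cubω_eq (fun i => ?_) fun i => ?_
  · fin_cases i
    exacts [isAdmissible_ETL, isAdmissible_TRE, isAdmissible_DL, isAdmissible_DR]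
  · fin_cases i
    exacts [fieldAnomaly_ETL, fieldAnomaly_TRE, fieldAnomaly_DL, fieldAnomaly_DR]

theorem isCovariant_exprE (Λ : ℝ) : (𝓕.exprE η Λ).IsCovariant 𝓕 := by
  rw [exprE_eq]
  refine isCovariant_deform_sum 𝓕 _ _ _ (quadE_eq Λ) (cubE_eq Λ) (fun i => ?_) fun i => ?_
  · fin_cases i
    exacts [isAdmissible_ER, isAdmissible_RE, isAdmissible_EEE, isAdmissible_sum]
  · fin_cases i
    exacts [fieldAnomaly_ER, fieldAnomaly_RE, fieldAnomaly_EEE, fieldAnomaly_sum]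

theorem isCovariant_sum :
    Expression.IsCovariant 𝓕 (𝓕.exprEDω η + 𝓕.exprDωE η + 𝓕.exprEωω η) := by
  rw [exprSum_eq]
  exact isCovariant_deform 𝓕 isAdmissible_sum fieldAnomaly_sum

end DrinfeldTwist

end FieldEquations

/-! ### Trivial R-matrix and trivial twist. -/

section Classical

variable {A : Type*} [CommRing A] [Algebra ℂ A] {η : Fin 4 → ℤˣ}

attribute [local instance] tensorEnvModule

namespace DrinfeldTwist

variable (𝓕 : DrinfeldTwist A)

section Symmetric

variable {V W X Z : Type*} [AddCommGroup V] [Module ℂ V] [AddCommGroup W] [Module ℂ W]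
  [AddCommGroup X] [Module ℂ X] [AddCommGroup Z] [Module ℂ Z] [EnvModule A V] [EnvModule A W]
  [EnvModule A Z] {𝓕}

theorem star_flip_of_R_eq_one (h : 𝓕.R = 1) (B : V →ₗ[ℂ] W →ₗ[ℂ] X) (v : FPS V) (w : FPS W) :
    𝓕.star B.flip w v = 𝓕.star B v w := by
  rw [← braid_star, 𝓕.braid_of_R_eq_one h]; rfl

theorem star₃_flip_of_R_eq_one (h : 𝓕.R = 1) (T : V →ₗ[ℂ] W →ₗ[ℂ] Z →ₗ[ℂ] X) (u : FPS V)
    (v : FPS W) (w : FPS Z) : 𝓕.star₃ T.flip v u w = 𝓕.star₃ T u v w := by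
  let G : FPS V →ₗ[ℂ] FPS W →ₗ[ℂ] FPS X := LinearMap.mk₂ ℂ (fun u v => 𝓕.star₃ T u v w)
    (by intros; simp) (by intros; simp) (by intros; simp) (by intros; simp)
  rw [← 𝓕.braid_star₃_left (G := G) T w (fun _ _ => rfl), 𝓕.braid_of_R_eq_one h]
  rfl

theorem star₃_swapR_of_R_eq_one (h : 𝓕.R = 1) (T : V →ₗ[ℂ] W →ₗ[ℂ] Z →ₗ[ℂ] X) (u : FPS V)
    (v : FPS W) (w : FPS Z) : 𝓕.star₃ (swapR T) u w v = 𝓕.star₃ T u v w := by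
  rw [← braid_star₃_right, 𝓕.braid_of_R_eq_one h]; rfl

theorem star_diag_of_R_eq_one (h : 𝓕.R = 1) {b B : V →ₗ[ℂ] V →ₗ[ℂ] X}
    (hb : ∀ v w, b v w = (1 / 2 : ℂ) • (B v w + B w v)) (v : FPS V) :
    𝓕.star b v v = 𝓕.star B v v := by
  have e := 𝓕.star_sum ![1 / 2, 1 / 2] ![B, B.flip] (b := b)
    (fun v w => by
      rw [hb, Fin.sum_univ_two, smul_add]; rfl) v v
  rw [e, Fin.sum_univ_two]
  change (1 / 2 : ℂ) • 𝓕.star B v v + (1 / 2 : ℂ) • 𝓕.star B.flip v v = _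
  rw [star_flip_of_R_eq_one h]
  module

/-- When R = 1 permuting the arguments of T and the series together changes nothing. The
transpositions `swapR` and `flip` produce all six orderings, so on the diagonal the average is T
itself. -/
theorem star₃_diag_of_R_eq_one (h : 𝓕.R = 1) {t T : V →ₗ[ℂ] V →ₗ[ℂ] V →ₗ[ℂ] X}
    (ht : ∀ u v w, t u v w = (1 / 6 : ℂ) •
      (T u v w + T u w v + T v u w + T v w u + T w u v + T w v u)) (v : FPS V) :
    𝓕.star₃ t v v v = 𝓕.star₃ T v v v := by
  have e := 𝓕.star₃_sum ![1 / 6, 1 / 6, 1 / 6, 1 / 6, 1 / 6, 1 / 6]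
    ![T, swapR T, T.flip, swapR T.flip, (swapR T).flip, swapR (swapR T).flip] (t := t)
    (fun u v w => by
      rw [ht, Fin.sum_univ_six]
      change _ = (1 / 6 : ℂ) • T u v w + (1 / 6 : ℂ) • T u w v + (1 / 6 : ℂ) • T v u w +
        (1 / 6 : ℂ) • T w u v + (1 / 6 : ℂ) • T v w u + (1 / 6 : ℂ) • T w v u
      module) v v v
  rw [e, Fin.sum_univ_six]
  change (1 / 6 : ℂ) • 𝓕.star₃ T v v v + (1 / 6 : ℂ) • 𝓕.star₃ (swapR T) v v v +
    (1 / 6 : ℂ) • 𝓕.star₃ T.flip v v v + (1 / 6 : ℂ) • 𝓕.star₃ (swapR T.flip) v v v +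
    (1 / 6 : ℂ) • 𝓕.star₃ (swapR T).flip v v v +
    (1 / 6 : ℂ) • 𝓕.star₃ (swapR (swapR T).flip) v v v = _
  simp only [star₃_swapR_of_R_eq_one h, star₃_flip_of_R_eq_one h]
  module

end Symmetric

variable {𝓕}

theorem eval_deform_of_R_eq_one {X : Type*} [AddCommGroup X] [Module ℂ X] (h : 𝓕.R = 1)
    {b B : V1 A η →ₗ[ℂ] V1 A η →ₗ[ℂ] X} {t T : V1 A η →ₗ[ℂ] V1 A η →ₗ[ℂ] V1 A η →ₗ[ℂ] X}
    (hb : ∀ a a', b a a' = (1 / 2 : ℂ) • (B a a' + B a' a))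
    (ht : ∀ a a' a'', t a a' a'' = (1 / 6 : ℂ) •
      (T a a' a'' + T a a'' a' + T a' a a'' + T a' a'' a + T a'' a a' + T a'' a' a))
    (Φ : FPS (V1 A η)) : (𝓕.deform b t).eval Φ = (𝓕.deform B T).eval Φ :=
  congrArg₂ (· + ·) (star_diag_of_R_eq_one h hb Φ) (star₃_diag_of_R_eq_one h ht Φ)

theorem torsionL_eq_torsionR (h : 𝓕.R = 1) (e : FPS (VForm A 1 (Lam 1)))
    (ω : FPS (VForm A 1 (So η))) : 𝓕.torsionL e ω = 𝓕.torsionR e ω := by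
  rw [torsionL, torsionR, 𝓕.braid_of_R_eq_one h]; rfl

theorem eqω_of_R_eq_one (h : 𝓕.R = 1) (Λ : ℝ) (e : FPS (VForm A 1 (Lam 1)))
    (ω : FPS (VForm A 1 (So η))) : 𝓕.eqω Λ e ω = (𝓕.cur) e (𝓕.torsionL e ω) := by
  refine (𝓕.eval_exprω Λ e ω).symm.trans ?_
  refine Eq.trans ?_ (𝓕.eval_exprETL e ω)
  rw [exprω_eq, exprETL_eq]
  refine eval_deform_of_R_eq_one h (fun a a' => ?_) (fun a a' a'' => ?_) _
  · change -((1 / 2 : ℂ) • -(curly rfl rfl a.1 (vd 1 2 rfl a'.1) +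
      curly rfl rfl a'.1 (vd 1 2 rfl a.1))) = _
    simp only [quadETL_apply]
    module
  · change -((1 / 6 : ℂ) • -(curly rfl rfl a.1 (soTri (k := 1) (r := 2) rfl a'.2 a''.1) +
        curly rfl rfl a.1 (soTri (k := 1) (r := 2) rfl a''.2 a'.1) +
        curly rfl rfl a'.1 (soTri (k := 1) (r := 2) rfl a.2 a''.1) +
        curly rfl rfl a'.1 (soTri (k := 1) (r := 2) rfl a''.2 a.1) +
        curly rfl rfl a''.1 (soTri (k := 1) (r := 2) rfl a.2 a'.1) +
        curly rfl rfl a''.1 (soTri (k := 1) (r := 2) rfl a'.2 a.1))) = _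
    simp only [cubETL_apply]
    module

/-- The cosmological part of ℓ₃ is already Λ e⋏e⋏e up to the factor -6 and is split off, so that
only the part with Λ = 0 has to be symmetrized. -/
theorem quadE_eq_two (Λ : ℝ) (a a' : V1 A η) : quadE A η a a' =
    ∑ i, (![1, Λ] : Fin 2 → ℂ) i • (![quadE A η, 0] i) a a' := by
  rw [Fin.sum_univ_two]
  change _ = (1 : ℂ) • quadE A η a a' + (Λ : ℂ) • 0
  module

theorem cubE_eq_two (Λ : ℝ) (a a' a'' : V1 A η) : cubE A η Λ a a' a'' =
    ∑ i, (![1, Λ] : Fin 2 → ℂ) i • (![cubE A η 0, cubEEE A η] i) a a' a'' := by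
  rw [Fin.sum_univ_two]
  change -((1 / 6 : ℂ) • -(curlySo rfl rfl a.1 (soBr (r := 2) rfl a'.2 a''.2) +
        curlySo rfl rfl a'.1 (soBr (r := 2) rfl a.2 a''.2) +
        curlySo rfl rfl a''.1 (soBr (r := 2) rfl a.2 a'.2) +
        (6 * (Λ : ℂ)) • curly rfl rfl a.1 (curly (r := 2) (m := 2) rfl rfl a'.1 a''.1))) =
    (1 : ℂ) • -((1 / 6 : ℂ) • -(curlySo rfl rfl a.1 (soBr (r := 2) rfl a'.2 a''.2) +
        curlySo rfl rfl a'.1 (soBr (r := 2) rfl a.2 a''.2) +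
        curlySo rfl rfl a''.1 (soBr (r := 2) rfl a.2 a'.2) +
        (6 * ((0 : ℝ) : ℂ)) • curly rfl rfl a.1 (curly (r := 2) (m := 2) rfl rfl a'.1 a''.1))) +
    (Λ : ℂ) • cubEEE A η a a' a''
  simp only [cubEEE_apply, Complex.ofReal_zero]
  module

theorem symmetrize_smul {E Ω Y X : Type*} [AddCommGroup E] [Module ℂ E] [AddCommGroup Ω]
    [Module ℂ Ω] [AddCommGroup Y] [Module ℂ Y] [AddCommGroup X] [Module ℂ X]
    (C : E →ₗ[ℂ] Y →ₗ[ℂ] X) (S : Ω →ₗ[ℂ] Ω →ₗ[ℂ] Y) (hS : ∀ x y, S x y = S y x) (e e' e'' : E)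
    (x x' x'' : Ω) (z : X) :
    -((1 / 6 : ℂ) • -(C e (S x' x'') + C e' (S x x'') + C e'' (S x x') + (6 * (0 : ℂ)) • z)) =
      (1 / 6 : ℂ) • ((1 / 2 : ℂ) • C e (S x' x'') + (1 / 2 : ℂ) • C e (S x'' x') +
        (1 / 2 : ℂ) • C e' (S x x'') + (1 / 2 : ℂ) • C e' (S x'' x) +
        (1 / 2 : ℂ) • C e'' (S x x') + (1 / 2 : ℂ) • C e'' (S x' x)) := by
  rw [hS x'' x', hS x'' x, hS x' x]
  module

theorem eqE_of_R_eq_one (h : 𝓕.R = 1) (Λ : ℝ) (e : FPS (VForm A 1 (Lam 1)))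
    (ω : FPS (VForm A 1 (So η))) :
    𝓕.eqE Λ e ω = (𝓕.curR) e (𝓕.curvature ω) + (Λ : ℂ) • (𝓕.cur) e (𝓕.ee e e) := by
  refine (𝓕.eval_exprE Λ e ω).symm.trans ?_
  rw [exprE_eq, 𝓕.eval_deform_sum _ _ _ (quadE_eq_two Λ) (cubE_eq_two Λ), Fin.sum_univ_two]
  change (1 : ℂ) • (𝓕.deform (quadE A η) (cubE A η 0)).eval _ +
    (Λ : ℂ) • (𝓕.deform 0 (cubEEE A η)).eval _ = _
  rw [one_smul]
  refine congrArg₂ (· + ·) (Eq.trans ?_ (𝓕.eval_exprER e ω)) (congrArg ((Λ : ℂ) • ·)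
    ((congrArg (Expression.eval · _) 𝓕.exprEEE_eq.symm).trans (𝓕.eval_exprEEE e ω)))
  rw [exprER_eq]
  refine eval_deform_of_R_eq_one h (fun a a' => ?_) (fun a a' a'' => ?_) _
  · change -((1 / 2 : ℂ) • -(curlySo rfl rfl a.1 (vd 1 2 rfl a'.2) +
      curlySo rfl rfl a'.1 (vd 1 2 rfl a.2))) = _
    simp only [quadER_apply]
    module
  · change -((1 / 6 : ℂ) • -(curlySo rfl rfl a.1 (soBr (r := 2) rfl a'.2 a''.2) +
        curlySo rfl rfl a'.1 (soBr (r := 2) rfl a.2 a''.2) +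
        curlySo rfl rfl a''.1 (soBr (r := 2) rfl a.2 a'.2) +
        (6 * ((0 : ℝ) : ℂ)) • curly rfl rfl a.1 (curly (r := 2) (m := 2) rfl rfl a'.1 a''.1))) = _
    simp only [cubER_apply, Complex.ofReal_zero]
    exact symmetrize_smul (curlySo (A := A) (η := η) (p := 1) (q := 2) (r := 3) (k := 1) (m := 3)
      rfl rfl) (soBr (A := A) (η := η) (p := 1) (q := 1) (r := 2) rfl) (soBr_comm rfl) a.1 a'.1
      a''.1 a.2 a'.2 a''.2 _

section TrivialTwist

variable {V W X : Type*} [AddCommGroup V] [Module ℂ V] [AddCommGroup W] [Module ℂ W]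
  [AddCommGroup X] [Module ℂ X] [EnvModule A V] [EnvModule A W]

theorem R_eq_one_of_F_eq_one (h : 𝓕.F = 1) : 𝓕.R = 1 := by
  rw [R, h, inv_one, Units.val_one, map_one, mul_one]

theorem map_const (f : V →ₗ[ℂ] W) (v : V) : FPS.map f (FPS.const v) = FPS.const (f v) :=
  funext fun n => by
    rcases n with _ | n
    · rfl
    · exact map_zero f

theorem const_add {V : Type*} [AddCommGroup V] (v w : V) : FPS.const v + FPS.const w = FPS.const (v + w) :=
  (Pi.single_add (f := fun _ : ℕ => V) 0 v w).symm

theorem const_smul (c : ℂ) (v : V) : c • FPS.const v = FPS.const (c • v) :=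
  (Pi.single_smul (f := fun _ : ℕ => V) 0 c v).symm

theorem star_const_of_F_eq_one (h : 𝓕.F = 1) (B : V →ₗ[ℂ] W →ₗ[ℂ] X) (v : V) (w : W) :
    𝓕.star B (FPS.const v) (FPS.const w) = FPS.const (B v w) := by
  rw [star_eq_twistBy, h, inv_one, Units.val_one, twistBy_one]
  funext n
  change ∑ ij ∈ Finset.HasAntidiagonal.antidiagonal n,
    B (FPS.const v ij.1) (FPS.const w ij.2) = _
  rcases n with _ | n
  · simp [FPS.const]
  · refine Finset.sum_eq_zero fun ij hij => ?_
    have hij : ij.1 + ij.2 = n + 1 := Finset.HasAntidiagonal.mem_antidiagonal.1 hij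
    rcases Nat.eq_zero_or_pos ij.1 with h1 | h1
    · have h2 : ij.2 ≠ 0 := by omega
      rw [FPS.const, FPS.const, Pi.single_eq_of_ne h2, map_zero]
    · rw [FPS.const, Pi.single_eq_of_ne h1.ne', map_zero, LinearMap.zero_apply]

end TrivialTwist

theorem eqω_of_F_eq_one (h : 𝓕.F = 1) (Λ : ℝ) (e : VForm A 1 (Lam 1)) (ω : VForm A 1 (So η)) :
    𝓕.eqω Λ (FPS.const e) (FPS.const ω) = FPS.const ((curly) e (d₁ e + (soTri) ω e)) := by
  rw [eqω_of_R_eq_one (R_eq_one_of_F_eq_one h)]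
  have h₁ : 𝓕.torsionL (FPS.const e) (FPS.const ω) = FPS.const (d₁ e + (soTri) ω e) :=
    (congrArg₂ (· + ·) (map_const d₁ e) (star_const_of_F_eq_one h _ ω e)).trans (const_add _ _)
  rw [h₁]
  exact star_const_of_F_eq_one h _ e _

theorem eqE_of_F_eq_one (h : 𝓕.F = 1) (Λ : ℝ) (e : VForm A 1 (Lam 1)) (ω : VForm A 1 (So η)) :
    𝓕.eqE Λ (FPS.const e) (FPS.const ω) =
      FPS.const ((curlySo) e (d₁ ω + (1 / 2 : ℂ) • (soBr) ω ω) +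
        (Λ : ℂ) • (curly) e ((curly) e e : VForm A 2 (Lam 2))) := by
  rw [eqE_of_R_eq_one (R_eq_one_of_F_eq_one h)]
  have h₁ : 𝓕.curvature (FPS.const ω) = FPS.const (d₁ ω + (1 / 2 : ℂ) • (soBr) ω ω) :=
    (congrArg₂ (· + ·) (map_const d₁ ω) ((congrArg ((1 / 2 : ℂ) • ·)
      (star_const_of_F_eq_one h _ ω ω)).trans (const_smul _ _))).trans (const_add _ _)
  have h₂ : 𝓕.ee (FPS.const e) (FPS.const e) = FPS.const ((curly) e e : VForm A 2 (Lam 2)) :=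
    star_const_of_F_eq_one h _ e e
  rw [h₁, h₂]
  exact (congrArg₂ (· + ·) (star_const_of_F_eq_one h _ e _) ((congrArg ((Λ : ℂ) • ·)
      (star_const_of_F_eq_one h _ e _)).trans (const_smul _ _))).trans (const_add _ _)

end DrinfeldTwist

end Classical

/-! ### Algebraic differential operators; invertible ones over reduced algebras. -/

section DifferentialOperators

variable {C : Type*} [CommRing C] [Algebra ℂ C]

/-- The commutator of a linear operator with multiplication by a function. -/
def adMul (b : C) : Module.End ℂ (Module.End ℂ C) :=
  LinearMap.mulRight ℂ (LinearMap.mulLeft ℂ b) - LinearMap.mulLeft ℂ (LinearMap.mulLeft ℂ b)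

theorem adMul_apply (b : C) (D : Module.End ℂ C) :
    adMul b D = D * LinearMap.mulLeft ℂ b - LinearMap.mulLeft ℂ b * D := rfl

theorem adMul_apply_apply (b : C) (D : Module.End ℂ C) (x : C) :
    adMul b D x = D (b * x) - b * D x := rfl

theorem adMul_mul (b : C) (D E : Module.End ℂ C) :
    adMul b (D * E) = adMul b D * E + D * adMul b E := by
  simp only [adMul_apply]
  noncomm_ring

theorem adMul_add (b c : C) : adMul (b + c) = adMul b + adMul c := by
  ext D x
  simp only [adMul_apply_apply, LinearMap.add_apply, add_mul, map_add]
  ring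

theorem adMul_smul (t : ℂ) (b : C) : adMul (t • b) = t • adMul b := by
  ext D x
  simp only [adMul_apply_apply, LinearMap.smul_apply, smul_mul_assoc, map_smul, smul_sub]

theorem adMul_commute (b c : C) : Commute (adMul b) (adMul c) := by
  ext D x
  simp only [Module.End.mul_apply, adMul_apply_apply, mul_left_comm b c]
  ring

theorem adMul_mulLeft (b s : C) : adMul b (LinearMap.mulLeft ℂ s) = 0 := by
  ext x
  simp only [adMul_apply_apply, LinearMap.mulLeft_apply, LinearMap.zero_apply]
  ring

/-- Differential operators of order less than `n`. -/
def IsDiffOp : ℕ → Module.End ℂ C → Prop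
  | 0, D => D = 0
  | n + 1, D => ∀ b : C, IsDiffOp n (adMul b D)

theorem isDiffOp_zero (n : ℕ) : IsDiffOp n (0 : Module.End ℂ C) := by
  induction n with
  | zero => rfl
  | succ n ih => intro b; rwa [map_zero]

theorem IsDiffOp.succ {n : ℕ} {D : Module.End ℂ C} (h : IsDiffOp n D) : IsDiffOp (n + 1) D := by
  induction n generalizing D with
  | zero => obtain rfl : D = 0 := h; exact isDiffOp_zero _
  | succ n ih => exact fun b => ih (h b)

theorem IsDiffOp.mono {m n : ℕ} (hmn : m ≤ n) {D : Module.End ℂ C} (h : IsDiffOp m D) :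
    IsDiffOp n D := by
  induction hmn with
  | refl => exact h
  | step _ ih => exact ih.succ

theorem IsDiffOp.add {n : ℕ} {D E : Module.End ℂ C} (h : IsDiffOp n D) (h' : IsDiffOp n E) :
    IsDiffOp n (D + E) := by
  induction n generalizing D E with
  | zero => obtain rfl : D = 0 := h; rwa [zero_add]
  | succ n ih => intro b; rw [map_add]; exact ih (h b) (h' b)

/-- Commutation with a function is a derivation of the operator algebra. The bound m + n is crude;
only its existence matters. -/
theorem IsDiffOp.mul {m n : ℕ} {D E : Module.End ℂ C} (h : IsDiffOp m D) (h' : IsDiffOp n E) :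
    IsDiffOp (m + n) (D * E) := by
  induction m generalizing n D E with
  | zero => obtain rfl : D = 0 := h; rw [zero_mul]; exact isDiffOp_zero _
  | succ m ih =>
    induction n generalizing E with
    | zero => obtain rfl : E = 0 := h'; rw [mul_zero]; exact isDiffOp_zero _
    | succ n ih' =>
      intro b
      rw [adMul_mul]
      refine IsDiffOp.add ?_ (ih' (h' b))
      exact (ih (h b) h').mono (by change m + (n + 1) ≤ m + 1 + n; omega)

theorem isDiffOp_mulLeft (s : C) : IsDiffOp 1 (LinearMap.mulLeft ℂ s) :=
  fun b => adMul_mulLeft b s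

theorem isDiffOp_of_leibniz {D : Module.End ℂ C} (h : ∀ x y, D (x * y) = x * D y + y * D x) :
    IsDiffOp 2 D := by
  intro b
  have : adMul b D = LinearMap.mulLeft ℂ (D b) := by
    ext x
    rw [adMul_apply_apply, h, LinearMap.mulLeft_apply]
    ring
  rw [this]
  exact isDiffOp_mulLeft _

variable (C) in
/-- The algebra of differential operators. -/
def diffOps : Subalgebra ℂ (Module.End ℂ C) where
  carrier := {D | ∃ n, IsDiffOp n D}
  mul_mem' := fun ⟨_, h⟩ ⟨_, h'⟩ => ⟨_, h.mul h'⟩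
  add_mem' := fun ⟨m, h⟩ ⟨n, h'⟩ =>
    ⟨m + n, (h.mono (Nat.le_add_right _ _)).add (h'.mono (Nat.le_add_left _ _))⟩
  algebraMap_mem' c := ⟨1, by
    have : algebraMap ℂ (Module.End ℂ C) c = LinearMap.mulLeft ℂ (algebraMap ℂ C c) := by
      ext x
      rw [Module.algebraMap_end_apply, LinearMap.mulLeft_apply, Algebra.smul_def]
    rw [this]
    exact isDiffOp_mulLeft _⟩

/-- After applying a linear functional this is a polynomial over an infinite field with all values
zero. -/
theorem eq_zero_of_forall_sum_pow_smul_eq_zero {V : Type*} [AddCommGroup V] [Module ℂ V] {n : ℕ}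
    {v : ℕ → V} (h : ∀ t : ℂ, ∑ k ∈ Finset.range n, t ^ k • v k = 0) {k : ℕ} (hk : k < n) :
    v k = 0 := by
  rw [← Module.forall_dual_apply_eq_zero_iff ℂ]
  intro f
  let p : Polynomial ℂ := ∑ k ∈ Finset.range n, Polynomial.monomial k (f (v k))
  have hp : p = 0 := Polynomial.funext fun t => by
    have := congrArg f (h t)
    rw [map_sum, map_zero] at this
    rw [Polynomial.eval_zero, ← this, Polynomial.eval_finsetSum]
    refine Finset.sum_congr rfl fun k _ => ?_
    rw [Polynomial.eval_monomial, map_smul, smul_eq_mul, mul_comm]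
  have := congrArg (Polynomial.coeff · k) hp
  simpa [p, Polynomial.finsetSum_coeff, Polynomial.coeff_monomial, hk] using this

/-- Polarization: the commuting operators `adMul b` depend linearly on b, so iterated commutators
with different functions are recovered from those with a single one. -/
theorem isDiffOp_of_adMul_pow_eq_zero {n : ℕ} {D : Module.End ℂ C}
    (h : ∀ b : C, (adMul b ^ n) D = 0) : IsDiffOp n D := by
  induction n generalizing D with
  | zero => exact h 0
  | succ n ih =>
    intro c
    refine ih fun b => ?_
    have key : ∀ t : ℂ, ∑ k ∈ Finset.range (n + 1 + 1),
        t ^ k • (((n + 1).choose k : ℂ) • (adMul c ^ k * adMul b ^ (n + 1 - k)) D) = 0 := by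
      intro t
      have e := h (t • c + b)
      rw [adMul_add, adMul_smul, ((adMul_commute c b).smul_left t).add_pow,
        LinearMap.sum_apply] at e
      rw [← e]
      refine Finset.sum_congr rfl fun k _ => ?_
      rw [smul_pow, smul_mul_assoc, smul_mul_assoc, LinearMap.smul_apply, ← nsmul_eq_mul',
        LinearMap.smul_apply, Nat.cast_smul_eq_nsmul]
    -- The coefficient of t is (n+1) times one commutator with c and n with b; hence the commutator
    -- of D with c satisfies the hypothesis for n.
    have e := eq_zero_of_forall_sum_pow_smul_eq_zero key (k := 1) (by omega)
    rw [Nat.choose_one_right, smul_eq_zero, pow_one, Nat.add_sub_cancel] at e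
    rcases e with e | e
    · exact absurd e (Nat.cast_ne_zero.2 (Nat.succ_ne_zero n))
    · rwa [((adMul_commute c b).pow_right n).eq] at e

theorem IsDiffOp.adMul_pow {n : ℕ} {D : Module.End ℂ C} (b : C) {k : ℕ} (h : IsDiffOp (n + k) D) :
    IsDiffOp n ((adMul b ^ k) D) := by
  induction k generalizing D with
  | zero => exact h
  | succ k ih => rw [pow_succ]; exact ih (h b)

/-- On the tensor D ⊗ E the derivation acts as a sum of two commuting operators, and the binomial
theorem applies. -/
theorem adMul_pow_mul (b : C) (n : ℕ) (D E : Module.End ℂ C) :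
    (adMul b ^ n) (D * E) = ∑ ij ∈ Finset.HasAntidiagonal.antidiagonal n,
      (n.choose ij.1) • ((adMul b ^ ij.1) D * (adMul b ^ ij.2) E) := by
  let T := LinearMap.mul' ℂ (Module.End ℂ C)
  let l : Module.End ℂ (Module.End ℂ C ⊗[ℂ] Module.End ℂ C) := (adMul b).rTensor _
  let r : Module.End ℂ (Module.End ℂ C ⊗[ℂ] Module.End ℂ C) := (adMul b).lTensor _
  have hT : ∀ x, adMul b (T x) = T ((l + r) x) := by
    intro x
    induction x with
    | zero => simp
    | add x y hx hy => simp only [map_add, hx, hy]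
    | tmul D E => exact adMul_mul b D E
  have hT' : ∀ n x, (adMul b ^ n) (T x) = T (((l + r) ^ n) x) := by
    intro n
    induction n with
    | zero => exact fun x => rfl
    | succ n ih =>
      intro x
      rw [pow_succ, pow_succ, Module.End.mul_apply, Module.End.mul_apply, hT, ih]
  have hl : ∀ k (D E : Module.End ℂ C), (l ^ k) (D ⊗ₜ E) = (adMul b ^ k) D ⊗ₜ E := by
    intro k
    induction k with
    | zero => exact fun D E => rfl
    | succ k ih => exact fun D E => by rw [pow_succ, pow_succ]; exact ih _ _
  have hr : ∀ k (D E : Module.End ℂ C), (r ^ k) (D ⊗ₜ E) = D ⊗ₜ (adMul b ^ k) E := by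
    intro k
    induction k with
    | zero => exact fun D E => rfl
    | succ k ih => exact fun D E => by rw [pow_succ, pow_succ]; exact ih _ _
  have hc : Commute l r := TensorProduct.ext' fun D E => rfl
  have := hT' n (D ⊗ₜ E)
  rw [hc.add_pow', LinearMap.sum_apply, map_sum] at this
  refine this.trans (Finset.sum_congr rfl fun ij _ => ?_)
  rw [LinearMap.smul_apply, map_nsmul, Module.End.mul_apply, hr, hl]
  rfl

/-- Multiplication by high powers of a function can be moved to the right of a differential
operator. -/
theorem IsDiffOp.exists_mulLeft_pow_mul {n : ℕ} {D : Module.End ℂ C} (h : IsDiffOp n D) (s : C)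
    (i : ℕ) : ∃ N, ∃ D' : Module.End ℂ C,
      LinearMap.mulLeft ℂ s ^ N * D = D' * LinearMap.mulLeft ℂ s ^ i := by
  induction n generalizing D i with
  | zero => obtain rfl : D = 0 := h; exact ⟨0, 0, by simp⟩
  | succ n ih =>
    induction i with
    | zero => exact ⟨0, D, by simp⟩
    | succ i ih' =>
      obtain ⟨N₁, D₁, h₁⟩ := ih'
      obtain ⟨N₂, D₂, h₂⟩ := ih (h s) (i + 1)
      have e : LinearMap.mulLeft ℂ s * D = D * LinearMap.mulLeft ℂ s - adMul s D := by
        rw [adMul_apply]; abel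
      refine ⟨N₁ + N₂ + 1, LinearMap.mulLeft ℂ s ^ N₂ * D₁ - LinearMap.mulLeft ℂ s ^ N₁ * D₂, ?_⟩
      rw [pow_succ, mul_assoc, e, mul_sub, sub_mul]
      congr 1
      · rw [add_comm N₁, pow_add, mul_assoc, ← mul_assoc _ D, h₁, pow_succ]
        simp only [mul_assoc]
      · rw [pow_add, mul_assoc, h₂, mul_assoc]

theorem IsDiffOp.eq_mulLeft {D : Module.End ℂ C} (h : IsDiffOp 1 D) :
    D = LinearMap.mulLeft ℂ (D 1) := by
  ext x
  have : adMul x D 1 = 0 := LinearMap.congr_fun (h x) 1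
  rw [adMul_apply_apply, mul_one, sub_eq_zero] at this
  rw [this, LinearMap.mulLeft_apply, mul_comm]

theorem IsDiffOp.adMul_pow_eq_zero {n : ℕ} {D : Module.End ℂ C} (h : IsDiffOp n D) (b : C) {k : ℕ}
    (hk : n ≤ k) : (adMul b ^ k) D = 0 :=
  IsDiffOp.adMul_pow (n := 0) b (h.mono (by rwa [zero_add]))

theorem adMul_one (b : C) : adMul b (1 : Module.End ℂ C) = 0 := by
  rw [adMul_apply, one_mul, mul_one, sub_self]

/-- If a differential operator is invertible, then its symbols are nilpotent. -/
theorem exists_mulLeft_pow_eq_zero {D E : Module.End ℂ C} {m n : ℕ} (hD : IsDiffOp (n + 2) D)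
    (hE : IsDiffOp m E) (h : D * E = 1) (h' : E * D = 1) {b s : C}
    (hs : (adMul b ^ (n + 1)) D = LinearMap.mulLeft ℂ s) :
    ∃ N, LinearMap.mulLeft ℂ s ^ N = 0 := by
  set L := LinearMap.mulLeft ℂ s
  -- Descending induction on l, written with i = m - l: some power of s kills the l-fold commutator
  -- of E. For l ≥ m the commutator is zero already. At l = 0 a power of s kills E, hence also ED =
  -- 1.
  suffices hi : ∀ i, ∃ N, ∀ l, m ≤ l + i → L ^ N * (adMul b ^ l) E = 0 by
    obtain ⟨N, hN⟩ := hi m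
    have := hN 0 (by omega)
    rw [pow_zero, Module.End.one_apply] at this
    exact ⟨N, by rw [← mul_one (L ^ N), ← h', ← mul_assoc, this, zero_mul]⟩
  intro i
  induction i with
  | zero => exact ⟨0, fun l hl => by rw [hE.adMul_pow_eq_zero b (k := l) hl, mul_zero]⟩
  | succ i ih =>
    obtain ⟨N, hN⟩ := ih
    have hm : ∀ a, ∃ K, ∃ D', L ^ K * (adMul b ^ a) D = D' * L ^ N := fun a =>
      (IsDiffOp.adMul_pow b (hD.mono (Nat.le_add_right _ a))).exists_mulLeft_pow_mul s N
    choose K D' hK using hm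
    let M := ∑ a ∈ Finset.range (n + 1), K a
    refine ⟨M + 1, fun l hl => ?_⟩
    -- Commutators of DE = 1 vanish. In the Leibniz expansion the term (n+1, l) is a multiple of s
    -- times the wanted commutator. Terms with more commutators on D vanish by its order. Terms with
    -- fewer have more than l on E and die once a power of s is moved past D.
    have e : (adMul b ^ (n + 1 + l)) (D * E) = 0 := by
      rw [h, Nat.add_right_comm, pow_succ, Module.End.mul_apply, adMul_one, map_zero]
    rw [adMul_pow_mul] at e
    have e' := congrArg (L ^ M * ·) e
    simp only [mul_zero, Finset.mul_sum] at e'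
    rw [Finset.sum_eq_single_of_mem (n + 1, l) (Finset.HasAntidiagonal.mem_antidiagonal.2 rfl)] at e'
    · rw [mul_smul_comm, hs, ← mul_assoc, ← pow_succ, ← Nat.cast_smul_eq_nsmul ℂ,
        smul_eq_zero] at e'
      exact e'.resolve_left (Nat.cast_ne_zero.2 (Nat.choose_pos (Nat.le_add_right _ _)).ne')
    · rintro ⟨a, c⟩ hac hne
      have hac : a + c = n + 1 + l := Finset.HasAntidiagonal.mem_antidiagonal.1 hac
      rw [mul_smul_comm]
      rcases lt_trichotomy a (n + 1) with ha | ha | ha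
      · have hM : K a ≤ M := Finset.single_le_sum (fun _ _ => Nat.zero_le _) (Finset.mem_range.2 ha)
        rw [← Nat.sub_add_cancel hM, pow_add, mul_assoc, ← mul_assoc _ _ ((adMul b ^ c) E), hK,
          mul_assoc (D' a), hN c (by omega), mul_zero, mul_zero, smul_zero]
      · exact absurd (Prod.ext ha (by change c = l; omega)) hne
      · rw [hD.adMul_pow_eq_zero b (Nat.succ_le_of_lt ha), zero_mul, mul_zero, smul_zero]

variable (C) in
/-- The characters of an algebra separate its elements. -/
def HasPoints : Prop := ∀ x : C, (∀ φ : C →ₐ[ℂ] ℂ, φ x = 0) → x = 0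

theorem HasPoints.eq_zero_of_pow (hC : HasPoints C) {x : C} {n : ℕ} (h : x ^ n = 0) : x = 0 :=
  hC x fun φ => eq_zero_of_pow_eq_zero (n := n) (by rw [← map_pow, h, map_zero])

/-- Write x with coefficients in C along a basis of B. Under a character of C it becomes an element
of B killed by all characters, so every coefficient is killed by every character of C. -/
theorem HasPoints.tensor {B : Type*} [CommRing B] [Algebra ℂ B] (hC : HasPoints C)
    (hB : HasPoints B) : HasPoints (C ⊗[ℂ] B) := by
  classical
  intro x hx
  let ℬ := Module.Basis.ofVectorSpace ℂ B
  let f := TensorProduct.equivFinsuppOfBasisRight (M := C) ℬ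
  have hxf : x = (f x).sum fun k c => c ⊗ₜ ℬ k := by
    rw [← TensorProduct.equivFinsuppOfBasisRight_symm_apply]
    exact (f.symm_apply_apply x).symm
  have hf : f x = 0 := by
    ext k
    refine hC _ fun φ => ?_
    have hz : (f x).sum (fun k c => φ c • ℬ k) = 0 := by
      refine hB _ fun ψ => ?_
      have := hx ((Algebra.TensorProduct.lmul' ℂ).comp (Algebra.TensorProduct.map φ ψ))
      rw [hxf, Finsupp.sum, map_sum] at this
      rw [Finsupp.sum, map_sum, ← this]
      refine Finset.sum_congr rfl fun k _ => ?_
      simp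
    have := linearIndependent_iff.1 ℬ.linearIndependent
      ((f x).mapRange φ (map_zero φ)) (by
        rw [Finsupp.linearCombination_apply, Finsupp.sum_mapRange_index (fun k => zero_smul ℂ (ℬ k))]
        exact hz)
    exact DFunLike.congr_fun this k
  rwa [map_eq_zero_iff f f.injective] at hf

/-- Take the least order bound of D and suppose that it exceeds 1. The top symbols of D are
multiplications by nilpotent functions, and these are zero in a reduced algebra. By polarization the
order of D is then smaller, a contradiction. -/
theorem eq_mulLeft_of_mul_eq_one (hC : HasPoints C) {D E : Module.End ℂ C} (hD : D ∈ diffOps C)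
    (hE : E ∈ diffOps C) (h : D * E = 1) (h' : E * D = 1) : D = LinearMap.mulLeft ℂ (D 1) := by
  classical
  obtain ⟨m, hE⟩ := hE
  refine IsDiffOp.eq_mulLeft ((Nat.find_spec hD).mono ?_)
  by_contra hn
  obtain ⟨n, hn⟩ : ∃ n, Nat.find hD = n + 2 := ⟨Nat.find hD - 2, by omega⟩
  have hD' : IsDiffOp (n + 2) D := hn ▸ Nat.find_spec hD
  have hmin : ¬ IsDiffOp (n + 1) D := Nat.find_min hD (by omega)
  refine hmin (isDiffOp_of_adMul_pow_eq_zero fun b => ?_)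
  have hs := (IsDiffOp.adMul_pow (n := 1) (k := n + 1) b
    (hD'.mono (by omega))).eq_mulLeft
  obtain ⟨N, hN⟩ := exists_mulLeft_pow_eq_zero hD' hE h h' hs
  rw [LinearMap.pow_mulLeft] at hN
  have h0 := LinearMap.congr_fun hN 1
  rw [LinearMap.mulLeft_apply, mul_one, LinearMap.zero_apply] at h0
  rw [hs, hC.eq_zero_of_pow h0, LinearMap.mulLeft_zero_eq_zero]

end DifferentialOperators

/-! ### The leading coefficient of the twist acts trivially on functions. -/

section Functions

variable {A : Type*} [CommRing A] [Algebra ℂ A]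

attribute [local instance] tensorEnvModule

variable (A) in
/-- Vector fields act on functions. -/
abbrev funEnvModule : EnvModule A A :=
  ⟨UniversalEnvelopingAlgebra.lift ℂ
    { toFun := fun X => X.toLinearMap
      map_add' := fun _ _ => rfl
      map_smul' := fun _ _ => rfl
      map_lie' := Derivation.commutator_coe_linear_map }⟩

attribute [local instance] funEnvModule

theorem uact_fun (X : Vect A) (f : A) : uact A A (UniversalEnvelopingAlgebra.ι ℂ X) f = X f :=
  LinearMap.congr_fun (UniversalEnvelopingAlgebra.lift_ι_apply ℂ _ X) f

theorem uact_fun_mul (X : Vect A) (x y : A) : uact A A (UniversalEnvelopingAlgebra.ι ℂ X) (x * y) =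
    x * uact A A (UniversalEnvelopingAlgebra.ι ℂ X) y +
      y * uact A A (UniversalEnvelopingAlgebra.ι ℂ X) x := by
  simp only [uact_fun, Derivation.leibniz, smul_eq_mul]

theorem uact_fun_one (u : U A) : uact A A u 1 = counit A u • (1 : A) := by
  induction u using env_induction with
  | hι X => rw [uact_fun, counit_ι, zero_smul, Derivation.map_one_eq_zero]
  | hc c => simp [Algebra.algebraMap_eq_smul_one]
  | hadd a b ha hb => rw [map_add, LinearMap.add_apply, ha, hb, map_add, add_smul]
  | hmul a b ha hb =>
    rw [map_mul, Module.End.mul_apply, hb, map_smul, ha, map_mul, smul_smul, mul_comm]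

theorem leibniz_rTensor {B C : Type*} [CommRing B] [Algebra ℂ B] [CommRing C] [Algebra ℂ C]
    {D : Module.End ℂ B} (hD : ∀ x y, D (x * y) = x * D y + y * D x) (x y : B ⊗[ℂ] C) :
    TensorProduct.map D 1 (x * y) = x * TensorProduct.map D 1 y + y * TensorProduct.map D 1 x := by
  induction x with
  | zero => simp
  | add x x' hx hx' => simp only [map_add, add_mul, mul_add, hx, hx']; ring
  | tmul b c =>
    induction y with
    | zero => simp
    | add y y' hy hy' => simp only [map_add, add_mul, mul_add, hy, hy']; ring
    | tmul b' c' =>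
      simp only [Algebra.TensorProduct.tmul_mul_tmul, TensorProduct.map_tmul, Module.End.one_apply,
        hD, TensorProduct.add_tmul, mul_comm c' c]

theorem leibniz_lTensor {B C : Type*} [CommRing B] [Algebra ℂ B] [CommRing C] [Algebra ℂ C]
    {D : Module.End ℂ C} (hD : ∀ x y, D (x * y) = x * D y + y * D x) (x y : B ⊗[ℂ] C) :
    TensorProduct.map 1 D (x * y) = x * TensorProduct.map 1 D y + y * TensorProduct.map 1 D x := by
  induction x with
  | zero => simp
  | add x x' hx hx' => simp only [map_add, add_mul, mul_add, hx, hx']; ring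
  | tmul b c =>
    induction y with
    | zero => simp
    | add y y' hy hy' => simp only [map_add, add_mul, mul_add, hy, hy']; ring
    | tmul b' c' =>
      simp only [Algebra.TensorProduct.tmul_mul_tmul, TensorProduct.map_tmul, Module.End.one_apply,
        hD, TensorProduct.tmul_add, mul_comm b' b]

theorem mem_diffOps_of_leibniz {C : Type*} [CommRing C] [Algebra ℂ C]
    {ρ : U A →ₐ[ℂ] Module.End ℂ C} (h : ∀ (X : Vect A) (x y : C),
      ρ (UniversalEnvelopingAlgebra.ι ℂ X) (x * y) = x * ρ (UniversalEnvelopingAlgebra.ι ℂ X) y +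
        y * ρ (UniversalEnvelopingAlgebra.ι ℂ X) x) (u : U A) : ρ u ∈ diffOps C := by
  induction u using env_induction with
  | hι X => exact ⟨2, isDiffOp_of_leibniz (h X)⟩
  | hc c => rw [AlgHom.commutes]; exact Subalgebra.algebraMap_mem _ c
  | hadd a b ha hb => rw [map_add]; exact Subalgebra.add_mem _ ha hb
  | hmul a b ha hb => rw [map_mul]; exact Subalgebra.mul_mem _ ha hb

/-- The enveloping algebra acts by differential operators on functions of three variables. -/
theorem uact₃_mem_diffOps (T : U A ⊗[ℂ] (U A ⊗[ℂ] U A)) :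
    uact₃ A A A A T ∈ diffOps (A ⊗[ℂ] (A ⊗[ℂ] A)) := by
  have h₁ : ∀ u : U A, uact₃ A A A A (u ⊗ₜ 1) ∈ diffOps (A ⊗[ℂ] (A ⊗[ℂ] A)) :=
    mem_diffOps_of_leibniz (C := A ⊗[ℂ] (A ⊗[ℂ] A)) (ρ := (uact₃ A A A A).comp
      (Algebra.TensorProduct.includeLeft : U A →ₐ[ℂ] U A ⊗[ℂ] (U A ⊗[ℂ] U A)))
      fun X => by
        have : uact₃ A A A A (UniversalEnvelopingAlgebra.ι ℂ X ⊗ₜ 1) =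
            TensorProduct.map (uact A A (UniversalEnvelopingAlgebra.ι ℂ X)) 1 := by
          rw [tensorAct_tmul, map_one]
        exact this.symm ▸ leibniz_rTensor (uact_fun_mul X)
  have h₂ : ∀ u : U A, uact₃ A A A A (1 ⊗ₜ (u ⊗ₜ 1)) ∈ diffOps (A ⊗[ℂ] (A ⊗[ℂ] A)) :=
    mem_diffOps_of_leibniz (C := A ⊗[ℂ] (A ⊗[ℂ] A)) (ρ := ((uact₃ A A A A).comp Algebra.TensorProduct.includeRight).comp
      (Algebra.TensorProduct.includeLeft : U A →ₐ[ℂ] U A ⊗[ℂ] U A)) fun X => by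
        have : uact₃ A A A A (1 ⊗ₜ (UniversalEnvelopingAlgebra.ι ℂ X ⊗ₜ 1)) =
            TensorProduct.map 1
              (TensorProduct.map (uact A A (UniversalEnvelopingAlgebra.ι ℂ X)) 1) := by
          rw [tensorAct_tmul, tensorAct_tmul, map_one]
        exact this.symm ▸ leibniz_lTensor (leibniz_rTensor (uact_fun_mul X))
  have h₃ : ∀ u : U A, uact₃ A A A A (1 ⊗ₜ (1 ⊗ₜ u)) ∈ diffOps (A ⊗[ℂ] (A ⊗[ℂ] A)) :=
    mem_diffOps_of_leibniz (C := A ⊗[ℂ] (A ⊗[ℂ] A)) (ρ := ((uact₃ A A A A).comp Algebra.TensorProduct.includeRight).comp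
      Algebra.TensorProduct.includeRight) fun X => by
        have : uact₃ A A A A (1 ⊗ₜ (1 ⊗ₜ UniversalEnvelopingAlgebra.ι ℂ X)) =
            TensorProduct.map 1
              (TensorProduct.map 1 (uact A A (UniversalEnvelopingAlgebra.ι ℂ X))) := by
          rw [tensorAct_tmul, tensorAct_tmul, map_one]
        exact this.symm ▸ leibniz_lTensor (leibniz_lTensor (uact_fun_mul X))
  induction T with
  | zero => rw [map_zero]; exact Subalgebra.zero_mem _
  | add S T hS hT => rw [map_add]; exact Subalgebra.add_mem _ hS hT
  | tmul u T =>
    induction T with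
    | zero => rw [TensorProduct.tmul_zero, map_zero]; exact Subalgebra.zero_mem _
    | add S T hS hT =>
      rw [TensorProduct.tmul_add, map_add]; exact Subalgebra.add_mem _ hS hT
    | tmul v w =>
      -- The three slots act separately, and in each slot a vector field acts as a derivation of the
      -- triple tensor product.
      have : u ⊗ₜ[ℂ] (v ⊗ₜ[ℂ] w) = u ⊗ₜ 1 * (1 ⊗ₜ (v ⊗ₜ 1) * 1 ⊗ₜ (1 ⊗ₜ w)) := by
        simp only [Algebra.TensorProduct.tmul_mul_tmul, one_mul, mul_one]
      rw [this, map_mul, map_mul]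
      exact Subalgebra.mul_mem _ (h₁ u) (Subalgebra.mul_mem _ (h₂ v) (h₃ w))

variable (A) in
/-- The counit on two tensor factors. -/
def counit₂ : U A ⊗[ℂ] U A →ₐ[ℂ] ℂ :=
  (counit A).comp ((Algebra.TensorProduct.lid ℂ (U A)).toAlgHom.comp
    (Algebra.TensorProduct.map (counit A) (AlgHom.id ℂ (U A))))

theorem counit₂_tmul (u v : U A) : counit₂ A (u ⊗ₜ v) = counit A u * counit A v :=
  (map_smul (counit A) (counit A u) v)

theorem counit₂_coproduct (u : U A) : counit₂ A (coproduct A u) = counit A u := by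
  induction u using env_induction with
  | hι X =>
    rw [coproduct_ι, map_add, counit₂_tmul, counit₂_tmul, counit_ι, map_one, zero_mul, mul_zero,
      add_zero]
  | hc c => rw [AlgHom.commutes, AlgHom.commutes, AlgHom.commutes]
  | hadd a b ha hb => rw [map_add, map_add, ha, hb, map_add]
  | hmul a b ha hb => rw [map_mul, map_mul, ha, hb, map_mul]

variable (A) in
/-- The counit on three tensor factors. -/
def counit₃ : U A ⊗[ℂ] (U A ⊗[ℂ] U A) →ₐ[ℂ] ℂ :=
  (counit₂ A).comp ((Algebra.TensorProduct.lid ℂ (U A ⊗[ℂ] U A)).toAlgHom.comp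
    (Algebra.TensorProduct.map (counit A) (AlgHom.id ℂ (U A ⊗[ℂ] U A))))

theorem counit₃_tmul (u : U A) (T : U A ⊗[ℂ] U A) :
    counit₃ A (u ⊗ₜ T) = counit A u * counit₂ A T :=
  (map_smul (counit₂ A) (counit A u) T)

theorem uact₃_one (T : U A ⊗[ℂ] (U A ⊗[ℂ] U A)) :
    uact₃ A A A A T 1 = counit₃ A T • (1 : A ⊗[ℂ] (A ⊗[ℂ] A)) := by
  induction T with
  | zero => simp
  | add S T hS hT => rw [map_add, LinearMap.add_apply, hS, hT, map_add, add_smul]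
  | tmul u T =>
    induction T with
    | zero => simp
    | add S T hS hT =>
      rw [TensorProduct.tmul_add, map_add, LinearMap.add_apply, hS, hT, map_add, add_smul]
    | tmul v w =>
      change uact A A u 1 ⊗ₜ[ℂ] (uact A A v 1 ⊗ₜ[ℂ] uact A A w 1) = _
      rw [uact_fun_one, uact_fun_one, uact_fun_one, counit₃_tmul, counit₂_tmul,
        TensorProduct.tmul_smul, ← TensorProduct.smul_tmul', TensorProduct.tmul_smul,
        ← TensorProduct.smul_tmul', TensorProduct.tmul_smul, smul_smul, smul_smul]
      congr 1
      ring

namespace DrinfeldTwist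

variable (𝓕 : DrinfeldTwist A)

theorem map_counit₂_F : PowerSeries.map (counit₂ A).toRingHom (𝓕.F : PowerSeries _) = 1 := by
  have h := congrArg (PowerSeries.map (counit A).toRingHom) 𝓕.normalized_left
  rw [map_one] at h
  rw [← h, ← RingHom.comp_apply, ← PowerSeries.map_comp]
  rfl

/-- The counit is a homomorphism compatible with the coproduct, so it sends both factors 1 ⊗ F and
(id ⊗ Δ)F to (ε ⊗ ε)F, which the normalization makes 1. -/
theorem map_counit₃_F₃inv :
    PowerSeries.map (counit₃ A).toRingHom (𝓕.F₃inv : PowerSeries _) = 1 := by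
  have h₁ : PowerSeries.map (counit₃ A).toRingHom (PowerSeries.map
      (Algebra.TensorProduct.includeRight :
        U A ⊗[ℂ] U A →ₐ[ℂ] U A ⊗[ℂ] (U A ⊗[ℂ] U A)).toRingHom (𝓕.F : PowerSeries _)) = 1 := by
    rw [← 𝓕.map_counit₂_F, ← RingHom.comp_apply, ← PowerSeries.map_comp]
    congr 2
    refine RingHom.ext fun x => ?_
    change counit₃ A (1 ⊗ₜ x) = counit₂ A x
    rw [counit₃_tmul, map_one, one_mul]
  have h₂ : PowerSeries.map (counit₃ A).toRingHom (PowerSeries.map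
      (Algebra.TensorProduct.map (AlgHom.id ℂ (U A)) (coproduct A)).toRingHom
        (𝓕.F : PowerSeries _)) = 1 := by
    rw [← 𝓕.map_counit₂_F, ← RingHom.comp_apply, ← PowerSeries.map_comp]
    congr 2
    refine RingHom.ext fun x => ?_
    change counit₃ A (Algebra.TensorProduct.map (AlgHom.id ℂ (U A)) (coproduct A) x) = counit₂ A x
    induction x with
    | zero => simp
    | add x y hx hy => rw [map_add, map_add, hx, hy, map_add]
    | tmul u v =>
      rw [Algebra.TensorProduct.map_tmul, counit₃_tmul, counit₂_coproduct, counit₂_tmul]; rfl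
  have h := congrArg (PowerSeries.map (counit₃ A).toRingHom) (𝓕.F₃inv.mul_inv)
  rw [map_mul, map_one, F₃inv, inv_inv, Units.val_mul, map_mul] at h
  rw [← h]
  refine (mul_one _).symm.trans (congrArg _ ?_)
  exact ((congrArg₂ (· * ·) h₁ h₂).trans (one_mul 1)).symm

/-- The leading coefficient of a twist acts trivially on functions. -/
theorem uact₃_coeff_zero (hA : HasPoints A) (x : A ⊗[ℂ] (A ⊗[ℂ] A)) :
    uact₃ A A A A (PowerSeries.coeff 0 (𝓕.F₃inv : PowerSeries _)) x = x := by
  let P : (U A ⊗[ℂ] (U A ⊗[ℂ] U A))ˣ :=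
    Units.map (PowerSeries.constantCoeff (R := U A ⊗[ℂ] (U A ⊗[ℂ] U A))).toMonoidHom 𝓕.F₃inv
  have hP : (P : U A ⊗[ℂ] (U A ⊗[ℂ] U A)) = PowerSeries.coeff 0 (𝓕.F₃inv : PowerSeries _) :=
    (PowerSeries.coeff_zero_eq_constantCoeff_apply _).symm
  have h₁ : uact₃ A A A A P * uact₃ A A A A ↑P⁻¹ = 1 := by
    rw [← map_mul, P.mul_inv, map_one]
  have h₂ : uact₃ A A A A ↑P⁻¹ * uact₃ A A A A P = 1 := by
    rw [← map_mul, P.inv_mul, map_one]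
  -- A multiplication operator is determined by its value at 1, and on 1 the enveloping algebra acts
  -- through the counit.
  have h := eq_mulLeft_of_mul_eq_one (hA.tensor (hA.tensor hA)) (uact₃_mem_diffOps _)
    (uact₃_mem_diffOps _) h₁ h₂
  have hc : counit₃ A P = 1 := by
    have := congrArg (PowerSeries.coeff 0) 𝓕.map_counit₃_F₃inv
    rw [PowerSeries.coeff_map, ← hP, PowerSeries.coeff_zero_one] at this
    exact this
  rw [uact₃_one, hc, one_smul] at h
  rw [← hP, h, LinearMap.mulLeft_apply, one_mul]

/-- On constant series the coefficient of ħ⁰ sees only the leading coefficient of the inverse twist.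
The definition of a twist does not prescribe that coefficient, so its trivial action on functions is
what is needed. -/
theorem star₃_const_coeff_zero (hA : HasPoints A) {X : Type*} [AddCommGroup X] [Module ℂ X]
    (T : A →ₗ[ℂ] A →ₗ[ℂ] A →ₗ[ℂ] X) (a b c : A) :
    𝓕.star₃ T (FPS.const a) (FPS.const b) (FPS.const c) 0 = T a b c := by
  have h : (htmul (FPS.const a) (htmul (FPS.const b) (FPS.const c))) 0 = a ⊗ₜ[ℂ] (b ⊗ₜ[ℂ] c) := by
    simp [htmul, FPS.map₂, FPS.const]
  rw [star₃_eq_pact]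
  change lift₃ T (pact _ _ _ 0) = _
  rw [pact_apply, Finset.HasAntidiagonal.antidiagonal_zero, Finset.sum_singleton, h,
    uact₃_coeff_zero 𝓕 hA, lift₃_tmul]

end DrinfeldTwist

end Functions

/-! ### Two non-commuting rotations and a vector with a nonzero trivector. -/

section Nonvanishing

theorem mem_so {η : Fin 4 → ℤˣ} {S : Matrix (Fin 4) (Fin 4) ℂ} (hS : S.transpose = -S) :
    S * Matrix.diagonal (fun i => ((η i : ℤ) : ℂ)) ∈ So η := by
  rw [mem_skewAdjointMatricesLieSubalgebra, mem_skewAdjointMatricesSubmodule,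
    Matrix.IsSkewAdjoint, Matrix.IsAdjointPair, Matrix.transpose_mul, Matrix.diagonal_transpose, hS]
  noncomm_ring

/-- The determinant of the components along `E₀`, `E₂`, `E₃` of a trivector. -/
def detLam : Lam 3 →ₗ[ℂ] ℂ :=
  exteriorPower.alternatingMapLinearEquiv
    ((Matrix.detRowAlternating (R := ℂ) (n := Fin 3)).compLinearMap
      (LinearMap.funLeft ℂ ℂ (![0, 2, 3] : Fin 3 → Fin 4)))

theorem detLam_ιMulti (v : Fin 3 → Fin 4 → ℂ) : detLam (exteriorPower.ιMulti ℂ 3 v) =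
    (Matrix.of fun i j => v i ((![0, 2, 3] : Fin 3 → Fin 4) j)).det :=
  exteriorPower.alternatingMapLinearEquiv_apply_ιMulti _ _

theorem exists_lamMul_soToLam_ne_zero (η : Fin 4 → ℤˣ) :
    ∃ (w : Lam 1) (X Y : So η), lamMul (m := 3) rfl w (soToLam η ⁅X, Y⁆) ≠ 0 := by
  -- Rotations in the planes 01 and 12, multiplied by η, bracket to one in the plane 02; its
  -- bivector is 2η₁ E₀∧E₂, and E₃ completes it to a nonzero trivector in any signature.
  let S : Matrix (Fin 4) (Fin 4) ℂ := !![0, 1, 0, 0; -1, 0, 0, 0; 0, 0, 0, 0; 0, 0, 0, 0]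
  let T : Matrix (Fin 4) (Fin 4) ℂ := !![0, 0, 0, 0; 0, 0, 1, 0; 0, -1, 0, 0; 0, 0, 0, 0]
  have hS : S.transpose = -S := by
    ext i j; fin_cases i <;> fin_cases j <;> simp [S]
  have hT : T.transpose = -T := by
    ext i j; fin_cases i <;> fin_cases j <;> simp [T]
  refine ⟨exteriorPower.ιMulti ℂ 1 ![Pi.single 3 1], ⟨_, mem_so hS⟩, ⟨_, mem_so hT⟩, fun h => ?_⟩
  have h' := congrArg detLam h
  have e : ∀ a b, detLam (lamMul (m := 3) rfl (exteriorPower.ιMulti ℂ 1 ![Pi.single 3 1])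
      (exteriorPower.ιMulti ℂ 2 ![Pi.single a 1, Pi.single b 1])) =
      (!![0, 0, 1, 0; 0, 0, 0, 0; -1, 0, 0, 0;
        0, 0, 0, 0] : Matrix (Fin 4) (Fin 4) ℂ) a b := by
    intro a b
    rw [lamMul_ιMulti]
    refine (detLam_ιMulti _).trans ?_
    have hm : (Matrix.of fun i j => (Fin.append ![Pi.single 3 1] ![Pi.single a 1, Pi.single b 1] :
        Fin 3 → Fin 4 → ℂ) i ((![0, 2, 3] : Fin 3 → Fin 4) j)) =
        !![0, 0, 1; (Pi.single a 1 : Fin 4 → ℂ) 0, (Pi.single a 1 : Fin 4 → ℂ) 2,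
          (Pi.single a 1 : Fin 4 → ℂ) 3; (Pi.single b 1 : Fin 4 → ℂ) 0,
          (Pi.single b 1 : Fin 4 → ℂ) 2, (Pi.single b 1 : Fin 4 → ℂ) 3] := by
      ext i j
      fin_cases i <;> fin_cases j <;> rfl
    rw [hm, Matrix.det_fin_three]
    fin_cases a <;> fin_cases b <;> simp
  have hc : ∀ (P Q : So η), ((⁅P, Q⁆ : So η) : Matrix (Fin 4) (Fin 4) ℂ) =
      (P : Matrix (Fin 4) (Fin 4) ℂ) * Q - (Q : Matrix (Fin 4) (Fin 4) ℂ) * P := fun _ _ => rfl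
  simp only [soToLam_apply, map_sum, map_smul, e, map_zero, hc] at h'
  have h0 := eta_sq η 0
  have h2 := eta_sq η 2
  have h1 := eta_sq η 1
  simp [Fin.sum_univ_four, S, T, Matrix.diagonal, Matrix.vecHead, Matrix.vecTail] at h'
  have h3 : 2 * (((η 1 : ℤ) : ℂ) * ((η 1 : ℤ) : ℂ)) = 0 := by
    linear_combination ((η 1 : ℤ) : ℂ) * h' - ((η 1 : ℤ) : ℂ) ^ 2 * h0 - ((η 1 : ℤ) : ℂ) ^ 2 * h2
  rw [h1, mul_one] at h3
  exact two_ne_zero h3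

end Nonvanishing

/-! ### Fields built from functions, and a frame for which e⋏[dρ, ω] is nonzero. -/

section Constants

variable {A : Type*} [CommRing A] [Algebra ℂ A] {η : Fin 4 → ℤˣ}

attribute [local instance] tensorEnvModule funEnvModule

variable (A) in
/-- Functions as forms of degree zero. -/
def zeroForm : A →ₗ[ℂ] Form A 0 where
  toFun f := AlternatingMap.constOfIsEmpty A (Vect A) (Fin 0) f
  map_add' _ _ := rfl
  map_smul' _ _ := rfl

theorem zeroForm_apply (f : A) (v : Fin 0 → Vect A) : zeroForm A f v = f := rfl

theorem isEquivariant_zeroForm : IsEquivariant A (zeroForm A) :=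
  isEquivariant_of_ι fun X f => by
    have h : uact A (Form A 0) (UniversalEnvelopingAlgebra.ι ℂ X) = lieRep 0 X :=
      UniversalEnvelopingAlgebra.lift_ι_apply ℂ _ X
    rw [uact_fun, h]
    ext v
    change X f = lieForm X (zeroForm A f) v
    rw [lieForm_apply, Finset.univ_eq_empty, Finset.sum_empty, sub_zero, zeroForm_apply]

theorem isEquivariant_vtmul {p : ℕ} {W : Type*} [AddCommGroup W] [Module ℂ W] (w : W) :
    IsEquivariant A (vtmul.flip w : Form A p →ₗ[ℂ] VForm A p W) :=
  isEquivariant_of_ι fun X α => by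
    have h : uact A (Form A p) (UniversalEnvelopingAlgebra.ι ℂ X) = lieRep p X :=
      UniversalEnvelopingAlgebra.lift_ι_apply ℂ _ X
    rw [uact_vform, h, LinearMap.flip_apply, LinearMap.flip_apply, vLie_vtmul]
    rfl

theorem isEquivariant_inl {V W : Type*} [AddCommGroup V] [Module ℂ V] [EnvModule A V]
    [AddCommGroup W] [Module ℂ W] [EnvModule A W] : IsEquivariant A (LinearMap.inl ℂ V W) :=
  fun u _ => Prod.ext rfl (map_zero (uact A W u)).symm

theorem isEquivariant_inr {V W : Type*} [AddCommGroup V] [Module ℂ V] [EnvModule A V]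
    [AddCommGroup W] [Module ℂ W] [EnvModule A W] : IsEquivariant A (LinearMap.inr ℂ V W) :=
  fun u _ => Prod.ext (map_zero (uact A V u)).symm rfl

variable (A) in
/-- The gauge parameter `(0, f Y)`. -/
def gaugeOf (Y : So η) : A →ₗ[ℂ] V0 A η :=
  LinearMap.inr ℂ _ _ ∘ₗ vtmul.flip Y ∘ₗ zeroForm A

variable (A η) in
/-- The field `(df w, 0)`. -/
def vielbeinOf (w : Lam 1) : A →ₗ[ℂ] V1 A η :=
  LinearMap.inl ℂ _ _ ∘ₗ vd 0 1 rfl ∘ₗ vtmul.flip w ∘ₗ zeroForm A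

variable (A) in
/-- The field `(0, df X)`. -/
def connectionOf (X : So η) : A →ₗ[ℂ] V1 A η :=
  LinearMap.inr ℂ _ _ ∘ₗ vd 0 1 rfl ∘ₗ vtmul.flip X ∘ₗ zeroForm A

theorem isEquivariant_gaugeOf (Y : So η) : IsEquivariant A (gaugeOf A Y) :=
  isEquivariant_inr.comp ((isEquivariant_vtmul Y).comp isEquivariant_zeroForm)

theorem isEquivariant_vielbeinOf (w : Lam 1) : IsEquivariant A (vielbeinOf A η w) :=
  isEquivariant_inl.comp ((isEquivariant_vd_zero rfl).comp
    ((isEquivariant_vtmul w).comp isEquivariant_zeroForm))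

theorem isEquivariant_connectionOf (X : So η) : IsEquivariant A (connectionOf A X) :=
  isEquivariant_inr.comp ((isEquivariant_vd_zero rfl).comp
    ((isEquivariant_vtmul X).comp isEquivariant_zeroForm))

/-- If the star deformation of a trilinear map vanishes on the diagonal, then the trilinear map
itself is antisymmetric on the values of equivariant maps of functions. -/
theorem add_swap_eq_zero_of_star₃ (𝓕 : DrinfeldTwist A) (hA : HasPoints A) {L V X : Type*}
    [AddCommGroup L] [Module ℂ L] [AddCommGroup V] [Module ℂ V] [AddCommGroup X] [Module ℂ X]
    [EnvModule A L] [EnvModule A V] {T : L →ₗ[ℂ] V →ₗ[ℂ] V →ₗ[ℂ] X}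
    (hT : ∀ (l : FPS L) (v : FPS V), 𝓕.star₃ T l v v = 0) {f : A →ₗ[ℂ] L} {g h : A →ₗ[ℂ] V}
    (hf : IsEquivariant A f) (hg : IsEquivariant A g) (hh : IsEquivariant A h) (a b c : A) :
    T (f a) (g b) (h c) + T (f a) (h c) (g b) = 0 := by
  -- Polarization of the vanishing on the diagonal.
  have hp : ∀ (l : FPS L) (u v : FPS V), 𝓕.star₃ T l u v + 𝓕.star₃ T l v u = 0 := by
    intro l u v
    have e := hT l (u + v)
    rw [map_add, LinearMap.map_add₂, LinearMap.map_add₂, hT, hT, zero_add, add_zero,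
      add_comm] at e
    exact e
  -- Equivariance of f, g, h moves the twist onto the functions a, b, c, where its leading
  -- coefficient is known to act trivially.
  have e := congrFun (hp (FPS.map f (FPS.const a)) (FPS.map g (FPS.const b))
    (FPS.map h (FPS.const c))) 0
  rw [𝓕.star₃_map hf hg hh, 𝓕.star₃_map hf hh hg, Pi.add_apply,
    𝓕.star₃_const_coeff_zero hA, 𝓕.star₃_const_coeff_zero hA] at e
  exact e

/-- Functions and vector fields which are dual to each other at a point. -/
def HasFrame (A : Type*) [CommRing A] [Algebra ℂ A] : Prop :=
  ∃ (f : Fin 3 → A) (D : Fin 3 → Vect A) (φ : A →ₐ[ℂ] ℂ), ∀ i j, φ (D i (f j)) = if i = j then 1 else 0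

/-- Evaluated on the dual vector fields at the point, the three-form is the determinant of a
permutation matrix. -/
theorem HasFrame.wedge_ne_zero (hA : HasFrame A) : ∃ a b c : A,
    wedge (p := 1) (q := 2) rfl (extD 0 (zeroForm A b))
      (wedge (p := 1) (q := 1) rfl (extD 0 (zeroForm A a)) (extD 0 (zeroForm A c))) ≠ 0 := by
  obtain ⟨f, D, φ, h⟩ := hA
  refine ⟨f 0, f 1, f 2, fun e => ?_⟩
  have e' := congrArg φ (DFunLike.congr_fun e ![D 0, D 1, D 2])
  rw [wedge_one_two_apply, wedge_one_one_apply, wedge_one_one_apply, wedge_one_one_apply] at e'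
  simp only [extD_zero_apply, zeroForm_apply, map_add, map_sub, map_mul, h,
    AlternatingMap.zero_apply, map_zero] at e'
  norm_num [Fin.ext_iff] at e'

theorem tmul_ne_zero_of_ne_zero {V W : Type*} [AddCommGroup V] [Module ℂ V] [AddCommGroup W]
    [Module ℂ W] {v : V} {w : W} (hv : v ≠ 0) (hw : w ≠ 0) : v ⊗ₜ[ℂ] w ≠ 0 := by
  obtain ⟨f, hf⟩ := not_forall.1 (mt (Module.forall_dual_apply_eq_zero_iff ℂ v).1 hv)
  obtain ⟨g, hg⟩ := not_forall.1 (mt (Module.forall_dual_apply_eq_zero_iff ℂ w).1 hw)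
  intro e
  have e' := congrArg (LinearMap.mul' ℂ ℂ ∘ₗ TensorProduct.map f g) e
  rw [map_zero] at e'
  exact mul_ne_zero hf hg e'

theorem exists_curlySo_ne_zero (hA : HasFrame A) (η : Fin 4 → ℤˣ) :
    ∃ (w : Lam 1) (Y X : So η) (a b c : A),
      (curlySo (m := 3) rfl rfl (vielbeinOf A η w b).1
        (soBr (r := 2) rfl (vd 0 1 rfl (gaugeOf A Y a).2) (connectionOf A X c).2) :
          VForm A 3 (Lam 3)) ≠ 0 := by
  obtain ⟨w, Y, X, h⟩ := exists_lamMul_soToLam_ne_zero η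
  obtain ⟨a, b, c, h'⟩ := hA.wedge_ne_zero
  refine ⟨w, Y, X, a, b, c, ?_⟩
  change curlySo (m := 3) rfl rfl (vd 0 1 rfl (vtmul (zeroForm A b) w))
    (soBr (r := 2) rfl (vd 0 1 rfl (vtmul (zeroForm A a) Y))
      (vd 0 1 rfl (vtmul (zeroForm A c) X))) ≠ 0
  rw [vd_vtmul_zero, vd_vtmul_zero, vd_vtmul_zero, soBr, formMul_vtmul, curlySo, formMul_vtmul]
  exact tmul_ne_zero_of_ne_zero h' h

end Constants

/-! ### The three terms that fail to be covariant. -/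

section NonCovariance

variable {A : Type*} [CommRing A] [Algebra ℂ A] {η : Fin 4 → ℤˣ}

attribute [local instance] tensorEnvModule funEnvModule

/-- Test on one field with only a vielbein and another with only a connection. The polarized anomaly
is then a nonzero multiple of e⋏[dρ, ω], while covariance would make it zero. -/
theorem not_isCovariant_deform (𝓕 : DrinfeldTwist A) (hA : HasPoints A) (hA' : HasFrame A)
    {b : V1 A η →ₗ[ℂ] V1 A η →ₗ[ℂ] VForm A 3 (Lam 3)}
    {t : V1 A η →ₗ[ℂ] V1 A η →ₗ[ℂ] V1 A η →ₗ[ℂ] VForm A 3 (Lam 3)} (h : IsAdmissible b t) {c : ℂ}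
    (hc : c ≠ 0) (hT : ∀ (lam : V0 A η) (a a' : V1 A η), a.2 = 0 → a'.1 = 0 →
      fieldAnomaly b t lam a a' + fieldAnomaly b t lam a' a =
        c • curlySo (m := 3) rfl rfl a.1 (soBr (r := 2) rfl (vd 0 1 rfl lam.2) a'.2)) :
    ¬ (𝓕.deform b t).IsCovariant 𝓕 := by
  intro hcov
  obtain ⟨w, Y, X, f, g, k, hne⟩ := exists_curlySo_ne_zero hA' η
  have e := add_swap_eq_zero_of_star₃ 𝓕 hA ((isCovariant_deform_iff 𝓕 h).1 hcov)
    (isEquivariant_gaugeOf Y) (isEquivariant_vielbeinOf w) (isEquivariant_connectionOf X) f g k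
  exact smul_ne_zero hc hne ((hT (gaugeOf A Y f) (vielbeinOf A η w g) (connectionOf A X k)
    rfl rfl).symm.trans e)

theorem not_isCovariant_exprEDω (𝓕 : DrinfeldTwist A) (hA : HasPoints A) (hA' : HasFrame A) :
    ¬ (𝓕.exprEDω η).IsCovariant 𝓕 := by
  rw [𝓕.exprEDω_eq]
  refine not_isCovariant_deform 𝓕 hA hA' isAdmissible_ER_zero (c := -1) (by norm_num)
    fun lam a a' h h' => ?_
  rw [fieldAnomaly_EDω_apply, fieldAnomaly_EDω_apply, h', map_zero, LinearMap.zero_apply, neg_zero,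
    add_zero, neg_one_smul]

theorem not_isCovariant_exprDωE (𝓕 : DrinfeldTwist A) (hA : HasPoints A) (hA' : HasFrame A) :
    ¬ (𝓕.exprDωE η).IsCovariant 𝓕 := by
  rw [𝓕.exprDωE_eq]
  refine not_isCovariant_deform 𝓕 hA hA' isAdmissible_RE_zero (c := -1) (by norm_num)
    fun lam a a' h h' => ?_
  rw [fieldAnomaly_DωE_apply, fieldAnomaly_DωE_apply, h', map_zero, neg_zero, zero_add,
    soCurly_comm rfl rfl, neg_one_smul]

theorem not_isCovariant_exprEωω (𝓕 : DrinfeldTwist A) (hA : HasPoints A) (hA' : HasFrame A) :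
    ¬ (𝓕.exprEωω η).IsCovariant 𝓕 := by
  rw [𝓕.exprEωω_eq]
  -- Both orders of the two fields contribute the same term here, whence 2; for the other two
  -- expressions only one order contributes.
  refine not_isCovariant_deform 𝓕 hA hA' isAdmissible_Eωω (c := 2) (by norm_num)
    fun lam a a' h h' => ?_
  rw [fieldAnomaly_Eωω_apply, fieldAnomaly_Eωω_apply, h, h', map_zero, map_zero, map_zero,
    LinearMap.zero_apply, soCurly_comm rfl rfl, two_smul, add_zero]
  exact congrArg _ (zero_add _)

end NonCovariance

/-! ### Points and frames on a manifold from charts and bump functions. -/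

section Charts

variable {M : Type*} [TopologicalSpace M] [ChartedSpace (EuclideanSpace ℝ (Fin 4)) M]

theorem hasPoints_smoothFunctions : HasPoints (SmoothFunctions M) := fun _ h =>
  Subtype.ext (funext fun x => h ((Pi.evalAlgHom ℂ (fun _ : M => ℂ) x).comp (SmoothFunctions M).val))

variable [IsManifold (𝓡 4) ((⊤ : ℕ∞) : WithTop ℕ∞) M]

theorem contDiffOn_chart (x : M) (f : SmoothFunctions M) : ContDiffOn ℝ ((⊤ : ℕ∞) : WithTop ℕ∞)
    ((f : M → ℂ) ∘ (extChartAt (𝓡 4) x).symm) (extChartAt (𝓡 4) x).target :=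
  contMDiffOn_iff_contDiffOn.1 (ContMDiff.comp_contMDiffOn f.2 (contMDiffOn_extChartAt_symm x))

theorem differentiableAt_chart (x : M) (f : SmoothFunctions M) {y : M}
    (hy : y ∈ (chartAt (EuclideanSpace ℝ (Fin 4)) x).source) :
    DifferentiableAt ℝ ((f : M → ℂ) ∘ (extChartAt (𝓡 4) x).symm) (extChartAt (𝓡 4) x y) :=
  ((contDiffOn_chart x f).contDiffAt ((isOpen_extChartAt_target x).mem_nhds
    ((extChartAt (𝓡 4) x).map_source ((extChartAt_source (𝓡 4) x).symm ▸ hy)))).differentiableAt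
      (by simp)

/-- The derivative of a function in the direction of a coordinate of a chart. -/
def chartDeriv (x : M) (i : Fin 4) (f : M → ℂ) (y : M) : ℂ :=
  fderiv ℝ (f ∘ (extChartAt (𝓡 4) x).symm) (extChartAt (𝓡 4) x y) (EuclideanSpace.single i 1)

theorem contMDiffOn_chartDeriv (x : M) (i : Fin 4) (f : SmoothFunctions M) :
    ContMDiffOn (𝓡 4) 𝓘(ℝ, ℂ) ((⊤ : ℕ∞) : WithTop ℕ∞) (chartDeriv x i f)
      (chartAt (EuclideanSpace ℝ (Fin 4)) x).source := by
  have h : ContDiffOn ℝ ((⊤ : ℕ∞) : WithTop ℕ∞) (fun z => fderiv ℝ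
      ((f : M → ℂ) ∘ (extChartAt (𝓡 4) x).symm) z (EuclideanSpace.single i 1))
      (extChartAt (𝓡 4) x).target :=
    ((contDiffOn_chart x f).fderiv_of_isOpen (isOpen_extChartAt_target x) le_rfl).clm_apply
      contDiffOn_const
  refine h.contMDiffOn.comp contMDiffOn_extChartAt fun y hy => ?_
  exact (extChartAt (𝓡 4) x).map_source ((extChartAt_source (𝓡 4) x).symm ▸ hy)

variable [T2Space M]

/-- A coordinate vector field, cut off by a bump function. -/
def chartVect {x : M} (ψ : SmoothBumpFunction (𝓡 4) x) (i : Fin 4) : Vect (SmoothFunctions M) :=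
  Derivation.mk'
    { toFun f := ⟨fun y => ψ y • chartDeriv x i f y, ψ.contMDiff_smul (contMDiffOn_chartDeriv x i f)⟩
      map_add' f g := by
        refine Subtype.ext (funext fun y => ?_)
        change ψ y • chartDeriv x i (f + g) y = ψ y • chartDeriv x i f y + ψ y • chartDeriv x i g y
        -- Differentiability in the chart is available only on its source; elsewhere the bump
        -- function vanishes.
        by_cases hy : y ∈ (chartAt (EuclideanSpace ℝ (Fin 4)) x).source
        · rw [← smul_add]
          exact congrArg (ψ y • ·) (congrArg (· (EuclideanSpace.single i 1)) (fderiv_add (differentiableAt_chart x f hy)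
            (differentiableAt_chart x g hy)))
        · rw [Function.notMem_support.1 fun h => hy (ψ.support_subset_source h)]
          simp only [zero_smul, add_zero]
      map_smul' c f := by
        refine Subtype.ext (funext fun y => ?_)
        change ψ y • chartDeriv x i (c • (f : M → ℂ)) y = c • ψ y • chartDeriv x i f y
        by_cases hy : y ∈ (chartAt (EuclideanSpace ℝ (Fin 4)) x).source
        · rw [smul_comm]
          exact congrArg (ψ y • ·) (congrArg (· (EuclideanSpace.single i 1))
            (fderiv_const_smul (differentiableAt_chart x f hy) c))
        · rw [Function.notMem_support.1 fun h => hy (ψ.support_subset_source h)]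
          simp only [zero_smul, smul_zero] }
    fun f g => by
      refine Subtype.ext (funext fun y => ?_)
      change ψ y • chartDeriv x i (f * g) y =
        (f : M → ℂ) y * (ψ y • chartDeriv x i g y) + (g : M → ℂ) y * (ψ y • chartDeriv x i f y)
      by_cases hy : y ∈ (chartAt (EuclideanSpace ℝ (Fin 4)) x).source
      · have e : chartDeriv x i (f * g) y = _ := congrArg (· (EuclideanSpace.single i 1))
          (fderiv_mul (differentiableAt_chart x f hy) (differentiableAt_chart x g hy))
        have hs : (extChartAt (𝓡 4) x).symm (extChartAt (𝓡 4) x y) = y :=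
          (extChartAt (𝓡 4) x).left_inv ((extChartAt_source (𝓡 4) x).symm ▸ hy)
        rw [e]
        simp only [add_apply, smul_apply,
          Function.comp_apply, hs, smul_eq_mul, chartDeriv, smul_add, mul_smul_comm]
      · rw [Function.notMem_support.1 fun h => hy (ψ.support_subset_source h)]
        simp only [zero_smul, mul_zero, add_zero]

/-- A coordinate of a chart, cut off by a bump function. -/
def chartFun {x : M} (ψ : SmoothBumpFunction (𝓡 4) x) (j : Fin 4) : SmoothFunctions M :=
  ⟨fun y => ψ y • ((extChartAt (𝓡 4) x y j : ℝ) : ℂ), ψ.contMDiff_smul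
    ((Complex.ofRealCLM ∘L EuclideanSpace.proj j).contMDiff.comp_contMDiffOn contMDiffOn_extChartAt)⟩

/-- Near x the bump function is 1, so the cut-off coordinate agrees there with the linear coordinate
function. -/
theorem chartVect_chartFun {x : M} (ψ : SmoothBumpFunction (𝓡 4) x) (i j : Fin 4) :
    (chartVect ψ i (chartFun ψ j) : M → ℂ) x = if i = j then 1 else 0 := by
  change ψ x • fderiv ℝ ((chartFun ψ j : M → ℂ) ∘ (extChartAt (𝓡 4) x).symm)
    (extChartAt (𝓡 4) x x) (EuclideanSpace.single i 1) = _
  have h : ((chartFun ψ j : M → ℂ) ∘ (extChartAt (𝓡 4) x).symm) =ᶠ[nhds (extChartAt (𝓡 4) x x)]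
      (Complex.ofRealCLM ∘L EuclideanSpace.proj j : EuclideanSpace ℝ (Fin 4) →L[ℝ] ℂ) := by
    have hc : Filter.Tendsto (extChartAt (𝓡 4) x).symm (nhds (extChartAt (𝓡 4) x x)) (nhds x) := by
      have := (continuousAt_extChartAt_symm (I := 𝓡 4) x).tendsto
      rwa [extChartAt_to_inv] at this
    filter_upwards [hc.eventually ψ.eventuallyEq_one, extChartAt_target_mem_nhds (I := 𝓡 4) x]
      with z hz hz'
    change ψ _ • ((extChartAt (𝓡 4) x ((extChartAt (𝓡 4) x).symm z) j : ℝ) : ℂ) = ((z j : ℝ) : ℂ)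
    rw [hz, (extChartAt (𝓡 4) x).right_inv hz', Pi.one_apply, one_smul]
  rw [h.fderiv_eq, ContinuousLinearMap.fderiv, ψ.eq_one, one_smul]
  change (((EuclideanSpace.single i (1 : ℝ)) j : ℝ) : ℂ) = _
  rw [PiLp.single_apply]
  simp only [eq_comm (a := j), apply_ite Complex.ofReal, Complex.ofReal_one, Complex.ofReal_zero]

theorem hasFrame_smoothFunctions [Nonempty M] : HasFrame (SmoothFunctions M) := by
  obtain ⟨x⟩ := ‹Nonempty M›
  obtain ⟨ψ⟩ : Nonempty (SmoothBumpFunction (𝓡 4) x) := inferInstance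
  -- A three-form needs only three of the four coordinate directions.
  refine ⟨fun j => chartFun ψ j.castSucc, fun i => chartVect ψ i.castSucc,
    (Pi.evalAlgHom ℂ (fun _ : M => ℂ) x).comp (SmoothFunctions M).val, fun i j => ?_⟩
  refine (chartVect_chartFun ψ _ _).trans ?_
  simp only [Fin.castSucc_inj]

end Charts

end BraidedECP

end

theorem mainTheorem6
    {M : Type*} [TopologicalSpace M] [T2Space M] [SecondCountableTopology M] [Nonempty M]
    [ChartedSpace (EuclideanSpace ℝ (Fin 4)) M]
    [IsManifold (𝓡 4) ((⊤ : ℕ∞) : WithTop ℕ∞) M]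
    (η : Fin 4 → ℤˣ) (Λ : ℝ) (𝓕 : DrinfeldTwist (SmoothFunctions M)) :
    -- the torsion equation
    (∀ (e : FPS (VForm (SmoothFunctions M) 1 (Lam 1))) (ω : FPS (VForm (SmoothFunctions M) 1 (So η))),
      𝓕.eqω Λ e ω = (1 / 6 : ℂ) • ((𝓕.cur) e (𝓕.torsionL e ω) - (𝓕.cur) (𝓕.torsionR e ω) e
        - 𝓕.covDL ω (𝓕.ee e e) - 𝓕.covDR ω (𝓕.ee e e))) ∧
    -- the Einstein equation
    (∀ (e : FPS (VForm (SmoothFunctions M) 1 (Lam 1))) (ω : FPS (VForm (SmoothFunctions M) 1 (So η))),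
      𝓕.eqE Λ e ω = (1 / 6 : ℂ) • ((2 : ℂ) • (𝓕.curR) e (𝓕.curvature ω)
        + (2 : ℂ) • (𝓕.curL) (𝓕.curvature ω) e + (6 * Λ : ℂ) • (𝓕.cur) e (𝓕.ee e e)
        + ((𝓕.curR) e (D₁ ω) + (𝓕.curL) (D₁ ω) e + 𝓕.braidedTerm ω e ω))) ∧
    -- braided covariance of the field equations and of their building blocks
    ((𝓕.exprω η Λ).IsCovariant 𝓕 ∧ (𝓕.exprETL η).IsCovariant 𝓕 ∧ (𝓕.exprTRE η).IsCovariant 𝓕 ∧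
      (𝓕.exprDL η).IsCovariant 𝓕 ∧ (𝓕.exprDR η).IsCovariant 𝓕) ∧
    ((𝓕.exprE η Λ).IsCovariant 𝓕 ∧ (𝓕.exprER η).IsCovariant 𝓕 ∧ (𝓕.exprRE η).IsCovariant 𝓕 ∧
      (𝓕.exprEEE η).IsCovariant 𝓕) ∧
    -- the last three terms: covariant together, but not one by one
    (Expression.IsCovariant 𝓕 (𝓕.exprEDω η + 𝓕.exprDωE η + 𝓕.exprEωω η) ∧
      ¬ (𝓕.exprEDω η).IsCovariant 𝓕 ∧ ¬ (𝓕.exprDωE η).IsCovariant 𝓕 ∧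
      ¬ (𝓕.exprEωω η).IsCovariant 𝓕) ∧
    -- the classical form of the field equations for a trivial R-matrix
    (𝓕.R = 1 →
      ∀ (e : FPS (VForm (SmoothFunctions M) 1 (Lam 1)))
        (ω : FPS (VForm (SmoothFunctions M) 1 (So η))),
        𝓕.torsionL e ω = 𝓕.torsionR e ω ∧
        𝓕.eqω Λ e ω = (𝓕.cur) e (𝓕.torsionL e ω) ∧
        𝓕.eqE Λ e ω = (𝓕.curR) e (𝓕.curvature ω) + (Λ : ℂ) • (𝓕.cur) e (𝓕.ee e e)) ∧
    -- the classical field equations for the trivial twist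
    (𝓕.F = 1 →
      ∀ (e : VForm (SmoothFunctions M) 1 (Lam 1)) (ω : VForm (SmoothFunctions M) 1 (So η)),
        𝓕.eqω Λ (FPS.const e) (FPS.const ω) =
          FPS.const ((curly) e (d₁ e + (soTri) ω e)) ∧
        𝓕.eqE Λ (FPS.const e) (FPS.const ω) =
          FPS.const ((curlySo) e (d₁ ω + (1 / 2 : ℂ) • (soBr) ω ω) +
            (Λ : ℂ) • (curly) e ((curly) e e : VForm (SmoothFunctions M) 2 (Lam 2)))) := by
  refine ⟨𝓕.torsion_equation Λ, 𝓕.einstein_equation Λ,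
    ⟨𝓕.isCovariant_exprω Λ, 𝓕.isCovariant_exprETL, 𝓕.isCovariant_exprTRE, 𝓕.isCovariant_exprDL,
      𝓕.isCovariant_exprDR⟩,
    ⟨𝓕.isCovariant_exprE Λ, 𝓕.isCovariant_exprER, 𝓕.isCovariant_exprRE, 𝓕.isCovariant_exprEEE⟩,
    ⟨𝓕.isCovariant_sum, ?_, ?_, ?_⟩,
    fun h e ω => ⟨DrinfeldTwist.torsionL_eq_torsionR h e ω, DrinfeldTwist.eqω_of_R_eq_one h Λ e ω,
      DrinfeldTwist.eqE_of_R_eq_one h Λ e ω⟩,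
    fun h e ω => ⟨DrinfeldTwist.eqω_of_F_eq_one h Λ e ω, DrinfeldTwist.eqE_of_F_eq_one h Λ e ω⟩⟩
  · exact not_isCovariant_exprEDω 𝓕 hasPoints_smoothFunctions hasFrame_smoothFunctions
  · exact not_isCovariant_exprDωE 𝓕 hasPoints_smoothFunctions hasFrame_smoothFunctions
  · exact not_isCovariant_exprEωω 𝓕 hasPoints_smoothFunctions hasFrame_smoothFunctions
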